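/- Throughout, $G$ is a (discrete) group with unit $e$. A W*-algebra is a C*-algebra with a Banach space predual; "W*-ideal" means w*-closed two-sided *-ideal, and $Z(\cdot)$ denotes the centre. **Partial actions.** A partial action $\gamma$ of $G$ on a set $X$ consists of subsets $X_t\subseteq X$ and bijections $\gamma_t\colon X_{t^{-1}}\to X_t$ $(t\in G)$ with $X_e=X$, $\gamma_e=\mathrm{id}$, and such that $x\in X_{t^{-1}}$, $\gamma_t(x)\in X_{s^{-1}}$ imply $x\in X_{(st)^{-1}}$ and $\gamma_{st}(x)=\gamma_s(\gamma_t(x))$. It is global if $X_t=X$ for all $t$. Its restriction to $Y\subseteq X$ has the domains $Y_t=Y\cap\gamma_t(X_{t^{-1}}\cap Y)$ and the maps $\gamma_t|_{Y_{t^{-1}}}$. A W*-partial action on a W*-algebra is a partial action whose domains are W*-ideals and whose maps are w*-continuous *-isomorphisms. A W*-enveloping action of a W*-partial action $\gamma$ on $A$ is a global W*-action $\delta$ of $G$ on a W*-algebra $N$ for which there are a W*-ideal $J$ of $N$ such that $\operatorname{span}\bigcup_{t}\delta_t(J)$ is w*-dense in $N$, and a *-isomorphism $\iota\colon A\to J$,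 w*-continuous together with its inverse, such that $\iota$ is an isomorphism of partial actions from $\gamma$ onto the restriction of $\delta$ to $J$ (that is, $\iota$ and $\iota^{-1}$ map domains into the corresponding domains and are equivariant). **W*-Fell bundles.** A W*-Fell bundle $\mathcal M=\{M_t\}_{t\in G}$ is a Fell bundle over $G$ whose fibres are dual Banach spaces, such that the involutions $b\mapsto b^*$ and the left multiplications $b\mapsto ab$ are w*-continuous. Let $I_t$ be the w*-closed linear span of $M_tM_t^*$ in $M_e$. The central partial action of $\mathcal M$ is the partial action $\sigma$ of $G$ on $Z(M_e)$ whose domain at $t$ is $Z(I_t)\subseteq Z(M_e)$ and such that $\sigma_t(z)x=xz$ for all $z\in Z(I_{t^{-1}})$, $x\in M_t$. **The W*-algebra of kernels.** Let $\ell^2_{w^*}(\mathcal M)$ be the space of all sections $\xi\in\prod_t M_t$ for which the sums $\sum_{t\in F}\xi(t)^*\xi(t)$, $F\subseteq G$ finite, are bounded; it is a right Hilbert module over $M_e$ with $(\xi b)(t)=\xi(t)b$ and $\langle\xi,\eta\rangle=\sum_t\xi(t)^*\eta(t)$ (w*-convergent). Its algebra $\mathcal L=\mathcal L(\ell^2_{w^*}(\mathcal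 M))$ of adjointable operators is a W*-algebra, whose predual is the norm closed linear span of the functionals $T\mapsto\varphi(\langle\xi,T\eta\rangle)$, with $\varphi$ in the predual of $M_e$; and the predual of $\ell^\infty(G,\mathcal L)$ is the norm closed linear span of the functionals $f\mapsto\psi(f(t))$, with $t\in G$ and $\psi$ in the predual of $\mathcal L$. For a finitely supported kernel $k$ (with $k(r,s)\in M_{rs^{-1}}$) put $(\pi(k)\xi)(r)=\sum_s k(r,s)\xi(s)$, $\beta_t(k)(r,s)=k(rt,st)$ and $\pi^\beta(k)(t)=\pi(\beta_t^{-1}(k))$, so that $\pi^\beta(k)\in\ell^\infty(G,\mathcal L)$. The W*-algebra of kernels $\Bbbk_{w^*}(\mathcal M)$ is the w*-closure in $\ell^\infty(G,\mathcal L)$ of the set of all $\pi^\beta(k)$, and the canonical action $\beta^{w^*}$ of $G$ on it is the restriction of the translation action $\gamma_t(f)(s)=f(t^{-1}s)$ of $\ell^\infty(G,\mathcal L)$. **Theorem.** Let $\mathcal M$ be a W*-Fell bundle over a group $G$. Then $\mathcal M$ has exactly one central partial action $\sigma$, it is a W*-partial action of $G$ on $Z(M_e)$, and the restriction of $\beta^{w^*}$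 to the centre of $\Bbbk_{w^*}(\mathcal M)$ is a (global) W*-action which is the W*-enveloping action of $\sigma$. -/

import Mathlib

open scoped ENNReal Topology

set_option linter.unusedSectionVars false

universe u v

noncomputable section

/-! ### Weak-star topologies and preduals -/

section WStar

variable {E F : Type*} [NormedAddCommGroup E] [NormedSpace ℂ E]
  [NormedAddCommGroup F] [NormedSpace ℂ F]

/-- The topology on `E` induced by a linear space `P` of bounded functionals. If `P` is a predual
of `E`, this is the weak-star topology of `E`. -/
@[reducible] def wstarTopology (P : Submodule ℂ (StrongDual ℂ E)) : TopologicalSpace E :=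
  ⨅ φ : P, TopologicalSpace.induced (fun x : E => (φ : StrongDual ℂ E) x) inferInstance

/-- `P` is a predual of `E`: a norm closed (hence Banach) space of functionals on `E` such that
the canonical map `x ↦ (φ ↦ φ x)` from `E` to the Banach dual of `P` is isometric and onto. -/
structure IsPredual (P : Submodule ℂ (StrongDual ℂ E)) : Prop where
  isClosed : IsClosed (P : Set (StrongDual ℂ E))
  norm_le : ∀ (x : E) (C : ℝ), 0 ≤ C → (∀ φ ∈ P, ‖φ x‖ ≤ C * ‖φ‖) → ‖x‖ ≤ C
  surjective : ∀ Λ : P →ₗ[ℂ] ℂ, (∃ C : ℝ, ∀ φ : P, ‖Λ φ‖ ≤ C * ‖(φ : StrongDual ℂ E)‖) →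
    ∃ x : E, ∀ φ : P, Λ φ = (φ : StrongDual ℂ E) x

theorem continuous_wstar {P : Submodule ℂ (StrongDual ℂ E)} {φ : StrongDual ℂ E} (h : φ ∈ P) :
    Continuous[wstarTopology P, inferInstance] φ :=
  continuous_iInf_dom (i := (⟨φ, h⟩ : P)) continuous_induced_dom

theorem continuous_to_wstar {X : Type*} [TopologicalSpace X] {P : Submodule ℂ (StrongDual ℂ E)}
    {f : X → E} (h : ∀ φ ∈ P, Continuous fun x => φ (f x)) :
    Continuous[inferInstance, wstarTopology P] f :=
  continuous_iInf_rng.2 fun φ => continuous_induced_rng.2 (h φ φ.2)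

theorem norm_le_wstar (P : Submodule ℂ (StrongDual ℂ E)) :
    (inferInstance : TopologicalSpace E) ≤ wstarTopology P :=
  le_iInf fun φ => continuous_iff_le_induced.1 (φ : StrongDual ℂ E).continuous

theorem isClosed_of_wstar {P : Submodule ℂ (StrongDual ℂ E)} {s : Set E}
    (h : @IsClosed E (wstarTopology P) s) : IsClosed s :=
  h.mono (norm_le_wstar P)

/-- A linear functional that is weak-star continuous belongs to the predual. -/
theorem mem_of_continuous_wstar {P : Submodule ℂ (StrongDual ℂ E)} {ψ : StrongDual ℂ E}
    (h : Continuous[wstarTopology P, inferInstance] ψ) : ψ ∈ P := by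
  have h1 := (LinearMap.mem_span_iff_continuous
    (f := fun φ : P => ((φ : StrongDual ℂ E) : E →ₗ[ℂ] ℂ)) (ψ : E →ₗ[ℂ] ℂ)).2 h
  have h2 : Submodule.span ℂ (Set.range fun φ : P => ((φ : StrongDual ℂ E) : E →ₗ[ℂ] ℂ)) ≤
      P.map (ContinuousLinearMap.coeLM ℂ) := by
    rw [Submodule.span_le]
    rintro _ ⟨φ, rfl⟩
    exact ⟨φ, φ.2, rfl⟩
  obtain ⟨φ, hφ, he⟩ := h2 h1
  have : φ = ψ := ContinuousLinearMap.coe_injective he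
  exact this ▸ hφ

/-- The weak-star limit of elements of norm at most `R` has norm at most `R`. -/
theorem IsPredual.norm_le_of_tendsto {P : Submodule ℂ (StrongDual ℂ E)} (hP : IsPredual P)
    {ι : Type*} {l : Filter ι} [l.NeBot] {f : ι → E} {a : E} {R : ℝ} (hR : 0 ≤ R)
    (hf : ∀ᶠ i in l, ‖f i‖ ≤ R)
    (h : ∀ φ ∈ P, Filter.Tendsto (fun i => φ (f i)) l (𝓝 (φ a))) : ‖a‖ ≤ R := by
  refine hP.norm_le a R hR fun φ hφ => ?_
  refine le_of_tendsto (h φ hφ).norm (hf.mono fun i hi => ?_)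
  rw [mul_comm]
  exact (φ.le_opNorm _).trans (by gcongr)

/-- Weak-star compactness of balls, in terms of ultrafilters. -/
theorem IsPredual.exists_ultrafilter_limit {P : Submodule ℂ (StrongDual ℂ E)} (hP : IsPredual P)
    {ι : Type*} (U : Ultrafilter ι) {f : ι → E} {R : ℝ} (hf : ∀ i, ‖f i‖ ≤ R) :
    ∃ a : E, ∀ φ ∈ P, Filter.Tendsto (fun i => φ (f i)) U (𝓝 (φ a)) := by
  have key : ∀ φ : P, ∃ z : ℂ, ‖z‖ ≤ R * ‖(φ : StrongDual ℂ E)‖ ∧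
      Filter.Tendsto (fun i => (φ : StrongDual ℂ E) (f i)) U (𝓝 z) := by
    intro φ
    have hc : IsCompact (Metric.closedBall (0 : ℂ) (R * ‖(φ : StrongDual ℂ E)‖)) :=
      isCompact_closedBall _ _
    have hm : ∀ i, (φ : StrongDual ℂ E) (f i) ∈
        Metric.closedBall (0 : ℂ) (R * ‖(φ : StrongDual ℂ E)‖) := fun i => by
      rw [mem_closedBall_zero_iff, mul_comm]
      exact (ContinuousLinearMap.le_opNorm _ _).trans (by gcongr; exact hf i)
    obtain ⟨z, hz, hlim⟩ := hc.ultrafilter_le_nhds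
      (U.map fun i => (φ : StrongDual ℂ E) (f i))
      (Filter.le_principal_iff.2 (Filter.mem_map.2 (Filter.univ_mem' hm)))
    exact ⟨z, by simpa using hz, hlim⟩
  choose Λ hΛ hlim using key
  let Λ' : P →ₗ[ℂ] ℂ :=
    { toFun := Λ
      map_add' := fun φ ψ => tendsto_nhds_unique (hlim (φ + ψ)) (by
        simpa using (hlim φ).add (hlim ψ))
      map_smul' := fun c φ => tendsto_nhds_unique (hlim (c • φ)) (by
        simpa using (hlim φ).const_mul c) }
  obtain ⟨x, hx⟩ := hP.surjective Λ' ⟨R, hΛ⟩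
  refine ⟨x, fun φ hφ => ?_⟩
  have := hlim ⟨φ, hφ⟩
  rwa [show Λ ⟨φ, hφ⟩ = φ x from hx ⟨φ, hφ⟩] at this

theorem IsPredual.ext {P : Submodule ℂ (StrongDual ℂ E)} (hP : IsPredual P) {x y : E}
    (h : ∀ φ ∈ P, φ x = φ y) : x = y := by
  rw [← sub_eq_zero, ← norm_le_zero_iff]
  refine hP.norm_le _ 0 le_rfl fun φ hφ => ?_
  simp [h φ hφ]

end WStar

/-! ### Monotone weak-star limits in a C*-algebra with a predual -/

section Positive

variable {A : Type*} [NonUnitalCStarAlgebra A]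

/-- The involution and the right multiplications of `A` are weak-star continuous, in terms of the
predual. -/
structure IsStarPredual (P : Submodule ℂ (StrongDual ℂ A)) : Prop extends IsPredual P where
  star_mem : ∀ φ ∈ P, ∃ ψ ∈ P, ∀ x : A, ψ x = star (φ (star x))
  mul_right_mem : ∀ φ ∈ P, ∀ b : A, ∃ ψ ∈ P, ∀ x : A, ψ x = φ (x * b)

variable [PartialOrder A] [StarOrderedRing A]

theorem norm_smul_sub_mul_le {q b : A} {R : ℝ} (hq : 0 ≤ q) (hqR : ‖q‖ ≤ R) :
    ‖(R : ℂ) • b - q * b‖ ≤ R * ‖b‖ := by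
  lift R to NNReal using (norm_nonneg _).trans hqR
  have hsa : IsSelfAdjoint (q : Unitization ℂ A) := (IsSelfAdjoint.of_nonneg hq).inr ℂ
  have hs : SpectrumRestricts (q : Unitization ℂ A) ContinuousMap.realToNNReal :=
    (quasispectrumRestricts_iff_spectrumRestricts_inr' ℂ).1
      (nonneg_iff_isSelfAdjoint_and_quasispectrumRestricts.1 hq).2
  have hn := (SpectrumRestricts.nnreal_iff_nnnorm (t := R) hsa
    (by rw [← NNReal.coe_le_coe]; simpa [Unitization.norm_inr] using hqR)).1 hs
  have hn' : ‖algebraMap ℝ (Unitization ℂ A) R - (q : Unitization ℂ A)‖ ≤ R := hn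
  have he : (((R : ℂ) • b - q * b : A) : Unitization ℂ A) =
      (algebraMap ℝ (Unitization ℂ A) R - (q : Unitization ℂ A)) * (b : Unitization ℂ A) := by
    rw [sub_mul, Algebra.algebraMap_eq_smul_one, smul_mul_assoc, one_mul, Unitization.inr_sub,
      Unitization.inr_mul, Unitization.inr_smul]
    simp
  rw [← Unitization.norm_inr (𝕜 := ℂ) ((R : ℂ) • b - q * b), he]
  refine (norm_mul_le _ _).trans ?_
  rw [Unitization.norm_inr]
  gcongr

theorem nonneg_of_norm_smul_sub_mul_le {a : A} {R : ℝ} (ha : IsSelfAdjoint a) (haR : ‖a‖ ≤ R)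
    (h : ∀ b : A, ‖(R : ℂ) • b - a * b‖ ≤ R * ‖b‖) : 0 ≤ a := by
  lift R to NNReal using (norm_nonneg _).trans haR
  rw [nonneg_iff_isSelfAdjoint_and_quasispectrumRestricts]
  refine ⟨ha, (quasispectrumRestricts_iff_spectrumRestricts_inr' ℂ).2 ?_⟩
  refine (SpectrumRestricts.nnreal_iff_nnnorm (t := R) (ha.inr ℂ)
    (by rw [← NNReal.coe_le_coe]; simpa [Unitization.norm_inr] using haR)).2 ?_
  change ‖algebraMap ℝ (Unitization ℂ A) R - (a : Unitization ℂ A)‖ ≤ R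
  rw [Unitization.norm_eq_sup]
  have h0 : algebraMap ℝ (Unitization ℂ A) R = Unitization.inl ((R : ℝ) : ℂ) := by
    rw [Algebra.algebraMap_eq_smul_one, ← Unitization.inl_one, ← Unitization.inl_smul]
    simp
  have h1 : (algebraMap ℝ (Unitization ℂ A) R - (a : Unitization ℂ A)).fst = ((R : ℝ) : ℂ) := by
    rw [h0, sub_eq_add_neg, Unitization.fst_add, Unitization.fst_neg, Unitization.fst_inl,
      Unitization.fst_inr, neg_zero, add_zero]
  have h2 : (algebraMap ℝ (Unitization ℂ A) R - (a : Unitization ℂ A)).snd = -a := by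
    rw [h0, sub_eq_add_neg, Unitization.snd_add, Unitization.snd_neg, Unitization.snd_inl,
      Unitization.snd_inr, zero_add]
  rw [h1, h2]
  refine max_le (by simp) (ContinuousLinearMap.opNorm_le_bound _ R.2 fun b => ?_)
  have := h b
  simpa [Algebra.algebraMap_eq_smul_one, sub_eq_add_neg] using this

theorem IsStarPredual.nonneg_of_tendsto {P : Submodule ℂ (StrongDual ℂ A)} (hP : IsStarPredual P)
    {ι : Type*} {l : Filter ι} [l.NeBot] {f : ι → A} {a : A} {R : ℝ}
    (hf : ∀ᶠ i in l, 0 ≤ f i ∧ ‖f i‖ ≤ R)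
    (h : ∀ φ ∈ P, Filter.Tendsto (fun i => φ (f i)) l (𝓝 (φ a))) : 0 ≤ a := by
  have hR : 0 ≤ R := by
    obtain ⟨i, hi⟩ := hf.exists
    exact (norm_nonneg _).trans hi.2
  refine nonneg_of_norm_smul_sub_mul_le (R := R) ?_
    (hP.norm_le_of_tendsto hR (hf.mono fun i hi => hi.2) h) fun b => ?_
  · refine hP.ext fun φ hφ => ?_
    obtain ⟨ψ, hψ, hs⟩ := hP.star_mem φ hφ
    have h1 : Filter.Tendsto (fun i => star (φ (f i))) l (𝓝 (ψ a)) := by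
      refine (h ψ hψ).congr' (hf.mono fun i hi => ?_)
      rw [hs, (IsSelfAdjoint.of_nonneg hi.1).star_eq]
    have h2 := tendsto_nhds_unique h1 (h φ hφ).star
    rw [hs] at h2
    exact star_injective h2
  · refine hP.norm_le_of_tendsto (l := l) (f := fun i => (R : ℂ) • b - f i * b)
      (by positivity) (hf.mono fun i hi => norm_smul_sub_mul_le hi.1 hi.2) fun φ hφ => ?_
    obtain ⟨ψ, hψ, hs⟩ := hP.mul_right_mem φ hφ b
    simp only [map_sub, ← hs]
    exact tendsto_const_nhds.sub (h ψ hψ)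

/-- A bounded increasing net of positive elements converges weak-star to its supremum. -/
theorem IsStarPredual.exists_tendsto {P : Submodule ℂ (StrongDual ℂ A)} (hP : IsStarPredual P)
    {ι : Type*} [Preorder ι] [IsDirected ι (· ≤ ·)] [Nonempty ι] {f : ι → A} {R : ℝ}
    (hmono : Monotone f) (hf : ∀ i, 0 ≤ f i) (hR : ∀ i, ‖f i‖ ≤ R) :
    ∃ a : A, (∀ φ ∈ P, Filter.Tendsto (fun i => φ (f i)) Filter.atTop (𝓝 (φ a))) ∧
      0 ≤ a ∧ ‖a‖ ≤ R ∧ ∀ i, f i ≤ a := by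
  have hR0 : 0 ≤ R := (norm_nonneg _).trans (hR (Classical.arbitrary ι))
  have key : ∀ U : Ultrafilter ι, (U : Filter ι) ≤ Filter.atTop → ∀ a : A,
      (∀ φ ∈ P, Filter.Tendsto (fun i => φ (f i)) U (𝓝 (φ a))) →
      (∀ i, f i ≤ a) ∧ ∀ b, (∀ i, f i ≤ b) → a ≤ b := by
    intro U hU a ha
    constructor
    · intro i
      rw [← sub_nonneg]
      refine hP.nonneg_of_tendsto (l := (U : Filter ι)) (f := fun j => f j - f i) (R := R + R)
        (((Filter.eventually_ge_atTop i).filter_mono hU).mono fun j hj =>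
          ⟨sub_nonneg.2 (hmono hj), ?_⟩) fun φ hφ => ?_
      · exact (norm_sub_le _ _).trans (add_le_add (hR _) (hR _))
      · simp only [map_sub]
        exact (ha φ hφ).sub tendsto_const_nhds
    · intro b hb
      rw [← sub_nonneg]
      refine hP.nonneg_of_tendsto (l := (U : Filter ι)) (f := fun j => b - f j) (R := ‖b‖ + R)
        (Filter.Eventually.of_forall fun j => ⟨sub_nonneg.2 (hb j), ?_⟩) fun φ hφ => ?_
      · exact (norm_sub_le _ _).trans (add_le_add le_rfl (hR _))
      · simp only [map_sub]
        exact tendsto_const_nhds.sub (ha φ hφ)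
  obtain ⟨U, hU⟩ := Ultrafilter.exists_le (Filter.atTop : Filter ι)
  obtain ⟨a, ha⟩ := hP.exists_ultrafilter_limit U hR
  refine ⟨a, fun φ hφ => ?_, ?_, ?_, (key U hU a ha).1⟩
  · rw [Filter.tendsto_iff_ultrafilter]
    intro V hV
    obtain ⟨b, hb⟩ := hP.exists_ultrafilter_limit V hR
    have : a = b := le_antisymm ((key U hU a ha).2 b (key V hV b hb).1)
      ((key V hV b hb).2 a (key U hU a ha).1)
    exact this ▸ hb φ hφ
  · exact (hf (Classical.arbitrary ι)).trans ((key U hU a ha).1 _)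
  · exact hP.norm_le_of_tendsto hR0 (Filter.Eventually.of_forall hR) ha

end Positive

/-! ### Adjointable operators on a Hilbert C*-module -/

section Adjointable

variable (B E : Type*) [NonUnitalCStarAlgebra B] [PartialOrder B] [StarOrderedRing B]
  [NormedAddCommGroup E] [NormedSpace ℂ E] [SMul B E] [CStarModule B E]

/-- The algebra `𝓛(E)` of adjointable operators on a Hilbert module. -/
def adjointable : Subalgebra ℂ (E →L[ℂ] E) where
  carrier := {T | ∃ S : E →L[ℂ] E, ∀ x y, inner B (T x) y = inner B x (S y)}
  mul_mem' := by
    rintro T₁ T₂ ⟨S₁, h₁⟩ ⟨S₂, h₂⟩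
    exact ⟨S₂ * S₁, fun x y => by simp [h₁, h₂]⟩
  add_mem' := by
    rintro T₁ T₂ ⟨S₁, h₁⟩ ⟨S₂, h₂⟩
    exact ⟨S₁ + S₂, fun x y => by simp [h₁, h₂]⟩
  algebraMap_mem' := fun c => ⟨algebraMap ℂ _ (star c), fun x y => by
    simp [Algebra.algebraMap_eq_smul_one]⟩

/-- The type of adjointable operators. -/
abbrev Adjointable : Type _ := ↥(adjointable B E)

variable {B E}

theorem inner_left_ext {x y : E} (h : ∀ z, inner B z x = inner B z y) : x = y := by
  rw [← sub_eq_zero, ← CStarModule.inner_self (A := B) (x := x - y)]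
  simp [h]

namespace Adjointable

instance : Star (Adjointable B E) where
  star T := ⟨T.2.choose, ⟨T.1, fun x y => by
    rw [← CStarModule.star_inner, ← T.2.choose_spec, CStarModule.star_inner]⟩⟩

/-- The defining property of the adjoint. -/
theorem inner_star (T : Adjointable B E) (x y : E) :
    inner B (T.1 x) y = inner B x ((star T).1 y) :=
  T.2.choose_spec x y

theorem star_inner_right (T : Adjointable B E) (x y : E) :
    inner B ((star T).1 x) y = inner B x (T.1 y) := by
  rw [← CStarModule.star_inner, ← inner_star, CStarModule.star_inner]

theorem eq_star {T S : Adjointable B E} (h : ∀ x y, inner B (T.1 x) y = inner B x (S.1 y)) :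
    star T = S := by
  refine Subtype.ext (ContinuousLinearMap.ext fun y => inner_left_ext (B := B) fun z => ?_)
  rw [← inner_star, h]

instance : StarRing (Adjointable B E) where
  star_involutive T := eq_star fun x y => star_inner_right T x y
  star_mul T S := eq_star fun x y => by
    change inner B (T.1 (S.1 x)) y = inner B x ((star S).1 ((star T).1 y))
    rw [inner_star, inner_star]
  star_add T S := eq_star fun x y => by
    change inner B (T.1 x + S.1 x) y = inner B x ((star T).1 y + (star S).1 y)
    simp [inner_star]

instance : StarModule ℂ (Adjointable B E) where
  star_smul c T := eq_star fun x y => by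
    change inner B (c • T.1 x) y = inner B x (star c • (star T).1 y)
    simp [inner_star]

theorem norm_sq_le (T : Adjointable B E) : ‖T‖ * ‖T‖ ≤ ‖star T * T‖ := by
  have h0 : 0 ≤ ‖star T * T‖ := norm_nonneg _
  have : ‖T.1‖ ≤ √‖star T * T‖ := by
    refine ContinuousLinearMap.opNorm_le_bound _ (Real.sqrt_nonneg _) fun x => ?_
    refine abs_le_of_sq_le_sq' ?_ (by positivity) |>.2
    rw [mul_pow, Real.sq_sqrt h0, CStarModule.norm_sq_eq (A := B), inner_star]
    refine (CStarModule.norm_inner_le E).trans ?_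
    have : ‖(star T * T).1 x‖ ≤ ‖star T * T‖ * ‖x‖ := (star T * T).1.le_opNorm x
    calc ‖x‖ * ‖(star T).1 (T.1 x)‖ ≤ ‖x‖ * (‖star T * T‖ * ‖x‖) := by gcongr; exact this
      _ = ‖star T * T‖ * ‖x‖ ^ 2 := by ring
  calc ‖T‖ * ‖T‖ ≤ √‖star T * T‖ * √‖star T * T‖ := by
        gcongr <;> exact this
    _ = _ := Real.mul_self_sqrt h0

instance : CStarRing (Adjointable B E) where
  norm_mul_self_le := norm_sq_le

theorem norm_star_le (T : Adjointable B E) : ‖star T‖ ≤ ‖T‖ := by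
  rcases eq_or_ne ‖star T‖ 0 with h0 | h0
  · rw [h0]; exact norm_nonneg _
  · have h1 := norm_sq_le (star T)
    rw [star_star] at h1
    exact le_of_mul_le_mul_right (h1.trans (norm_mul_le _ _))
      (lt_of_le_of_ne (norm_nonneg _) (Ne.symm h0))

theorem norm_apply_le (T : Adjointable B E) (x : E) : ‖T.1 x‖ ≤ ‖T‖ * ‖x‖ := T.1.le_opNorm x

instance [CompleteSpace E] : CompleteSpace (Adjointable B E) := by
  refine Metric.complete_of_cauchySeq_tendsto fun u hu => ?_
  have hs : CauchySeq fun n => star (u n) := by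
    rw [Metric.cauchySeq_iff'] at hu ⊢
    intro ε hε
    obtain ⟨N, hN⟩ := hu ε hε
    exact ⟨N, fun n hn => by
      have e : star (u n) - star (u N) = star (u n - u N) := (star_sub (u n) (u N)).symm
      rw [dist_eq_norm, e]
      have h := hN n hn
      rw [dist_eq_norm] at h
      exact (norm_star_le _).trans_lt h⟩
  have h1 : CauchySeq fun n => (u n).1 := hu.map uniformContinuous_subtype_val
  have h2 : CauchySeq fun n => (star (u n)).1 := hs.map uniformContinuous_subtype_val
  obtain ⟨T, hT⟩ := cauchySeq_tendsto_of_complete h1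
  obtain ⟨S, hS⟩ := cauchySeq_tendsto_of_complete h2
  have hmem : T ∈ adjointable B E := by
    refine ⟨S, fun x y => ?_⟩
    have a1 : Filter.Tendsto (fun n => inner B ((u n).1 x) y) Filter.atTop
        (𝓝 (inner B (T x) y)) :=
      ((CStarModule.continuous_inner (A := B) (E := E)).tendsto (T x, y)).comp
        ((((ContinuousLinearMap.apply ℂ E x).continuous.tendsto T).comp hT).prodMk_nhds
          tendsto_const_nhds)
    have a2 : Filter.Tendsto (fun n => inner B x ((star (u n)).1 y)) Filter.atTop
        (𝓝 (inner B x (S y))) :=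
      ((CStarModule.continuous_inner (A := B) (E := E)).tendsto (x, S y)).comp
        (tendsto_const_nhds.prodMk_nhds
          (((ContinuousLinearMap.apply ℂ E y).continuous.tendsto S).comp hS))
    exact tendsto_nhds_unique a1 (a2.congr fun n => (inner_star (u n) x y).symm)
  exact ⟨⟨T, hmem⟩, tendsto_subtype_rng.2 hT⟩

instance [CompleteSpace E] : CStarAlgebra (Adjointable B E) where

end Adjointable

end Adjointable

/-! ### Fell bundles over discrete groups -/

/-- A Fell bundle (C*-algebraic bundle) over the discrete group `G`. The multiplication
`fiber s × fiber t → fiber (s * t)` and the involution `fiber s → fiber s⁻¹` are given together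
with a name `r` for the index of the target fibre (and a proof that `r` is that index), so that
the axioms can be stated without transport. An element of the unit fibre is positive if and only
if it has the form `c* c` with `c` in the unit fibre. -/
structure FellBundle (G : Type u) [Group G] where
  fiber : G → Type v
  [normed : ∀ t, NormedAddCommGroup (fiber t)]
  [space : ∀ t, NormedSpace ℂ (fiber t)]
  [complete : ∀ t, CompleteSpace (fiber t)]
  mul : ∀ {s t r : G}, s * t = r → fiber s → fiber t → fiber r
  adj : ∀ {s r : G}, s⁻¹ = r → fiber s → fiber r
  add_mul : ∀ {s t r : G} (h : s * t = r) (a b : fiber s) (c : fiber t),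
    mul h (a + b) c = mul h a c + mul h b c
  mul_add : ∀ {s t r : G} (h : s * t = r) (a : fiber s) (b c : fiber t),
    mul h a (b + c) = mul h a b + mul h a c
  smul_mul : ∀ {s t r : G} (h : s * t = r) (z : ℂ) (a : fiber s) (b : fiber t),
    mul h (z • a) b = z • mul h a b
  mul_smul : ∀ {s t r : G} (h : s * t = r) (z : ℂ) (a : fiber s) (b : fiber t),
    mul h a (z • b) = z • mul h a b
  mul_assoc : ∀ {s t r st tr str : G} (h₁ : s * t = st) (h₂ : st * r = str) (h₃ : t * r = tr)
    (h₄ : s * tr = str) (a : fiber s) (b : fiber t) (c : fiber r),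
    mul h₂ (mul h₁ a b) c = mul h₄ a (mul h₃ b c)
  adj_add : ∀ {s r : G} (h : s⁻¹ = r) (a b : fiber s), adj h (a + b) = adj h a + adj h b
  adj_smul : ∀ {s r : G} (h : s⁻¹ = r) (z : ℂ) (a : fiber s), adj h (z • a) = star z • adj h a
  adj_adj : ∀ {s r : G} (h : s⁻¹ = r) (h' : r⁻¹ = s) (a : fiber s), adj h' (adj h a) = a
  adj_mul : ∀ {s t r s' t' r' : G} (h : s * t = r) (hs : s⁻¹ = s') (ht : t⁻¹ = t')
    (hr : r⁻¹ = r') (h' : t' * s' = r') (a : fiber s) (b : fiber t),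
    adj hr (mul h a b) = mul h' (adj ht b) (adj hs a)
  norm_mul_le : ∀ {s t r : G} (h : s * t = r) (a : fiber s) (b : fiber t),
    ‖mul h a b‖ ≤ ‖a‖ * ‖b‖
  norm_adj_mul_self : ∀ {s r : G} (h : s⁻¹ = r) (h' : r * s = 1) (a : fiber s),
    ‖mul h' (adj h a) a‖ = ‖a‖ ^ 2
  adj_mul_self_nonneg : ∀ {s r : G} (h : s⁻¹ = r) (h' : r * s = 1) (a : fiber s),
    ∃ c : fiber 1, mul h' (adj h a) a = mul (one_mul 1) (adj inv_one c) c

namespace FellBundle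

attribute [instance] normed space complete

variable {G : Type u} [Group G] (B : FellBundle.{u, v} G)

/-- The unit fibre of a Fell bundle is a C*-algebra. -/
instance : NonUnitalCStarAlgebra (B.fiber 1) :=
  { B.normed 1, B.space 1, B.complete 1 with
    mul := B.mul (one_mul 1)
    left_distrib := B.mul_add _
    right_distrib := B.add_mul _
    zero_mul := fun a => by
      have := B.smul_mul (one_mul 1) 0 0 a
      rwa [zero_smul, zero_smul] at this
    mul_zero := fun a => by
      have := B.mul_smul (one_mul 1) 0 a 0
      rwa [zero_smul, zero_smul] at this
    mul_assoc := B.mul_assoc _ _ _ _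
    norm_mul_le := B.norm_mul_le _
    star := B.adj inv_one
    star_involutive := B.adj_adj _ _
    star_mul := B.adj_mul _ _ _ _ _
    star_add := B.adj_add _
    star_smul := B.adj_smul _
    norm_mul_self_le := fun a => by
      have := B.norm_adj_mul_self inv_one (one_mul 1) a
      rw [sq] at this
      exact this.ge
    smul_assoc := B.smul_mul _
    smul_comm := fun z a b => (B.mul_smul _ z a b).symm }

instance : PartialOrder (B.fiber 1) := CStarAlgebra.spectralOrder _

instance : StarOrderedRing (B.fiber 1) := CStarAlgebra.spectralOrderedRing _

theorem mul_def (a b : B.fiber 1) : a * b = B.mul (one_mul 1) a b := rfl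

theorem star_def (a : B.fiber 1) : star a = B.adj inv_one a := rfl

variable {B}

/-- Left multiplication, as a bounded linear map. -/
def mulLeft {s t r : G} (h : s * t = r) (a : B.fiber s) : B.fiber t →L[ℂ] B.fiber r :=
  LinearMap.mkContinuous ⟨⟨B.mul h a, B.mul_add h a⟩, fun z b => B.mul_smul h z a b⟩ ‖a‖
    (B.norm_mul_le h a)

/-- Right multiplication, as a bounded linear map. -/
def mulRight {s t r : G} (h : s * t = r) (b : B.fiber t) : B.fiber s →L[ℂ] B.fiber r :=
  LinearMap.mkContinuous ⟨⟨fun a => B.mul h a b, fun a a' => B.add_mul h a a' b⟩,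
    fun z a => B.smul_mul h z a b⟩ ‖b‖ (fun a => by rw [mul_comm]; exact B.norm_mul_le h a b)

@[simp] theorem mulLeft_apply {s t r : G} (h : s * t = r) (a : B.fiber s) (b : B.fiber t) :
    mulLeft h a b = B.mul h a b := rfl

@[simp] theorem mulRight_apply {s t r : G} (h : s * t = r) (b : B.fiber t) (a : B.fiber s) :
    mulRight h b a = B.mul h a b := rfl

/-- The inner product `a* b` of two elements of the same fibre. -/
def ip {t : G} (a b : B.fiber t) : B.fiber 1 := B.mul (inv_mul_cancel t) (B.adj rfl a) b

/-- The right action of the unit fibre on a fibre. -/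
def act {t : G} (a : B.fiber t) (b : B.fiber 1) : B.fiber t := B.mul (mul_one t) a b

theorem ip_add_right {t : G} (a b c : B.fiber t) : ip a (b + c) = ip a b + ip a c :=
  B.mul_add _ _ _ _

theorem ip_smul_right {t : G} (z : ℂ) (a b : B.fiber t) : ip a (z • b) = z • ip a b :=
  B.mul_smul _ _ _ _

theorem star_ip {t : G} (a b : B.fiber t) : star (ip a b) = ip b a := by
  rw [star_def, ip, B.adj_mul (inv_mul_cancel t) (inv_inv t) rfl inv_one (inv_mul_cancel t),
    B.adj_adj]
  rfl

theorem ip_add_left {t : G} (a b c : B.fiber t) : ip (a + b) c = ip a c + ip b c := by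
  rw [← star_ip, ip_add_right, star_add, star_ip, star_ip]

theorem ip_smul_left {t : G} (z : ℂ) (a b : B.fiber t) : ip (z • a) b = star z • ip a b := by
  rw [← star_ip, ip_smul_right, star_smul, star_ip]

theorem ip_act {t : G} (a b : B.fiber t) (c : B.fiber 1) : ip a (act b c) = ip a b * c :=
  (B.mul_assoc _ _ _ _ _ _ _).symm

theorem ip_self_nonneg {t : G} (a : B.fiber t) : 0 ≤ ip a a := by
  obtain ⟨c, hc⟩ := B.adj_mul_self_nonneg rfl (inv_mul_cancel t) a
  rw [ip, hc]
  exact star_mul_self_nonneg c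

theorem norm_ip_self {t : G} (a : B.fiber t) : ‖ip a a‖ = ‖a‖ ^ 2 :=
  B.norm_adj_mul_self _ _ a

/-- Left multiplication by `m` is adjoint to left multiplication by `m*`. -/
theorem ip_mul_left {u s r u' : G} (h : u * s = r) (hu : u⁻¹ = u') (h' : u' * r = s)
    (m : B.fiber u) (a : B.fiber s) (b : B.fiber r) :
    ip (B.mul h m a) b = ip a (B.mul h' (B.adj hu m) b) := by
  subst hu
  rw [ip, ip, B.adj_mul h rfl rfl rfl (by rw [← h, mul_inv_rev])]
  exact B.mul_assoc _ _ _ _ _ _ _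

theorem norm_adj {s r : G} (h : s⁻¹ = r) (a : B.fiber s) : ‖B.adj h a‖ = ‖a‖ := by
  have key : ∀ {s r : G} (h : s⁻¹ = r) (a : B.fiber s), ‖a‖ ≤ ‖B.adj h a‖ := by
    intro s r h a
    have h' : r * s = 1 := by rw [← h, inv_mul_cancel]
    have := B.norm_adj_mul_self h h' a
    rcases eq_or_ne ‖a‖ 0 with h0 | h0
    · rw [h0]; positivity
    · have h1 := B.norm_mul_le h' (B.adj h a) a
      rw [this, sq] at h1
      exact le_of_mul_le_mul_right h1 (lt_of_le_of_ne (norm_nonneg _) (Ne.symm h0))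
  refine le_antisymm ?_ (key h a)
  have h' : r⁻¹ = s := by rw [← h, inv_inv]
  have := key h' (B.adj h a)
  rwa [B.adj_adj] at this

end FellBundle

/-- A W*-Fell bundle: a Fell bundle whose fibres are dual Banach spaces (`predual t` is the
predual of `fiber t`), such that the involution and the left multiplications are weak-star
continuous. -/
structure WStarFellBundle (G : Type u) [Group G] extends FellBundle.{u, v} G where
  predual : ∀ t, Submodule ℂ (StrongDual ℂ (fiber t))
  isPredual : ∀ t, IsPredual (predual t)
  continuous_adj : ∀ {s r : G} (h : s⁻¹ = r),
    Continuous[wstarTopology (predual s), wstarTopology (predual r)] (adj h)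
  continuous_mul_left : ∀ {s t r : G} (h : s * t = r) (a : fiber s),
    Continuous[wstarTopology (predual t), wstarTopology (predual r)] (mul h a)

/-! ### The W*-Hilbert module of square summable sections -/

namespace WStarFellBundle

open FellBundle

variable {G : Type u} [Group G] (M : WStarFellBundle.{u, v} G)

theorem isStarPredual : IsStarPredual (A := M.fiber 1) (M.predual 1) where
  toIsPredual := M.isPredual 1
  star_mem := by
    intro φ hφ
    let ψ : StrongDual ℂ (M.fiber 1) := LinearMap.mkContinuous
      { toFun := fun x => star (φ (star x))
        map_add' := fun x y => by simp
        map_smul' := fun c x => by simp } ‖φ‖ (fun x => by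
          change ‖star (φ (star x))‖ ≤ _
          rw [norm_star]
          exact (φ.le_opNorm _).trans (by rw [norm_star]))
    refine ⟨ψ, mem_of_continuous_wstar ?_, fun x => rfl⟩
    have h1 := M.continuous_adj (s := 1) (r := 1) inv_one
    have h2 := @Continuous.comp _ _ _ (wstarTopology (M.predual 1))
      (wstarTopology (M.predual 1)) _ _ _ (continuous_wstar hφ) h1
    exact @Continuous.comp _ _ _ (wstarTopology (M.predual 1)) _ _ _ (fun z : ℂ => star z)
      continuous_star h2
  mul_right_mem := by
    intro φ hφ b
    let R : M.fiber 1 →L[ℂ] M.fiber 1 := mulRight (one_mul 1) b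
    refine ⟨φ.comp R, mem_of_continuous_wstar ?_, fun x => rfl⟩
    have h1 := M.continuous_adj (s := 1) (r := 1) inv_one
    have h2 := M.continuous_mul_left (one_mul 1) (star b)
    have h3 := @Continuous.comp _ _ _ (wstarTopology (M.predual 1)) (wstarTopology (M.predual 1))
      (wstarTopology (M.predual 1)) _ _ h1 (@Continuous.comp _ _ _ (wstarTopology (M.predual 1))
      (wstarTopology (M.predual 1)) (wstarTopology (M.predual 1)) _ _ h2 h1)
    have h4 := @Continuous.comp _ _ _ (wstarTopology (M.predual 1))
      (wstarTopology (M.predual 1)) _ _ _ (continuous_wstar hφ) h3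
    refine Eq.mp ?_ h4
    congr 1
    funext x
    change φ (star (star b * star x)) = φ (x * b)
    rw [star_mul, star_star, star_star]

variable {M}

theorem ip_zero_left {t : G} (a : M.fiber t) : ip 0 a = 0 := by
  simpa using ip_smul_left (0 : ℂ) a a

theorem ip_add_add_le {t : G} (a b : M.fiber t) :
    ip (a + b) (a + b) ≤ (2 : ℂ) • (ip a a + ip b b) := by
  have h := ip_self_nonneg (a + (-1 : ℂ) • b)
  rw [← sub_nonneg]
  refine h.trans_eq ?_
  rw [ip_add_left, ip_add_right, ip_add_right, ip_smul_left, ip_smul_left, ip_smul_right,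
    ip_smul_right, ip_add_left, ip_add_right, ip_add_right]
  simp only [star_neg, star_one, two_smul, neg_smul, one_smul]
  abel

variable (M)

/-- The square summable sections: the finite sums `∑ t ∈ F, ξ(t)* ξ(t)` are bounded. -/
def ell2 : Submodule ℂ (∀ t, M.fiber t) where
  carrier := {ξ | ∃ C : ℝ, ∀ F : Finset G, ‖∑ t ∈ F, ip (ξ t) (ξ t)‖ ≤ C}
  zero_mem' := ⟨0, fun F => by simp [ip_zero_left]⟩
  add_mem' := by
    rintro ξ η ⟨C, hC⟩ ⟨D, hD⟩
    refine ⟨2 * (C + D), fun F => ?_⟩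
    have h1 : ∑ t ∈ F, ip ((ξ + η) t) ((ξ + η) t) ≤
        (2 : ℂ) • (∑ t ∈ F, ip (ξ t) (ξ t) + ∑ t ∈ F, ip (η t) (η t)) := by
      rw [← Finset.sum_add_distrib, Finset.smul_sum]
      exact Finset.sum_le_sum fun t _ => ip_add_add_le (ξ t) (η t)
    refine (CStarAlgebra.norm_le_norm_of_nonneg_of_le
      (Finset.sum_nonneg fun t _ => ip_self_nonneg _) h1).trans ?_
    rw [norm_smul]
    refine mul_le_mul (by simp) ((norm_add_le _ _).trans (add_le_add (hC F) (hD F)))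
      (norm_nonneg _) (by norm_num)
  smul_mem' := by
    rintro c ξ ⟨C, hC⟩
    refine ⟨‖c‖ * ‖c‖ * C, fun F => ?_⟩
    have : ∑ t ∈ F, ip ((c • ξ) t) ((c • ξ) t) = (star c * c) • ∑ t ∈ F, ip (ξ t) (ξ t) := by
      rw [Finset.smul_sum]
      refine Finset.sum_congr rfl fun t _ => ?_
      rw [Pi.smul_apply, ip_smul_left, ip_smul_right, smul_smul]
    rw [this, norm_smul, norm_mul, norm_star]
    exact mul_le_mul_of_nonneg_left (hC F) (by positivity)

/-- The space of square summable sections. -/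
def L2 : Type (max u v) := ↥(ell2 M)

namespace L2

instance : AddCommGroup (L2 M) := inferInstanceAs (AddCommGroup ↥(ell2 M))

instance : Module ℂ (L2 M) := inferInstanceAs (Module ℂ ↥(ell2 M))

variable {M}

instance : CoeFun (L2 M) fun _ => ∀ t, M.fiber t := ⟨fun ξ => ξ.1⟩

@[ext] theorem ext {ξ η : L2 M} (h : ∀ t, ξ t = η t) : ξ = η := Subtype.ext (funext h)

@[simp] theorem add_apply (ξ η : L2 M) (t : G) : (ξ + η) t = ξ t + η t := rfl

@[simp] theorem smul_apply (c : ℂ) (ξ : L2 M) (t : G) : (c • ξ) t = c • ξ t := rfl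

@[simp] theorem zero_apply (t : G) : (0 : L2 M) t = 0 := rfl

theorem exists_self (ξ : L2 M) : ∃ a : M.fiber 1,
    (∀ φ ∈ M.predual 1, HasSum (fun t => φ (ip (ξ t) (ξ t))) (φ a)) ∧ 0 ≤ a ∧
    (∀ C : ℝ, (∀ F : Finset G, ‖∑ t ∈ F, ip (ξ t) (ξ t)‖ ≤ C) → ‖a‖ ≤ C) ∧
    ∀ F : Finset G, ∑ t ∈ F, ip (ξ t) (ξ t) ≤ a := by
  obtain ⟨C, hC⟩ := ξ.2
  obtain ⟨a, h1, h2, -, h4⟩ := M.isStarPredual.exists_tendsto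
    (f := fun F : Finset G => ∑ t ∈ F, ip (ξ t) (ξ t)) (R := C)
    (fun F F' h => Finset.sum_le_sum_of_subset_of_nonneg h fun t _ _ => ip_self_nonneg _)
    (fun F => Finset.sum_nonneg fun t _ => ip_self_nonneg _) hC
  refine ⟨a, fun φ hφ => ?_, h2, fun D hD => ?_, h4⟩
  · have := h1 φ hφ
    simp only [map_sum] at this
    exact this
  · exact (M.isPredual 1).norm_le_of_tendsto ((norm_nonneg _).trans (hD ∅))
      (Filter.Eventually.of_forall hD) h1

theorem exists_ip (ξ η : L2 M) : ∃ a : M.fiber 1,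
    ∀ φ ∈ M.predual 1, HasSum (fun t => φ (ip (ξ t) (η t))) (φ a) := by
  obtain ⟨a₀, h₀, -⟩ := exists_self (η + ξ)
  obtain ⟨a₁, h₁, -⟩ := exists_self (η + Complex.I • ξ)
  obtain ⟨a₂, h₂, -⟩ := exists_self (η + (-1 : ℂ) • ξ)
  obtain ⟨a₃, h₃, -⟩ := exists_self (η + (-Complex.I) • ξ)
  refine ⟨(1 / 4 : ℂ) • (a₀ + Complex.I • a₁ + (-1 : ℂ) • a₂ + (-Complex.I) • a₃),
    fun φ hφ => ?_⟩
  have h := ((((h₀ φ hφ).add ((h₁ φ hφ).mul_left Complex.I)).add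
    ((h₂ φ hφ).mul_left (-1))).add ((h₃ φ hφ).mul_left (-Complex.I))).mul_left (1 / 4 : ℂ)
  simp only [map_smul, map_add, smul_eq_mul]
  refine h.congr_fun ?_
  intro t
  simp only [add_apply, smul_apply, ip_add_left, ip_add_right, ip_smul_left, ip_smul_right,
    map_add, map_smul, smul_eq_mul]
  simp
  ring_nf
  simp
  ring

/-- The inner product `⟨ξ, η⟩ = ∑ t, ξ(t)* η(t)` (weak-star convergent sum) with values in the
unit fibre. -/
def ipL (ξ η : L2 M) : M.fiber 1 := (exists_ip ξ η).choose

theorem hasSum_ipL (ξ η : L2 M) {φ : StrongDual ℂ (M.fiber 1)} (hφ : φ ∈ M.predual 1) :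
    HasSum (fun t => φ (ip (ξ t) (η t))) (φ (ipL ξ η)) :=
  (exists_ip ξ η).choose_spec φ hφ

theorem ipL_eq {ξ η : L2 M} {a : M.fiber 1}
    (h : ∀ φ ∈ M.predual 1, HasSum (fun t => φ (ip (ξ t) (η t))) (φ a)) : ipL ξ η = a :=
  (M.isPredual 1).ext fun φ hφ => (hasSum_ipL ξ η hφ).unique (h φ hφ)

theorem ipL_self_spec (ξ : L2 M) : 0 ≤ ipL ξ ξ ∧
    (∀ C : ℝ, (∀ F : Finset G, ‖∑ t ∈ F, ip (ξ t) (ξ t)‖ ≤ C) → ‖ipL ξ ξ‖ ≤ C) ∧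
    ∀ F : Finset G, ∑ t ∈ F, ip (ξ t) (ξ t) ≤ ipL ξ ξ := by
  obtain ⟨a, h1, h2⟩ := exists_self ξ
  rw [ipL_eq h1]
  exact h2

theorem ipL_add_right (ξ η ζ : L2 M) : ipL ξ (η + ζ) = ipL ξ η + ipL ξ ζ :=
  ipL_eq fun φ hφ => by
    simpa [ip_add_right] using (hasSum_ipL ξ η hφ).add (hasSum_ipL ξ ζ hφ)

theorem ipL_smul_right (c : ℂ) (ξ η : L2 M) : ipL ξ (c • η) = c • ipL ξ η :=
  ipL_eq fun φ hφ => by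
    simpa [ip_smul_right] using (hasSum_ipL ξ η hφ).mul_left c

theorem star_ipL (ξ η : L2 M) : star (ipL ξ η) = ipL η ξ := by
  refine (ipL_eq fun φ hφ => ?_).symm
  obtain ⟨ψ, hψ, hs⟩ := M.isStarPredual.star_mem φ hφ
  have := (hasSum_ipL ξ η hψ).star
  simpa only [hs, star_star, star_ip] using this

theorem ipL_self_eq_zero {ξ : L2 M} : ipL ξ ξ = 0 ↔ ξ = 0 := by
  constructor
  · intro h
    ext t
    have h1 := (ipL_self_spec ξ).2.2 {t}
    rw [h, Finset.sum_singleton] at h1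
    have h2 : ip (ξ t) (ξ t) = 0 := le_antisymm h1 (ip_self_nonneg _)
    have h3 := norm_ip_self (ξ t)
    rw [h2, norm_zero] at h3
    simpa using h3.symm
  · rintro rfl
    simpa using ipL_smul_right 0 (0 : L2 M) 0

theorem norm_act_le {t : G} (a : M.fiber t) (b : M.fiber 1) : ‖act a b‖ ≤ ‖a‖ * ‖b‖ :=
  M.norm_mul_le _ a b

theorem ip_act_left {t : G} (a b : M.fiber t) (c : M.fiber 1) :
    ip (act a c) b = star c * ip a b := by
  rw [← star_ip, ip_act, star_mul, star_ip]

/-- The right action of the unit fibre on sections. -/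
def actL (ξ : L2 M) (b : M.fiber 1) : L2 M :=
  ⟨fun t => act (ξ t) b, by
    obtain ⟨C, hC⟩ := ξ.2
    refine ⟨‖b‖ * C * ‖b‖, fun F => ?_⟩
    have : ∑ t ∈ F, ip (act (ξ t) b) (act (ξ t) b) =
        star b * (∑ t ∈ F, ip (ξ t) (ξ t)) * b := by
      rw [Finset.mul_sum, Finset.sum_mul]
      exact Finset.sum_congr rfl fun t _ => by rw [ip_act, ip_act_left]
    rw [this]
    refine (_root_.norm_mul_le _ _).trans ?_
    refine mul_le_mul_of_nonneg_right ((_root_.norm_mul_le _ _).trans ?_) (norm_nonneg _)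
    rw [norm_star]
    exact mul_le_mul_of_nonneg_left (hC F) (norm_nonneg _)⟩

instance : SMul (M.fiber 1)ᵐᵒᵖ (L2 M) := ⟨fun b ξ => actL ξ b.unop⟩

theorem ipL_actL (ξ η : L2 M) (b : M.fiber 1) : ipL ξ (actL η b) = ipL ξ η * b := by
  refine ipL_eq fun φ hφ => ?_
  obtain ⟨ψ, hψ, hs⟩ := M.isStarPredual.mul_right_mem φ hφ b
  have := hasSum_ipL ξ η hψ
  simp only [hs, ← ip_act] at this
  exact this

/-- The norm of a section is `‖⟨ξ, ξ⟩‖ ^ (1/2)`. -/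
instance : Norm (L2 M) := ⟨fun ξ => √‖ipL ξ ξ‖⟩

/-- The square summable sections form a right Hilbert module over the unit fibre, i.e. a Hilbert
module, in the convention of `CStarModule`, over the opposite algebra. -/
instance : CStarModule (M.fiber 1)ᵐᵒᵖ (L2 M) where
  inner ξ η := MulOpposite.op (ipL ξ η)
  inner_add_right := by
    intro x y z
    rw [ipL_add_right, MulOpposite.op_add]
  inner_self_nonneg := by
    intro x
    exact (ipL_self_spec x).1
  inner_self := by
    intro x
    rw [MulOpposite.op_eq_zero_iff, ipL_self_eq_zero]
  inner_op_smul_right := by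
    intro a x y
    change MulOpposite.op (ipL x (actL y a.unop)) = _
    rw [ipL_actL, MulOpposite.op_mul, MulOpposite.op_unop]
  inner_smul_right_complex := by
    intro z x y
    rw [ipL_smul_right, MulOpposite.op_smul]
  star_inner x y := by
    rw [← MulOpposite.op_star, star_ipL]
  norm_eq_sqrt_norm_inner_self x := rfl

instance : NormedAddCommGroup (L2 M) := CStarModule.normedAddCommGroup (M.fiber 1)ᵐᵒᵖ

instance : NormedSpace ℂ (L2 M) := .ofCore (CStarModule.normedSpaceCore (M.fiber 1)ᵐᵒᵖ)

theorem norm_sq_eq (ξ : L2 M) : ‖ξ‖ ^ 2 = ‖ipL ξ ξ‖ := Real.sq_sqrt (norm_nonneg _)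

theorem norm_sum_ip_le (ξ : L2 M) (F : Finset G) : ‖∑ t ∈ F, ip (ξ t) (ξ t)‖ ≤ ‖ξ‖ ^ 2 := by
  rw [norm_sq_eq]
  exact CStarAlgebra.norm_le_norm_of_nonneg_of_le
    (Finset.sum_nonneg fun t _ => ip_self_nonneg _) ((ipL_self_spec ξ).2.2 F)

theorem norm_le_of_sum {ξ : L2 M} {C : ℝ} (hC : 0 ≤ C)
    (h : ∀ F : Finset G, ‖∑ t ∈ F, ip (ξ t) (ξ t)‖ ≤ C ^ 2) : ‖ξ‖ ≤ C := by
  refine abs_le_of_sq_le_sq' ?_ hC |>.2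
  rw [norm_sq_eq]
  exact (ipL_self_spec ξ).2.1 _ h

theorem norm_coord_le (ξ : L2 M) (t : G) : ‖ξ t‖ ≤ ‖ξ‖ := by
  refine abs_le_of_sq_le_sq' ?_ (norm_nonneg _) |>.2
  have := norm_sum_ip_le ξ {t}
  rwa [Finset.sum_singleton, norm_ip_self] at this

theorem norm_ip_le {t : G} (a b : M.fiber t) : ‖ip a b‖ ≤ ‖a‖ * ‖b‖ := by
  refine (M.norm_mul_le _ _ _).trans ?_
  rw [norm_adj]

theorem tendsto_ip_self {ι : Type*} {l : Filter ι} {t : G} {f : ι → M.fiber t} {a : M.fiber t}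
    (h : Filter.Tendsto f l (𝓝 a)) :
    Filter.Tendsto (fun i => ip (f i) (f i)) l (𝓝 (ip a a)) := by
  rw [tendsto_iff_norm_sub_tendsto_zero] at h ⊢
  have h1 : Filter.Tendsto (fun i => ‖f i - a‖ * (‖f i - a‖ + ‖a‖ + ‖a‖)) l (𝓝 0) := by
    simpa using h.mul ((h.add_const ‖a‖).add_const ‖a‖)
  refine squeeze_zero (fun i => norm_nonneg _) (fun i => ?_) h1
  have h2 : ip (f i) (f i) - ip a a = ip (f i - a) (f i) + ip a (f i - a) := by
    have e1 := ip_add_left (f i - a) a (f i)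
    have e2 := ip_add_right a (f i - a) a
    rw [sub_add_cancel] at e1 e2
    rw [e1, e2]
    abel
  rw [h2]
  refine (norm_add_le _ _).trans ((add_le_add (norm_ip_le _ _) (norm_ip_le _ _)).trans ?_)
  have h3 : ‖f i‖ ≤ ‖f i - a‖ + ‖a‖ := by
    have := norm_add_le (f i - a) a
    rwa [sub_add_cancel] at this
  nlinarith [norm_nonneg (f i - a), norm_nonneg a]

theorem sub_apply (ξ η : L2 M) (t : G) : (ξ - η) t = ξ t - η t := rfl

instance : CompleteSpace (L2 M) := by
  refine Metric.complete_of_cauchySeq_tendsto fun u hu => ?_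
  have hc : ∀ t, ∃ x : M.fiber t, Filter.Tendsto (fun n => u n t) Filter.atTop (𝓝 x) := by
    intro t
    refine cauchySeq_tendsto_of_complete ?_
    rw [Metric.cauchySeq_iff'] at hu ⊢
    intro ε hε
    obtain ⟨N, hN⟩ := hu ε hε
    refine ⟨N, fun n hn => ?_⟩
    have h1 := hN n hn
    rw [dist_eq_norm] at h1 ⊢
    exact (norm_coord_le (u n - u N) t).trans_lt h1
  choose x hx using hc
  have key : ∀ ε > 0, ∃ N, ∀ n ≥ N, ∀ F : Finset G,
      ‖∑ t ∈ F, ip (u n t - x t) (u n t - x t)‖ ≤ ε ^ 2 := by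
    intro ε hε
    obtain ⟨N, hN⟩ := Metric.cauchySeq_iff.1 hu ε hε
    refine ⟨N, fun n hn F => ?_⟩
    have h1 : Filter.Tendsto (fun m => ‖∑ t ∈ F, ip (u n t - u m t) (u n t - u m t)‖)
        Filter.atTop (𝓝 ‖∑ t ∈ F, ip (u n t - x t) (u n t - x t)‖) :=
      (tendsto_finsetSum F fun t _ => tendsto_ip_self ((hx t).const_sub (u n t))).norm
    refine le_of_tendsto h1 ((Filter.eventually_ge_atTop N).mono fun m hm => ?_)
    refine (norm_sum_ip_le (u n - u m) F).trans ?_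
    have h2 := hN n hn m hm
    rw [dist_eq_norm] at h2
    exact pow_le_pow_left₀ (norm_nonneg _) h2.le 2
  have hmem : x ∈ ell2 M := by
    obtain ⟨N, hN⟩ := key 1 one_pos
    have h1 : (fun t => u N t - x t) ∈ ell2 M := ⟨1 ^ 2, hN N le_rfl⟩
    have h2 := (ell2 M).sub_mem (u N).2 h1
    convert h2 using 1
    funext t
    exact (sub_sub_cancel _ _).symm
  let X : L2 M := ⟨x, hmem⟩
  refine ⟨X, Metric.tendsto_atTop.2 fun ε hε => ?_⟩
  obtain ⟨N, hN⟩ := key (ε / 2) (half_pos hε)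
  refine ⟨N, fun n hn => ?_⟩
  rw [dist_eq_norm]
  exact (norm_le_of_sum (half_pos hε).le (hN n hn)).trans_lt (half_lt_self hε)

end L2

end WStarFellBundle

/-! ### Weak-star closures of algebras -/

section Closure

variable {E F : Type*} [NormedAddCommGroup E] [NormedSpace ℂ E]
  [NormedAddCommGroup F] [NormedSpace ℂ F]

/-- The weak-star closure of a linear subspace. -/
def wstarClosure (P : Submodule ℂ (StrongDual ℂ E)) (S : Submodule ℂ E) : Submodule ℂ E where
  carrier := @closure E (wstarTopology P) S
  zero_mem' := @subset_closure E (wstarTopology P) _ _ S.zero_mem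
  add_mem' := by
    intro a b ha hb
    have h1 : Continuous[@instTopologicalSpaceProd E E (wstarTopology P) (wstarTopology P),
        wstarTopology P] (fun p : E × E => p.1 + p.2) := by
      refine continuous_iInf_rng.2 fun φ => continuous_induced_rng.2 ?_
      have h2 := continuous_wstar φ.2
      have h3 := @Continuous.add ℂ _ _ _ (E × E) (@instTopologicalSpaceProd E E (wstarTopology P)
        (wstarTopology P)) _ _
        (@Continuous.comp _ _ _ (_) (wstarTopology P) _ _ _ h2
          (@continuous_fst E E (wstarTopology P) (wstarTopology P)))
        (@Continuous.comp _ _ _ (_) (wstarTopology P) _ _ _ h2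
          (@continuous_snd E E (wstarTopology P) (wstarTopology P)))
      refine Eq.mp ?_ h3
      congr 1
      funext p
      exact (map_add (φ : StrongDual ℂ E) p.1 p.2).symm
    exact @map_mem_closure₂ E E E (wstarTopology P) (wstarTopology P) (wstarTopology P)
      (fun a b => a + b) _ _ _ _ _ h1 ha hb fun x hx y hy => S.add_mem hx hy
  smul_mem' := by
    intro c a ha
    have h1 : Continuous[wstarTopology P, wstarTopology P] (fun x : E => c • x) := by
      refine continuous_iInf_rng.2 fun φ => continuous_induced_rng.2 ?_
      have h2 := continuous_wstar φ.2
      have h3 := @Continuous.comp _ _ _ (wstarTopology P) _ _ _ (fun z : ℂ => c • z)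
        (continuous_const_smul c) h2
      refine Eq.mp ?_ h3
      congr 1
      funext p
      exact (map_smul (φ : StrongDual ℂ E) c p).symm
    exact @map_mem_closure E E (wstarTopology P) (wstarTopology P) _ _ _ _ h1 ha
      fun x hx => S.smul_mem c hx

theorem subset_wstarClosure (P : Submodule ℂ (StrongDual ℂ E)) (S : Submodule ℂ E) :
    S ≤ wstarClosure P S :=
  @subset_closure E (wstarTopology P) S

theorem isClosed_wstarClosure (P : Submodule ℂ (StrongDual ℂ E)) (S : Submodule ℂ E) :
    @IsClosed E (wstarTopology P) (wstarClosure P S : Set E) :=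
  @isClosed_closure E (wstarTopology P) S

theorem wstarClosure_map_mem {P : Submodule ℂ (StrongDual ℂ E)} {f : E → E}
    (hf : ∀ φ ∈ P, Continuous[wstarTopology P, inferInstance] fun x => φ (f x))
    {S T : Submodule ℂ E} (h : ∀ x ∈ S, f x ∈ wstarClosure P T) {x : E}
    (hx : x ∈ wstarClosure P S) : f x ∈ wstarClosure P T := by
  have h1 : Continuous[wstarTopology P, wstarTopology P] f :=
    continuous_iInf_rng.2 fun φ => continuous_induced_rng.2 (hf φ φ.2)
  have h2 := @map_mem_closure E E (wstarTopology P) (wstarTopology P) _ _ _ _ h1 hx h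
  exact (@IsClosed.closure_eq E (wstarTopology P) _ (isClosed_wstarClosure P T)).subset h2

variable {A : Type*} [NonUnitalCStarAlgebra A]

/-- The functional `x ↦ star (φ (star x))`. -/
def starDual (φ : StrongDual ℂ A) : StrongDual ℂ A :=
  LinearMap.mkContinuous
    { toFun := fun x => star (φ (star x))
      map_add' := fun x y => by simp
      map_smul' := fun c x => by simp } ‖φ‖ (fun x => by
        change ‖star (φ (star x))‖ ≤ _
        rw [norm_star]
        exact (φ.le_opNorm _).trans (by rw [norm_star]))

@[simp] theorem starDual_apply (φ : StrongDual ℂ A) (x : A) :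
    starDual φ x = star (φ (star x)) := rfl

theorem norm_starDual_le (φ : StrongDual ℂ A) : ‖starDual φ‖ ≤ ‖φ‖ :=
  LinearMap.mkContinuous_norm_le _ (norm_nonneg _) _

theorem continuous_starDual : Continuous (starDual : StrongDual ℂ A → StrongDual ℂ A) := by
  refine (LipschitzWith.of_dist_le_mul (K := 1) fun φ ψ => ?_).continuous
  have : starDual φ - starDual ψ = starDual (φ - ψ) := by
    ext x
    simp
  rw [dist_eq_norm, dist_eq_norm, this, NNReal.coe_one, one_mul]
  exact norm_starDual_le _

/-- A space of functionals that is stable under the operations that correspond to the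
involution and the left and right multiplications of the algebra, which are therefore continuous
for the weak topology. -/
structure IsAlgDual (P : Submodule ℂ (StrongDual ℂ A)) : Prop where
  star_mem : ∀ φ ∈ P, starDual φ ∈ P
  mul_left_mem : ∀ φ ∈ P, ∀ b, φ.comp (ContinuousLinearMap.mul ℂ A b) ∈ P
  mul_right_mem : ∀ φ ∈ P, ∀ b, φ.comp ((ContinuousLinearMap.mul ℂ A).flip b) ∈ P

theorem isAlgDual_of_span {S : Set (StrongDual ℂ A)} (h₁ : ∀ φ ∈ S, starDual φ ∈ S)
    (h₂ : ∀ φ ∈ S, ∀ b, φ.comp (ContinuousLinearMap.mul ℂ A b) ∈ S)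
    (h₃ : ∀ φ ∈ S, ∀ b, φ.comp ((ContinuousLinearMap.mul ℂ A).flip b) ∈ S) :
    IsAlgDual (Submodule.span ℂ S).topologicalClosure := by
  set P := (Submodule.span ℂ S).topologicalClosure
  have hS : S ⊆ P := Submodule.subset_span.trans (Submodule.le_topologicalClosure _)
  have hP : IsClosed (P : Set (StrongDual ℂ A)) := Submodule.isClosed_topologicalClosure _
  have key : ∀ T : A →L[ℂ] A, (∀ φ ∈ S, φ.comp T ∈ S) → ∀ φ ∈ P, φ.comp T ∈ P := by
    intro T hT
    let L : StrongDual ℂ A →L[ℂ] StrongDual ℂ A := (ContinuousLinearMap.compL ℂ A A ℂ).flip T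
    have h : P ≤ P.comap (L : StrongDual ℂ A →ₗ[ℂ] StrongDual ℂ A) := by
      refine Submodule.topologicalClosure_minimal _ (Submodule.span_le.2 fun φ hφ => ?_)
        (hP.preimage L.continuous)
      exact hS (hT φ hφ)
    exact fun φ hφ => h hφ
  refine ⟨?_, fun φ hφ b => key _ (fun ψ hψ => h₂ ψ hψ b) φ hφ,
    fun φ hφ b => key _ (fun ψ hψ => h₃ ψ hψ b) φ hφ⟩
  let Q : Submodule ℂ (StrongDual ℂ A) :=
    { carrier := {φ | starDual φ ∈ P}
      zero_mem' := by
        have : starDual (0 : StrongDual ℂ A) = 0 := by ext x; simp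
        simp [this]
      add_mem' := by
        intro φ ψ hφ hψ
        have : starDual (φ + ψ) = starDual φ + starDual ψ := by ext x; simp
        simpa only [Set.mem_ofPred_eq, this] using P.add_mem hφ hψ
      smul_mem' := by
        intro c φ hφ
        have : starDual (c • φ) = star c • starDual φ := by ext x; simp
        simpa only [Set.mem_ofPred_eq, this] using P.smul_mem _ hφ }
  have h : P ≤ Q := by
    refine Submodule.topologicalClosure_minimal _ (Submodule.span_le.2 fun φ hφ => ?_)
      (hP.preimage continuous_starDual)
    exact hS (h₁ φ hφ)
  exact fun φ hφ => h hφ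

/-- The weak-star closure of a *-subalgebra. -/
def wstarClosureAlg {P : Submodule ℂ (StrongDual ℂ A)} (hP : IsAlgDual P)
    (S : NonUnitalStarSubalgebra ℂ A) : NonUnitalStarSubalgebra ℂ A :=
  { wstarClosure P S.toNonUnitalSubalgebra.toSubmodule with
    mul_mem' := by
      intro a b ha hb
      refine wstarClosure_map_mem (f := fun x => a * x)
        (fun φ hφ => continuous_wstar (hP.mul_left_mem φ hφ a)) (fun y hy => ?_) hb
      refine wstarClosure_map_mem (f := fun x => x * y)
        (fun φ hφ => continuous_wstar (hP.mul_right_mem φ hφ y)) (fun x hx => ?_) ha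
      exact subset_wstarClosure _ _ (S.mul_mem hx hy)
    star_mem' := by
      intro a ha
      refine wstarClosure_map_mem (f := fun x => star x) (fun φ hφ => ?_) (fun y hy => ?_) ha
      · have h1 := continuous_wstar (hP.star_mem φ hφ)
        have h2 := @Continuous.comp _ _ _ (wstarTopology P) _ _ _ (fun z : ℂ => star z)
          continuous_star h1
        refine Eq.mp ?_ h2
        congr 1
        funext x
        simp
      · exact subset_wstarClosure _ _ (S.star_mem' hy) }

theorem coe_wstarClosureAlg {P : Submodule ℂ (StrongDual ℂ A)} (hP : IsAlgDual P)
    (S : NonUnitalStarSubalgebra ℂ A) :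
    (wstarClosureAlg hP S : Set A) = @closure A (wstarTopology P) (S : Set A) := rfl

instance {P : Submodule ℂ (StrongDual ℂ A)} (hP : IsAlgDual P)
    (S : NonUnitalStarSubalgebra ℂ A) : IsClosed (wstarClosureAlg hP S : Set A) :=
  isClosed_of_wstar (isClosed_wstarClosure P S.toNonUnitalSubalgebra.toSubmodule)

instance (A : Type*) [NonUnitalCStarAlgebra A] :
    IsClosed (NonUnitalStarSubalgebra.center ℂ A : Set A) := by
  have : (NonUnitalStarSubalgebra.center ℂ A : Set A) = ⋂ b : A, {a | b * a = a * b} := by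
    ext a
    simp only [Set.mem_iInter, Set.mem_ofPred_eq, SetLike.mem_coe]
    exact Semigroup.mem_center_iff
  rw [this]
  exact isClosed_iInter fun b =>
    isClosed_eq (continuous_const.mul continuous_id) (continuous_id.mul continuous_const)

/-- The space of the restrictions to `S` of the functionals in `P`. If `P` is a predual and `S` is
weak-star closed, this is the predual of `S`. -/
def restrictPredual (P : Submodule ℂ (StrongDual ℂ A)) (S : NonUnitalStarSubalgebra ℂ A)
    [IsClosed (S : Set A)] : Submodule ℂ (StrongDual ℂ S) where
  carrier := {ψ | ∃ φ ∈ P, ∀ x : S, ψ x = φ x}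
  zero_mem' := ⟨0, P.zero_mem, fun x => rfl⟩
  add_mem' := by
    rintro ψ ψ' ⟨φ, hφ, h⟩ ⟨φ', hφ', h'⟩
    exact ⟨φ + φ', P.add_mem hφ hφ', fun x => by simp [h, h']⟩
  smul_mem' := by
    rintro c ψ ⟨φ, hφ, h⟩
    exact ⟨c • φ, P.smul_mem c hφ, fun x => by simp [h]⟩

end Closure

/-! ### Finitely supported kernels and the algebra of kernels -/

namespace FellBundle

variable {G : Type u} [Group G] {B : FellBundle.{u, v} G}

/-- Transport between equal fibres. -/
def castFiber {s r : G} (h : s = r) (a : B.fiber s) : B.fiber r := h ▸ a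

theorem castFiber_zero {s r : G} (h : s = r) : castFiber h (0 : B.fiber s) = 0 := by
  subst h
  rfl

theorem mul_castFiber {s t r u : G} (h : s = u) (h₁ : u * t = r) (h₂ : s * t = r)
    (a : B.fiber s) (b : B.fiber t) : B.mul h₁ (castFiber h a) b = B.mul h₂ a b := by
  subst h
  rfl

end FellBundle

namespace WStarFellBundle

open FellBundle

open scoped Classical in
/-- The section supported at `r` with value `a`. -/
def L2.single {G : Type u} [Group G] {M : WStarFellBundle.{u, v} G} (r : G) (a : M.fiber r) :
    L2 M :=
  ⟨Pi.single r a, ‖a‖ ^ 2, fun F => by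
    have h : ∀ t ∈ F, t ≠ r →
        ip (Pi.single (M := M.fiber) r a t) (Pi.single (M := M.fiber) r a t) = 0 := by
      intro t _ ht
      rw [Pi.single_eq_of_ne ht, ip_zero_left]
    by_cases hr : r ∈ F
    · rw [Finset.sum_eq_single_of_mem r hr h, Pi.single_eq_same, norm_ip_self]
    · rw [Finset.sum_eq_zero fun t ht => h t ht (fun e => hr (e ▸ ht)), norm_zero]
      positivity⟩

variable {G : Type u} [Group G] {M : WStarFellBundle.{u, v} G}

namespace L2

open scoped Classical in
@[simp] theorem single_same (r : G) (a : M.fiber r) : single r a r = a :=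
  Pi.single_eq_same (M := M.fiber) r a

open scoped Classical in
theorem single_of_ne {r t : G} (h : t ≠ r) (a : M.fiber r) : single r a t = 0 :=
  Pi.single_eq_of_ne (M := M.fiber) h a

theorem single_add (r : G) (a b : M.fiber r) : single r (a + b) = single r a + single r b := by
  ext t
  rcases eq_or_ne t r with rfl | h
  · simp
  · simp [single_of_ne h]

theorem single_smul (r : G) (c : ℂ) (a : M.fiber r) : single r (c • a) = c • single r a := by
  ext t
  rcases eq_or_ne t r with rfl | h
  · simp
  · simp [single_of_ne h]

theorem ipL_single_left (r : G) (a : M.fiber r) (η : L2 M) : ipL (single r a) η = ip a (η r) := by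
  refine ipL_eq fun φ hφ => ?_
  have h := hasSum_single (f := fun t => φ (ip (single r a t) (η t))) r fun t ht => by
    rw [single_of_ne ht, ip_zero_left, map_zero]
  simpa using h

theorem ipL_single_right (r : G) (a : M.fiber r) (η : L2 M) :
    ipL η (single r a) = ip (η r) a := by
  rw [← star_ipL, ipL_single_left, star_ip]

theorem norm_single (r : G) (a : M.fiber r) : ‖single r a‖ = ‖a‖ := by
  have h := norm_sq_eq (single r a)
  rw [ipL_single_left, single_same, norm_ip_self] at h
  exact (pow_left_inj₀ (norm_nonneg _) (norm_nonneg _) two_ne_zero).1 h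

end L2

variable (M)

/-- The algebra `𝓛(ℓ²(M))` of adjointable operators on the module of square summable sections. -/
def Op : Type (max u v) := Adjointable (M.fiber 1)ᵐᵒᵖ (L2 M)

instance : CStarAlgebra (Op M) := inferInstanceAs (CStarAlgebra (Adjointable (M.fiber 1)ᵐᵒᵖ (L2 M)))

/-- The algebra `ℓ^∞(G, 𝓛(ℓ²(M)))`. -/
abbrev LInfOp : Type (max u v) := lp (fun _ : G => Op M) ∞

variable {M}

theorem inner_eq (ξ η : L2 M) : inner (M.fiber 1)ᵐᵒᵖ ξ η = MulOpposite.op (L2.ipL ξ η) := rfl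

theorem ipL_star (T : Op M) (ξ η : L2 M) : L2.ipL (T.1 ξ) η = L2.ipL ξ ((star T).1 η) :=
  MulOpposite.op_injective (Adjointable.inner_star T ξ η)

theorem op_ext {T S : Op M} (h : ∀ ξ r, T.1 ξ r = S.1 ξ r) : T = S :=
  Subtype.ext (ContinuousLinearMap.ext fun ξ => L2.ext (h ξ))

/-- The operator `ξ ↦ δ_r (a ξ(s))`, for `a` in the fibre at `u = r s⁻¹`. -/
def elemOp {u s r : G} (h : u * s = r) : M.fiber u →ₗ[ℂ] Op M where
  toFun a :=
    ⟨LinearMap.mkContinuous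
      { toFun := fun ξ => L2.single r (M.mul h a (ξ s))
        map_add' := fun ξ η => by rw [L2.add_apply, M.mul_add, L2.single_add]
        map_smul' := fun c ξ => by
          rw [L2.smul_apply, M.mul_smul, L2.single_smul, RingHom.id_apply] } ‖a‖ (fun ξ => by
        change ‖L2.single r (M.mul h a (ξ s))‖ ≤ _
        rw [L2.norm_single]
        exact (M.norm_mul_le h _ _).trans
          (mul_le_mul_of_nonneg_left (L2.norm_coord_le ξ s) (norm_nonneg _))),
      LinearMap.mkContinuous
      { toFun := fun ξ => L2.single s (M.mul (by rw [← h, inv_mul_cancel_left]) (M.adj rfl a) (ξ r))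
        map_add' := fun ξ η => by rw [L2.add_apply, M.mul_add, L2.single_add]
        map_smul' := fun c ξ => by
          rw [L2.smul_apply, M.mul_smul, L2.single_smul, RingHom.id_apply] } ‖a‖ (fun ξ => by
        change ‖L2.single s (M.mul (by rw [← h, inv_mul_cancel_left]) (M.adj rfl a) (ξ r))‖ ≤ _
        rw [L2.norm_single]
        refine (M.norm_mul_le _ _ _).trans ?_
        rw [norm_adj]
        exact mul_le_mul_of_nonneg_left (L2.norm_coord_le ξ r) (norm_nonneg _)),
      fun ξ η => by
        refine congrArg MulOpposite.op ?_
        change L2.ipL (L2.single r _) η = L2.ipL ξ (L2.single s _)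
        rw [L2.ipL_single_left, L2.ipL_single_right]
        exact ip_mul_left h rfl _ a (ξ s) (η r)⟩
  map_add' a b := op_ext fun ξ t => by
    change L2.single r (M.mul h (a + b) (ξ s)) t =
      (L2.single r (M.mul h a (ξ s)) + L2.single r (M.mul h b (ξ s))) t
    rw [M.add_mul, L2.single_add]
  map_smul' c a := op_ext fun ξ t => by
    change L2.single r (M.mul h (c • a) (ξ s)) t = (c • L2.single r (M.mul h a (ξ s))) t
    rw [M.smul_mul, L2.single_smul]

theorem elemOp_apply {u s r : G} (h : u * s = r) (a : M.fiber u) (ξ : L2 M) :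
    (elemOp h a).1 ξ = L2.single r (M.mul h a (ξ s)) := rfl

theorem norm_elemOp_le {u s r : G} (h : u * s = r) (a : M.fiber u) : ‖elemOp h a‖ ≤ ‖a‖ := by
  refine ContinuousLinearMap.opNorm_le_bound _ (norm_nonneg _) fun ξ => ?_
  change ‖L2.single r (M.mul h a (ξ s))‖ ≤ _
  rw [L2.norm_single]
  exact (M.norm_mul_le h _ _).trans
    (mul_le_mul_of_nonneg_left (L2.norm_coord_le ξ s) (norm_nonneg _))

theorem star_elemOp {u u' s r : G} (h : u * s = r) (hu : u⁻¹ = u') (h' : u' * r = s)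
    (a : M.fiber u) : star (elemOp h a) = elemOp h' (M.adj hu a) :=
  Adjointable.eq_star fun ξ η => by
    refine congrArg MulOpposite.op ?_
    rw [elemOp_apply, elemOp_apply, L2.ipL_single_left, L2.ipL_single_right]
    exact ip_mul_left h hu h' a (ξ s) (η r)

theorem elemOp_mul {u w uw q s r : G} (h : u * s = r) (h' : w * q = s) (h₁ : u * w = uw)
    (h₂ : uw * q = r) (a : M.fiber u) (b : M.fiber w) :
    elemOp h a * elemOp h' b = elemOp h₂ (M.mul h₁ a b) := by
  refine op_ext fun ξ t => ?_
  change L2.single r (M.mul h a (L2.single s (M.mul h' b (ξ q)) s)) t = _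
  rw [L2.single_same, elemOp_apply, M.mul_assoc h₁ h₂ h' h]

theorem elemOp_mul_of_ne {u w q s s' r : G} (h : u * s = r) (h' : w * q = s') (hs : s ≠ s')
    (a : M.fiber u) (b : M.fiber w) : elemOp h a * elemOp h' b = 0 := by
  refine op_ext fun ξ t => ?_
  change L2.single r (M.mul h a (L2.single s' (M.mul h' b (ξ q)) s)) t = _
  have e := M.mul_smul h 0 a 0
  rw [zero_smul, zero_smul] at e
  rw [L2.single_of_ne hs, e]
  have e' := L2.single_smul r 0 (0 : M.fiber r)
  rw [zero_smul, zero_smul] at e'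
  rw [e']
  rfl

variable (M)

/-- The finitely supported kernels `k`, where `k(r, s)` belongs to the fibre at `r s⁻¹`. -/
abbrev Kernel : Type (max u v) := Π₀ p : G × G, M.fiber (p.1 * p.2⁻¹)

variable {M}

/-- The action `β` of `G` on the kernels: `β_t(k)(r, s) = k(r t, s t)`. -/
def shift (t : G) (k : Kernel M) : Kernel M :=
  DFinsupp.mapRange
    (fun p : G × G => castFiber (show p.1 * t * (p.2 * t)⁻¹ = p.1 * p.2⁻¹ by group))
    (fun _ => castFiber_zero _)
    (DFinsupp.comapDomain' (fun p : G × G => (p.1 * t, p.2 * t))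
      (h' := fun p : G × G => (p.1 * t⁻¹, p.2 * t⁻¹)) (fun p => by simp) k)

open scoped Classical in
/-- The operator `π(k)` of a kernel `k`; see `opOfKernel_apply` for the formula. -/
def opOfKernel : Kernel M →ₗ[ℂ] Op M :=
  DFinsupp.lsum ℂ fun p : G × G => elemOp (inv_mul_cancel_right p.1 p.2)

open scoped Classical in
theorem opOfKernel_single (p : G × G) (a : M.fiber (p.1 * p.2⁻¹)) :
    opOfKernel (DFinsupp.single p a : Kernel M) = elemOp (inv_mul_cancel_right p.1 p.2) a := by
  rw [opOfKernel, DFinsupp.lsum_single]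

theorem zero_mul_fiber {s t r : G} (h : s * t = r) (b : M.fiber t) : M.mul h 0 b = 0 := by
  have := M.smul_mul h 0 0 b
  rwa [zero_smul, zero_smul] at this

/-- The action of a kernel on sections: `(π(k) ξ)(r) = ∑ s, k(r, s) ξ(s)`. -/
theorem opOfKernel_apply (k : Kernel M) (ξ : L2 M) (r : G) :
    (opOfKernel k).1 ξ r = ∑ᶠ s, M.mul (inv_mul_cancel_right r s) (k (r, s)) (ξ s) := by
  classical
  have hfin : ∀ k : Kernel M, (Function.support fun s =>
      M.mul (inv_mul_cancel_right r s) (k (r, s)) (ξ s)).Finite := by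
    intro k
    refine (k.support.image Prod.snd).finite_toSet.subset fun s hs => ?_
    rw [Finset.coe_image]
    refine ⟨(r, s), ?_, rfl⟩
    rw [Finset.mem_coe, DFinsupp.mem_support_iff]
    intro h0
    refine hs ?_
    change M.mul _ (k (r, s)) _ = 0
    rw [h0]
    exact zero_mul_fiber _ _
  induction k using DFinsupp.induction with
  | h0 =>
    rw [map_zero]
    refine (finsum_eq_zero_of_forall_eq_zero fun s => ?_).symm
    exact zero_mul_fiber _ _
  | ha p a k _ _ ih =>
    rw [map_add]
    have e : ∀ s, M.mul (inv_mul_cancel_right r s)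
        ((DFinsupp.single p a + k : Kernel M) (r, s)) (ξ s) =
        M.mul (inv_mul_cancel_right r s) ((DFinsupp.single p a : Kernel M) (r, s)) (ξ s) +
        M.mul (inv_mul_cancel_right r s) (k (r, s)) (ξ s) := fun s => by
      rw [DFinsupp.add_apply, M.add_mul]
    simp only [e]
    rw [finsum_add_distrib (hfin _) (hfin _), ← ih, opOfKernel_single]
    change (L2.single p.1 (M.mul _ a (ξ p.2)) + (opOfKernel k).1 ξ) r = _
    rw [L2.add_apply]
    congr 1
    obtain ⟨p₁, p₂⟩ := p
    rw [finsum_eq_single _ p₂ fun s hs => by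
      rw [DFinsupp.single_eq_of_ne (by simpa using fun _ => hs)]
      exact zero_mul_fiber _ _]
    rcases eq_or_ne r p₁ with rfl | hr
    · rw [L2.single_same, DFinsupp.single_eq_same]
    · rw [L2.single_of_ne hr, DFinsupp.single_eq_of_ne (by simp [hr])]
      exact (zero_mul_fiber _ _).symm

theorem shift_apply (t : G) (k : Kernel M) (r s : G) :
    shift t k (r, s) = castFiber (by group) (k (r * t, s * t)) := rfl

theorem castFiber_add {s r : G} (h : s = r) (a b : M.fiber s) :
    castFiber h (a + b) = castFiber (B := M.toFellBundle) h a + castFiber h b := by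
  subst h
  rfl

theorem castFiber_smul {s r : G} (h : s = r) (c : ℂ) (a : M.fiber s) :
    castFiber (B := M.toFellBundle) h (c • a) = c • castFiber h a := by
  subst h
  rfl

theorem shift_add (t : G) (k l : Kernel M) : shift t (k + l) = shift t k + shift t l :=
  DFinsupp.ext fun _ => castFiber_add _ _ _

theorem shift_smul (t : G) (c : ℂ) (k : Kernel M) : shift t (c • k) = c • shift t k :=
  DFinsupp.ext fun _ => castFiber_smul _ _ _

open scoped Classical in
theorem opOfKernel_shift_single (t : G) (r s : G) (a : M.fiber (r * s⁻¹)) :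
    opOfKernel (shift t⁻¹ (DFinsupp.single (r, s) a : Kernel M)) =
      elemOp (show r * s⁻¹ * (s * t) = r * t by group) a := by
  refine op_ext fun ξ q => ?_
  rw [opOfKernel_apply, elemOp_apply]
  have e : ∀ x, M.mul (inv_mul_cancel_right q x)
      (shift t⁻¹ (DFinsupp.single (r, s) a : Kernel M) (q, x)) (ξ x) =
      M.mul (show q * t⁻¹ * (x * t⁻¹)⁻¹ * x = q by group)
      ((DFinsupp.single (r, s) a : Kernel M) (q * t⁻¹, x * t⁻¹)) (ξ x) := fun x => by
    rw [shift_apply]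
    exact mul_castFiber _ _ _ _ _
  simp only [e]
  rw [finsum_eq_single _ (s * t) fun x hx => by
    rw [DFinsupp.single_eq_of_ne (by
      intro h
      exact hx (by rw [← (Prod.mk.inj h).2, inv_mul_cancel_right]))]
    exact zero_mul_fiber _ _]
  rcases eq_or_ne q (r * t) with rfl | hq
  · rw [L2.single_same]
    have key : ∀ (x y : G) (hx : r = x) (hy : s = y) (h₁ : x * y⁻¹ * (s * t) = r * t),
        M.mul h₁ ((DFinsupp.single (r, s) a : Kernel M) (x, y)) (ξ (s * t)) =
        M.mul (show r * s⁻¹ * (s * t) = r * t by group) a (ξ (s * t)) := by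
      rintro x y rfl rfl h₁
      rw [DFinsupp.single_eq_same]
    exact key _ _ (mul_inv_cancel_right r t).symm (mul_inv_cancel_right s t).symm _
  · rw [L2.single_of_ne hq, DFinsupp.single_eq_of_ne (by
      intro h
      exact hq (by rw [← (Prod.mk.inj h).1, inv_mul_cancel_right]))]
    exact zero_mul_fiber _ _

theorem exists_norm_opOfKernel_shift_le (k : Kernel M) :
    ∃ C : ℝ, ∀ t : G, ‖opOfKernel (shift t⁻¹ k)‖ ≤ C := by
  classical
  induction k using DFinsupp.induction with
  | h0 =>
    refine ⟨0, fun t => ?_⟩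
    have : shift t⁻¹ (0 : Kernel M) = 0 := by simpa using shift_smul t⁻¹ 0 (0 : Kernel M)
    rw [this, map_zero, norm_zero]
  | ha p a k _ _ ih =>
    obtain ⟨C, hC⟩ := ih
    refine ⟨‖a‖ + C, fun t => ?_⟩
    rw [shift_add, map_add]
    refine (norm_add_le _ _).trans (add_le_add ?_ (hC t))
    rw [opOfKernel_shift_single t p.1 p.2 a]
    exact norm_elemOp_le _ _

/-- The representation of the kernels in `ℓ^∞(G, 𝓛(ℓ²(M)))`, with `t ↦ π(β_t⁻¹(k))` as the image
of `k`. -/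
def kernelRep : Kernel M →ₗ[ℂ] LInfOp M where
  toFun k := ⟨fun t => opOfKernel (shift t⁻¹ k), memℓp_infty (by
    obtain ⟨C, hC⟩ := exists_norm_opOfKernel_shift_le k
    exact ⟨C, by rintro _ ⟨t, rfl⟩; exact hC t⟩)⟩
  map_add' k l := by
    ext t : 2
    change opOfKernel (shift t⁻¹ (k + l)) = opOfKernel (shift t⁻¹ k) + opOfKernel (shift t⁻¹ l)
    rw [shift_add, map_add]
  map_smul' c k := by
    ext t : 2
    change opOfKernel (shift t⁻¹ (c • k)) = c • opOfKernel (shift t⁻¹ k)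
    rw [shift_smul, map_smul]

end WStarFellBundle

namespace WStarFellBundle

open FellBundle

variable {G : Type u} [Group G] {M : WStarFellBundle.{u, v} G}

theorem kernelRep_apply (k : Kernel M) (t : G) :
    kernelRep k t = opOfKernel (shift t⁻¹ k) := rfl

open scoped Classical in
theorem kernelRep_single (r s : G) (a : M.fiber (r * s⁻¹)) (t : G) :
    kernelRep (DFinsupp.single (r, s) a : Kernel M) t =
      elemOp (show r * s⁻¹ * (s * t) = r * t by group) a :=
  opOfKernel_shift_single t r s a

theorem kernelRep_star_mem (k : Kernel M) : star (kernelRep k) ∈ LinearMap.range (kernelRep (M := M)) := by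
  classical
  induction k using DFinsupp.induction with
  | h0 =>
    rw [map_zero, star_zero]
    exact Submodule.zero_mem _
  | ha p a k _ _ ih =>
    rw [map_add, star_add]
    refine Submodule.add_mem _ ?_ ih
    obtain ⟨r, s⟩ := p
    refine ⟨DFinsupp.single (s, r) (M.adj (by group) a), ?_⟩
    ext t : 2
    rw [lp.coeFn_star, Pi.star_apply, kernelRep_single, kernelRep_single]
    exact (star_elemOp _ _ _ a).symm

theorem kernelRep_mul_mem (k l : Kernel M) :
    kernelRep k * kernelRep l ∈ LinearMap.range (kernelRep (M := M)) := by
  classical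
  induction k using DFinsupp.induction with
  | h0 =>
    rw [map_zero, zero_mul]
    exact Submodule.zero_mem _
  | ha p a k _ _ ih =>
    rw [map_add, _root_.add_mul]
    refine Submodule.add_mem _ ?_ ih
    clear ih
    induction l using DFinsupp.induction with
    | h0 =>
      rw [map_zero, mul_zero]
      exact Submodule.zero_mem _
    | ha q b l _ _ ih =>
      rw [map_add, _root_.mul_add]
      refine Submodule.add_mem _ ?_ ih
      obtain ⟨r, s⟩ := p
      obtain ⟨s', q⟩ := q
      rcases eq_or_ne s s' with rfl | hs
      · refine ⟨DFinsupp.single (r, q)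
          (M.mul (show r * s⁻¹ * (s * q⁻¹) = r * q⁻¹ by group) a b), ?_⟩
        ext t : 2
        rw [lp.infty_coeFn_mul, Pi.mul_apply, kernelRep_single, kernelRep_single,
          kernelRep_single]
        exact (elemOp_mul _ _ _ _ a b).symm
      · refine ⟨0, ?_⟩
        ext t : 2
        rw [lp.infty_coeFn_mul, Pi.mul_apply, kernelRep_single, kernelRep_single, map_zero]
        exact (elemOp_mul_of_ne _ _ (fun h => hs (mul_right_cancel h)) a b).symm

variable (M)

/-- The image of the finitely supported kernels in `ℓ^∞(G, 𝓛(ℓ²(M)))`. -/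
def kernelRange : NonUnitalStarSubalgebra ℂ (LInfOp M) :=
  { LinearMap.range (kernelRep (M := M)) with
    mul_mem' := by
      rintro _ _ ⟨k, rfl⟩ ⟨l, rfl⟩
      exact kernelRep_mul_mem k l
    star_mem' := by
      rintro _ ⟨k, rfl⟩
      exact kernelRep_star_mem k }

theorem coe_kernelRange : (kernelRange M : Set (LInfOp M)) = Set.range (kernelRep (M := M)) := rfl

variable {M}

/-- The functional `T ↦ φ ⟨ξ, T η⟩`. -/
def opFunctional (φ : StrongDual ℂ (M.fiber 1)) (ξ η : L2 M) : StrongDual ℂ (Op M) :=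
  LinearMap.mkContinuous
    { toFun := fun T => φ (L2.ipL ξ (T.1 η))
      map_add' := fun T S => by
        change φ (L2.ipL ξ (T.1 η + S.1 η)) = _
        rw [L2.ipL_add_right, map_add]
      map_smul' := fun c T => by
        change φ (L2.ipL ξ (c • T.1 η)) = _
        rw [L2.ipL_smul_right, map_smul, RingHom.id_apply] } (‖φ‖ * (‖ξ‖ * ‖η‖)) (fun T => by
    change ‖φ (L2.ipL ξ (T.1 η))‖ ≤ _
    have h1 : ‖L2.ipL ξ (T.1 η)‖ ≤ ‖ξ‖ * ‖T.1 η‖ :=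
      CStarModule.norm_inner_le (A := (M.fiber 1)ᵐᵒᵖ) (L2 M)
    have h2 := Adjointable.norm_apply_le T η
    calc ‖φ (L2.ipL ξ (T.1 η))‖ ≤ ‖φ‖ * (‖ξ‖ * (‖T‖ * ‖η‖)) :=
          (φ.le_opNorm _).trans (by gcongr; exact h1.trans (mul_le_mul_of_nonneg_left h2 (norm_nonneg _)))
      _ = ‖φ‖ * (‖ξ‖ * ‖η‖) * ‖T‖ := by ring)

theorem opFunctional_apply (φ : StrongDual ℂ (M.fiber 1)) (ξ η : L2 M) (T : Op M) :
    opFunctional φ ξ η T = φ (L2.ipL ξ (T.1 η)) := rfl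

variable (M)

/-- The functionals `T ↦ φ ⟨ξ, T η⟩` on `𝓛(ℓ²(M))`, with `φ` weak-star continuous. -/
def opFunctionals : Set (StrongDual ℂ (Op M)) :=
  {ω | ∃ φ ∈ M.predual 1, ∃ ξ η : L2 M, ω = opFunctional φ ξ η}

/-- The predual of the W*-algebra `𝓛(ℓ²(M))`: the closed linear span of the functionals
`T ↦ φ ⟨ξ, T η⟩`. -/
def opPredual : Submodule ℂ (StrongDual ℂ (Op M)) :=
  (Submodule.span ℂ (opFunctionals M)).topologicalClosure

theorem isAlgDual_opPredual : IsAlgDual (opPredual M) := by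
  refine isAlgDual_of_span ?_ ?_ ?_
  · rintro _ ⟨φ, hφ, ξ, η, rfl⟩
    obtain ⟨ψ, hψ, h⟩ := M.isStarPredual.star_mem φ hφ
    refine ⟨ψ, hψ, η, ξ, ?_⟩
    ext T
    rw [starDual_apply, opFunctional_apply, opFunctional_apply, h, ← ipL_star, L2.star_ipL]
  · rintro _ ⟨φ, hφ, ξ, η, rfl⟩ S
    refine ⟨φ, hφ, (star S).1 ξ, η, ?_⟩
    ext T
    rw [opFunctional_apply, ipL_star, star_star]
    rfl
  · rintro _ ⟨φ, hφ, ξ, η, rfl⟩ S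
    exact ⟨φ, hφ, ξ, S.1 η, rfl⟩

end WStarFellBundle

/-! ### Bounded functions on a group -/

section Bounded

variable {G : Type*} [Group G] {N : Type*} [NonUnitalCStarAlgebra N]

/-- The predual of `ℓ^∞(G, N)`, where `P` is the predual of `N`: the closed linear span of the
functionals `f ↦ φ (f t)`, with `φ` in `P` and `t` in `G`. -/
def linftyPredual (P : Submodule ℂ (StrongDual ℂ N)) :
    Submodule ℂ (StrongDual ℂ (lp (fun _ : G => N) ∞)) :=
  (Submodule.span ℂ {ω | ∃ φ ∈ P, ∃ t : G,
    ω = φ.comp (lp.evalCLM ℂ (fun _ : G => N) ∞ t)}).topologicalClosure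

theorem isAlgDual_linftyPredual {P : Submodule ℂ (StrongDual ℂ N)} (hP : IsAlgDual P) :
    IsAlgDual (linftyPredual (G := G) P) := by
  refine isAlgDual_of_span ?_ ?_ ?_
  · rintro _ ⟨φ, hφ, t, rfl⟩
    exact ⟨starDual φ, hP.star_mem φ hφ, t, rfl⟩
  · rintro _ ⟨φ, hφ, t, rfl⟩ f
    exact ⟨φ.comp (ContinuousLinearMap.mul ℂ N (f t)), hP.mul_left_mem φ hφ (f t), t, rfl⟩
  · rintro _ ⟨φ, hφ, t, rfl⟩ f
    exact ⟨φ.comp ((ContinuousLinearMap.mul ℂ N).flip (f t)), hP.mul_right_mem φ hφ (f t), t, rfl⟩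

/-- Translation of functions: `(translateFun t f)(s) = f(t⁻¹ s)`. -/
def translateFun (t : G) (f : lp (fun _ : G => N) ∞) : lp (fun _ : G => N) ∞ :=
  ⟨fun s => f (t⁻¹ * s), memℓp_infty ⟨‖f‖, by
    rintro _ ⟨s, rfl⟩
    exact lp.norm_apply_le_norm ENNReal.top_ne_zero f _⟩⟩

theorem translateFun_apply (t : G) (f : lp (fun _ : G => N) ∞) (s : G) :
    translateFun t f s = f (t⁻¹ * s) := rfl

end Bounded

namespace WStarFellBundle

variable {G : Type u} [Group G] (M : WStarFellBundle.{u, v} G)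

/-- The W*-algebra of kernels of a W*-Fell bundle: the weak-star closure of the image of the
kernels in `ℓ^∞(G, 𝓛(ℓ²(M)))`. -/
def kernelAlg : NonUnitalStarSubalgebra ℂ (LInfOp M) :=
  wstarClosureAlg (isAlgDual_linftyPredual (isAlgDual_opPredual M)) (kernelRange M)

instance : IsClosed (kernelAlg M : Set (LInfOp M)) :=
  inferInstanceAs (IsClosed (wstarClosureAlg (isAlgDual_linftyPredual (isAlgDual_opPredual M))
    (kernelRange M) : Set (LInfOp M)))

/-- The predual of the W*-algebra of kernels. -/
def kernelPredual : Submodule ℂ (StrongDual ℂ (kernelAlg M)) :=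
  restrictPredual (linftyPredual (opPredual M)) (kernelAlg M)

end WStarFellBundle

/-! ### Partial actions -/

/-- A set theoretic partial action of `G` on `X`, with domains `X_t = dom t` and bijections
`σ_t : X_{t⁻¹} → X_t`. -/
@[ext] structure PartialAction (G X : Type*) [Group G] where
  dom : G → Set X
  map : ∀ t, dom t⁻¹ → dom t
  dom_one : dom 1 = Set.univ
  map_one : ∀ x : dom 1⁻¹, (map 1 x : X) = x
  mem_dom : ∀ (s t : G) (x : dom t⁻¹), (map t x : X) ∈ dom s⁻¹ → (x : X) ∈ dom (s * t)⁻¹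
  map_mul : ∀ (s t : G) (x : dom t⁻¹) (h : (map t x : X) ∈ dom s⁻¹),
    (map (s * t) ⟨x, mem_dom s t x h⟩ : X) = map s ⟨map t x, h⟩

namespace PartialAction

variable {G X Y : Type*} [Group G]

/-- A partial action is global if all its domains are the whole space. -/
def IsGlobal (σ : PartialAction G X) : Prop := ∀ t, σ.dom t = Set.univ

/-- Equivariant maps between partial actions. -/
def IsMorphism (σ : PartialAction G X) (τ : PartialAction G Y) (f : X → Y) : Prop :=
  (∀ t, ∀ x ∈ σ.dom t, f x ∈ τ.dom t) ∧
    ∀ t (x : σ.dom t⁻¹) (h : f x ∈ τ.dom t⁻¹), f (σ.map t x) = τ.map t ⟨f x, h⟩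

variable (σ : PartialAction G X)

theorem map_eq_self {u : G} (hu : u = 1) (x : σ.dom u⁻¹) : (σ.map u x : X) = x := by
  subst hu
  exact σ.map_one x

theorem map_map_inv {s t : G} (h : s * t = 1) (x : σ.dom t⁻¹) :
    ∃ hx : (σ.map t x : X) ∈ σ.dom s⁻¹, (σ.map s ⟨σ.map t x, hx⟩ : X) = x := by
  have hs : t = s⁻¹ := (inv_eq_of_mul_eq_one_right h).symm
  have hx : (σ.map t x : X) ∈ σ.dom s⁻¹ := hs ▸ (σ.map t x).2
  exact ⟨hx, (σ.map_mul s t x hx).symm.trans (σ.map_eq_self h _)⟩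

/-- The restriction of a partial action to a subset `Y`, with domains
`Y_t = Y ∩ σ_t(X_{t⁻¹} ∩ Y)`. -/
def restrict {S : Type*} [SetLike S X] (Y : S) : PartialAction G Y where
  dom t := {y | ∃ x : σ.dom t⁻¹, (x : X) ∈ Y ∧ (σ.map t x : X) = y}
  map t y :=
    have hy : (y : X) ∈ σ.dom t⁻¹ := by
      obtain ⟨x, _, e⟩ := y.2
      exact e ▸ (σ.map t⁻¹ x).2
    ⟨⟨σ.map t ⟨y, hy⟩, by
      obtain ⟨x, hx, e'⟩ := y.2
      obtain ⟨h, e⟩ := σ.map_map_inv (mul_inv_cancel t) x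
      have : (⟨σ.map t⁻¹ x, h⟩ : σ.dom t⁻¹) = ⟨y, hy⟩ := Subtype.ext e'
      exact this ▸ e ▸ hx⟩, ⟨y, hy⟩, y.1.2, rfl⟩
  dom_one := by
    refine Set.eq_univ_of_forall fun y => ?_
    have h : (y : X) ∈ σ.dom 1⁻¹ := by
      rw [inv_one, σ.dom_one]
      trivial
    exact ⟨⟨y, h⟩, y.2, σ.map_one _⟩
  map_one y := Subtype.ext (σ.map_one _)
  mem_dom := by
    rintro s t ⟨⟨y, hY⟩, hy⟩ ⟨x, hx, e⟩
    have hy' : y ∈ σ.dom t⁻¹ := by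
      obtain ⟨x₀, _, e₀⟩ := hy
      have e₁ : (σ.map t⁻¹ x₀ : X) = y := e₀
      exact e₁ ▸ (σ.map t⁻¹ x₀).2
    change (σ.map s⁻¹ x : X) = σ.map t ⟨y, hy'⟩ at e
    obtain ⟨h, e'⟩ := σ.map_map_inv (mul_inv_cancel s) x
    have h1 : (σ.map t ⟨y, hy'⟩ : X) ∈ σ.dom s⁻¹ := e ▸ (σ.map s⁻¹ x).2
    have h2 : (σ.map s ⟨σ.map t ⟨y, hy'⟩, h1⟩ : X) = x := by
      rw [← e']
      congr 2
      exact Subtype.ext e.symm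
    have h3 := σ.mem_dom s t ⟨y, hy'⟩ h1
    have h4 := (σ.map_mul s t ⟨y, hy'⟩ h1).trans h2
    obtain ⟨h5, e5⟩ := σ.map_map_inv (inv_mul_cancel (s * t)) ⟨y, h3⟩
    exact ⟨⟨_, h5⟩, h4 ▸ hx, e5⟩
  map_mul := by
    rintro s t ⟨⟨y, hY⟩, hy⟩ h
    have hy' : y ∈ σ.dom t⁻¹ := by
      obtain ⟨x₀, _, e₀⟩ := hy
      have e₁ : (σ.map t⁻¹ x₀ : X) = y := e₀
      exact e₁ ▸ (σ.map t⁻¹ x₀).2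
    have h' : (σ.map t ⟨y, hy'⟩ : X) ∈ σ.dom s⁻¹ := by
      obtain ⟨x₀, _, e₀⟩ := h
      have e₁ : (σ.map s⁻¹ x₀ : X) = σ.map t ⟨y, hy'⟩ := e₀
      exact e₁ ▸ (σ.map s⁻¹ x₀).2
    exact Subtype.ext (σ.map_mul s t ⟨y, hy'⟩ h')

end PartialAction

/-! ### W*-partial actions and their enveloping actions -/

section WStarAction

variable {A N : Type*} [NonUnitalCStarAlgebra A] [NonUnitalCStarAlgebra N]

/-- The W*-ideals of a W*-algebra: the weak-star closed two-sided *-ideals. -/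
structure IsWStarIdeal (P : Submodule ℂ (StrongDual ℂ A)) (I : Set A) : Prop where
  zero_mem : (0 : A) ∈ I
  add_mem : ∀ a ∈ I, ∀ b ∈ I, a + b ∈ I
  smul_mem : ∀ (c : ℂ), ∀ a ∈ I, c • a ∈ I
  mul_left_mem : ∀ (b : A), ∀ a ∈ I, b * a ∈ I
  mul_right_mem : ∀ (b : A), ∀ a ∈ I, a * b ∈ I
  star_mem : ∀ a ∈ I, star a ∈ I
  isClosed : @IsClosed A (wstarTopology P) I

/-- The topology on a subset `I` of `A` inherited from the weak-star topology. -/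
@[reducible] def wstarTopologyOn (P : Submodule ℂ (StrongDual ℂ A)) (I : Set A) :
    TopologicalSpace I :=
  TopologicalSpace.induced Subtype.val (wstarTopology P)

variable {G : Type*} [Group G]

/-- A partial action of `G` on the W*-algebra `A` with predual `P` is a W*-partial action if its
domains are W*-ideals and its maps `σ_t` (which are bijective) are weak-star continuous
*-homomorphisms. -/
structure IsWStarPartialAction (P : Submodule ℂ (StrongDual ℂ A)) (σ : PartialAction G A) :
    Prop where
  isWStarIdeal : ∀ t, IsWStarIdeal P (σ.dom t)
  map_add : ∀ (t : G) (x y z : σ.dom t⁻¹), (z : A) = x + y →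
    (σ.map t z : A) = σ.map t x + σ.map t y
  map_smul : ∀ (t : G) (c : ℂ) (x z : σ.dom t⁻¹), (z : A) = c • (x : A) →
    (σ.map t z : A) = c • (σ.map t x : A)
  map_mul : ∀ (t : G) (x y z : σ.dom t⁻¹), (z : A) = x * y →
    (σ.map t z : A) = σ.map t x * σ.map t y
  map_star : ∀ (t : G) (x z : σ.dom t⁻¹), (z : A) = star (x : A) →
    (σ.map t z : A) = star (σ.map t x : A)
  continuous_map : ∀ t,
    Continuous[wstarTopologyOn P (σ.dom t⁻¹), wstarTopologyOn P (σ.dom t)] (σ.map t)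

/-- `δ`, acting on the W*-algebra `N` with predual `Q`, is a W*-enveloping action of the W*-partial
action `γ` on the W*-algebra `A` with predual `P`: it is a W*-global action, and there are a
W*-ideal `J` of `N`, whose linear `δ`-orbit is weak-star dense in `N`, and an isomorphism `ι` of
W*-partial actions between `γ` and the restriction of `δ` to `J`. -/
structure IsWStarEnvelopingAction (P : Submodule ℂ (StrongDual ℂ A)) (γ : PartialAction G A)
    (Q : Submodule ℂ (StrongDual ℂ N)) (δ : PartialAction G N) : Prop where
  isPredual_left : IsPredual P
  isWStarPartialAction_left : IsWStarPartialAction P γ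
  isPredual_right : IsPredual Q
  isWStarPartialAction_right : IsWStarPartialAction Q δ
  isGlobal : δ.IsGlobal
  exists_ideal : ∃ (J : NonUnitalStarSubalgebra ℂ N) (ι : A ≃⋆ₐ[ℂ] J),
    IsWStarIdeal Q (J : Set N) ∧
    Continuous[wstarTopology P, wstarTopologyOn Q (J : Set N)] ι ∧
    Continuous[wstarTopologyOn Q (J : Set N), wstarTopology P] ι.symm ∧
    PartialAction.IsMorphism γ (δ.restrict J) ι ∧
    PartialAction.IsMorphism (δ.restrict J) γ ι.symm ∧
    wstarClosure Q (Submodule.span ℂ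
      {y | ∃ (t : G) (x : δ.dom t⁻¹), (x : N) ∈ J ∧ y = δ.map t x}) = ⊤

end WStarAction

/-! ### The central partial action and the canonical action -/

/-- The translation action of `G` on `ℓ^∞(G, N)`. -/
def translation (G N : Type*) [Group G] [NonUnitalCStarAlgebra N] :
    PartialAction G (lp (fun _ : G => N) ∞) where
  dom _ := Set.univ
  map t f := ⟨translateFun t f, trivial⟩
  dom_one := rfl
  map_one f := by
    ext s : 2
    rw [translateFun_apply, inv_one, one_mul]
  mem_dom _ _ _ _ := trivial
  map_mul s t f _ := by
    ext r : 2
    rw [translateFun_apply, translateFun_apply, translateFun_apply, mul_inv_rev, mul_assoc]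

namespace WStarFellBundle

variable {G : Type u} [Group G] (M : WStarFellBundle.{u, v} G)

/-- The canonical action of `G` on the W*-algebra of kernels. -/
def canonicalAction : PartialAction G (kernelAlg M) := (translation G (Op M)).restrict (kernelAlg M)

/-- The W*-ideal `I_t` of the unit fibre: the weak-star closed span of `M_t M_t*`. -/
def fiberIdeal (t : G) : Submodule ℂ (M.fiber 1) :=
  wstarClosure (M.predual 1) (Submodule.span ℂ
    {a | ∃ x y : M.fiber t, a = M.mul (mul_inv_cancel t) x (M.adj rfl y)})

/-- The centre of the unit fibre. -/
abbrev centre : NonUnitalStarSubalgebra ℂ (M.fiber 1) := NonUnitalStarSubalgebra.center ℂ (M.fiber 1)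

/-- The centre of the W*-algebra of kernels. -/
abbrev kernelCentre : NonUnitalStarSubalgebra ℂ (kernelAlg M) :=
  NonUnitalStarSubalgebra.center ℂ (kernelAlg M)

/-- The central partial action of a W*-Fell bundle is the partial action `σ` on the centre of the
unit fibre whose domains are the centres of the ideals `I_t`, with `σ_t(z) x = x z` for all `z` in
the centre of `I_{t⁻¹}` and all `x` in the fibre at `t`. -/
structure IsCentralPartialAction (σ : PartialAction G (centre M)) : Prop where
  dom_eq : ∀ t, (Subtype.val '' σ.dom t : Set (M.fiber 1)) =
    {z | z ∈ fiberIdeal M t ∧ ∀ a ∈ fiberIdeal M t, z * a = a * z}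
  map_mul : ∀ (t : G) (z : σ.dom t⁻¹) (x : M.fiber t),
    M.mul (one_mul t) (σ.map t z : centre M).1 x = M.mul (mul_one t) x (z : centre M).1

end WStarFellBundle

end

noncomputable section

/-! ### Duality for weak-star topologies -/

section NormedSpace

variable {V W : Type*} [NormedAddCommGroup V] [NormedSpace ℂ V] [NormedAddCommGroup W]
  [NormedSpace ℂ W]

/-! Write M_t for the fibres, e for the unit of G and I_t for the weak-star closed span of M_t M_t*.
An element of the W*-algebra of kernels is viewed as a matrix whose (r,s) entry lies in M_{rs⁻¹}.
Its diagonal entries f_r therefore lie in M_e, and translation by t replaces f_r by f_{rt}. A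
central element commutes with every matrix that has a single entry. Hence it is determined by its
diagonal (`kernelCentre_ext`), its entries are central in M_e, and f_r a = a f_s for all a in
M_{rs⁻¹} (`diagEntry_mul_comm`).

The case s = e says that f_r acts on M_r from the left as f_e acts from the right. Elements of I_r
are determined by their left action on M_r (`fiberIdeal_ext`). This gives the uniqueness of σ, and
it shows that f_r = σ_r(f_e) whenever f_r lies in I_r. For existence, σ_t(z) is defined for every
central z, as a weak-star limit of sums Σ xᵢ z yᵢ, where the sums Σ xᵢ yᵢ form a bounded left
approximate unit of M_t (`exists_central`). The relation σ_r(z) a = a σ_s(z) of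
`centralFun_mul_comm` gives the composition law of σ. It also shows that the diagonal matrix with
entries σ_r(z) is central (`exists_kernelCentre`).

Let J be the set of central f with f_r in I_r for all r. By the above, f ↦ f_e is an isomorphism
from J onto Z(M_e), with inverse z ↦ diag(σ_r(z)). Since the entry of the translate at e is f_t =
σ_t(f_e), it carries the restricted translation action to σ. For density of the translates of J, the
weak-star closure of their span has a unit. Compression to any single diagonal entry shows that all
entries of this unit are 1, so it is a unit for the whole centre, and the closed ideal is everything
(`EnvelopingData.wstarClosure_span_orbit`).

The analytic part shows that the spaces of functionals in the statement are preduals: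
`IsPredual.restrict` for weak-star closed subalgebras, `isPredual_opPredual` for the adjointable
operators and `IsPredual.linfty` for bounded functions. Weak-star continuity of a map is proved by
pulling back functionals. For σ_t this rests on `IsPredual.mem_of_separating`, and for z ↦
diag(σ_r(z)) on matrix coefficients (`opPredual_le`). -/

/-- The distance to a closed subspace, computed by functionals. -/
theorem Submodule.exists_norm_sub_lt (Q : Submodule ℂ V) [hQ : IsClosed (Q : Set V)] {v : V} {C : ℝ}
    (h : ∀ g : StrongDual ℂ V, ‖g‖ ≤ 1 → (∀ w ∈ Q, g w = 0) → ‖g v‖ ≤ C) {ε : ℝ} (hε : 0 < ε) :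
    ∃ w ∈ Q, ‖v - w‖ < C + ε := by
  -- A norming functional of the class of `v` in the quotient, pulled back, is an admissible test
  -- functional in `h`.
  obtain ⟨g, hg, hg'⟩ := exists_dual_vector'' ℂ (Q.mkQ v : V ⧸ Q)
  have h1 : ‖(Q.mkQ v : V ⧸ Q)‖ ≤ C := by
    let g' : StrongDual ℂ V := (g.toLinearMap ∘ₗ Q.mkQ).mkContinuous 1 fun w =>
      (g.le_opNorm _).trans (mul_le_mul hg (Submodule.Quotient.norm_mk_le Q w) (norm_nonneg _)
        zero_le_one)
    have h2 := h g' (LinearMap.mkContinuous_norm_le _ zero_le_one _) fun w hw => by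
      have h3 : Q.mkQ w = 0 := by rwa [Submodule.mkQ_apply, Submodule.Quotient.mk_eq_zero]
      change g (Q.mkQ w) = 0
      rw [h3, map_zero]
    refine le_trans ?_ h2
    change _ ≤ ‖g (Q.mkQ v)‖
    rw [hg']
    simp
  obtain ⟨u, hu, hn⟩ := Submodule.Quotient.norm_mk_lt (S := Q) (Q.mkQ v) hε
  refine ⟨v - u, (Submodule.Quotient.eq Q).1 hu.symm, ?_⟩
  rw [sub_sub_cancel]
  linarith

/-- A limit point of the image is the sum of a rapidly convergent series of image points. Their
lifts have controlled norm, so the lifted series converges in the complete space `P`. The factor 2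
leaves room for lifts whose infimal norm is not attained. -/
theorem Submodule.isClosed_map_of_lift [CompleteSpace V] (P : Submodule ℂ V)
    (hP : IsClosed (P : Set V)) (r : V →L[ℂ] W)
    (h : ∀ v ∈ P, 0 < ‖r v‖ → ∃ u ∈ P, r u = r v ∧ ‖u‖ ≤ 2 * ‖r v‖) :
    IsClosed (P.map r.toLinearMap : Set W) := by
  have : CompleteSpace P := hP.completeSpace_coe
  let f : NormedAddGroupHom P W := ((r.comp P.subtypeL : P →L[ℂ] W) : P →+ W).mkNormedAddGroupHom
    ‖r.comp P.subtypeL‖ fun x => (r.comp P.subtypeL).le_opNorm x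
  have hf : f.SurjectiveOnWith f.range 2 := by
    rintro w ⟨v, hv⟩
    have hv' : r v = w := hv
    rcases eq_or_ne w 0 with h0 | h0
    · exact ⟨0, by rw [h0, map_zero], by rw [h0]; simp⟩
    · obtain ⟨u, hu, hr, hn⟩ := h v v.2 (by rw [hv']; exact norm_pos_iff.2 h0)
      exact ⟨⟨u, hu⟩, hr.trans hv', by rwa [hv'] at hn⟩
  have h2 := controlled_closure_of_complete two_pos one_pos hf
  have hr : (P.map r.toLinearMap : Set W) = f.range := by
    ext w
    constructor
    · rintro ⟨v, hv, rfl⟩; exact ⟨⟨v, hv⟩, rfl⟩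
    · rintro ⟨v, rfl⟩; exact ⟨v, v.2, rfl⟩
  rw [hr]
  refine isClosed_of_closure_subset fun w hw => ?_
  obtain ⟨v, hv, -⟩ := h2 w hw
  exact ⟨v, hv⟩

/-- A bounded functional on the closed span of `S` is determined by its values on `S`. -/
theorem eq_of_eqOn_closed_span {S : Set V} {Λ : (Submodule.span ℂ S).topologicalClosure →ₗ[ℂ] ℂ}
    {C : ℝ} (hΛ : ∀ v, ‖Λ v‖ ≤ C * ‖(v : V)‖) (e : StrongDual ℂ V)
    (h : ∀ (v : V) (hv : v ∈ S), Λ ⟨v, Submodule.le_topologicalClosure _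
      (Submodule.subset_span hv)⟩ = e v) (v : (Submodule.span ℂ S).topologicalClosure) :
    Λ v = e v := by
  let D : (Submodule.span ℂ S).topologicalClosure →L[ℂ] ℂ :=
    Λ.mkContinuous C hΛ - e.comp (Submodule.subtypeL _)
  suffices hD : ∀ ψ (hψ : ψ ∈ (Submodule.span ℂ S).topologicalClosure), D ⟨ψ, hψ⟩ = 0 from
    sub_eq_zero.1 (hD v v.2)
  have hspan : ∀ ψ (hψ : ψ ∈ Submodule.span ℂ S),
      D ⟨ψ, Submodule.le_topologicalClosure _ hψ⟩ = 0 := by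
    intro ψ hψ
    induction hψ using Submodule.span_induction with
    | mem ψ hψ => exact sub_eq_zero.2 (h ψ hψ)
    | zero => exact map_zero D
    | add a b ha hb iha ihb =>
      have := map_add D ⟨a, Submodule.le_topologicalClosure _ ha⟩
        ⟨b, Submodule.le_topologicalClosure _ hb⟩
      rw [iha, ihb, add_zero] at this
      exact this
    | smul c a ha iha =>
      have := map_smul D c ⟨a, Submodule.le_topologicalClosure _ ha⟩
      rw [iha, smul_zero] at this
      exact this
  intro ψ hψ
  have hcl : IsClosed {φ : (Submodule.span ℂ S).topologicalClosure | D φ = 0} :=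
    isClosed_eq D.continuous continuous_const
  have hd : (⟨ψ, hψ⟩ : (Submodule.span ℂ S).topologicalClosure) ∈
      closure {φ : (Submodule.span ℂ S).topologicalClosure | (φ : V) ∈ Submodule.span ℂ S} := by
    rw [closure_subtype]
    refine closure_mono ?_ (show ψ ∈ closure (Submodule.span ℂ S : Set V) from hψ)
    intro φ hφ
    exact ⟨⟨φ, Submodule.le_topologicalClosure _ hφ⟩, hφ, rfl⟩
  exact closure_minimal (s := {φ : (Submodule.span ℂ S).topologicalClosure |
    (φ : V) ∈ Submodule.span ℂ S}) (fun φ hφ => hspan φ hφ) hcl hd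

end NormedSpace

section Duality

variable {E F : Type*} [NormedAddCommGroup E] [NormedSpace ℂ E]
  [NormedAddCommGroup F] [NormedSpace ℂ F]

/-- The product form makes visible that a basic neighbourhood involves only finitely many
functionals. -/
theorem wstarTopology_eq_induced (P : Submodule ℂ (StrongDual ℂ E)) :
    wstarTopology P = TopologicalSpace.induced
      (fun (x : E) (φ : P) => (φ : StrongDual ℂ E) x) inferInstance := by
  rw [wstarTopology, Pi.topologicalSpace, induced_iInf]
  simp only [induced_compose]
  rfl

/-- Points outside a weak-star closed subspace are separated from it by the predual. -/
theorem exists_separating {P : Submodule ℂ (StrongDual ℂ E)} {S : Submodule ℂ E}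
    (hS : @IsClosed E (wstarTopology P) S) {x : E} (hx : x ∉ S) :
    ∃ φ ∈ P, (∀ y ∈ S, φ y = 0) ∧ φ x ≠ 0 := by
  classical
  have h1 : @IsOpen E (wstarTopology P) (S : Set E)ᶜ := (@isOpen_compl_iff E _ (wstarTopology P)).2 hS
  rw [wstarTopology_eq_induced] at h1
  obtain ⟨U, hU, hUS⟩ := h1
  obtain ⟨I, u, hu, hI⟩ := isOpen_pi_iff.1 hU _ (show x ∈ _ ⁻¹' U by rw [hUS]; exact hx)
  -- A neighbourhood of `x` that misses `S` is controlled by the finite set `I`, so the separation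
  -- can be done in ℂ^I, where `T x` lies outside the image of `S`.
  let T : E →ₗ[ℂ] (I → ℂ) :=
    LinearMap.pi fun i => ((i : P) : StrongDual ℂ E).toLinearMap
  have hT : T x ∉ S.map T := by
    rintro ⟨y, hy, he⟩
    have : y ∈ (fun (x : E) (φ : P) => (φ : StrongDual ℂ E) x) ⁻¹' U := by
      refine hI fun φ hφ => ?_
      have e : (φ : StrongDual ℂ E) y = (φ : StrongDual ℂ E) x := congrFun he ⟨φ, hφ⟩
      change (φ : StrongDual ℂ E) y ∈ u φ
      rw [e]
      exact (hu φ hφ).2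
    rw [hUS] at this
    exact this hy
  obtain ⟨f, hf, hf'⟩ := Submodule.exists_dual_map_eq_bot_of_notMem hT inferInstance
  refine ⟨∑ i : I, f (Pi.single i 1) • ((i : P) : StrongDual ℂ E),
    P.sum_mem fun i _ => P.smul_mem _ i.1.2, ?_, ?_⟩
  all_goals
    have key : ∀ y, (∑ i : I, f (Pi.single i 1) • ((i : P) : StrongDual ℂ E)) y = f (T y) := by
      intro y
      have e : T y = ∑ i, T y i • (Pi.single i 1 : I → ℂ) := pi_eq_sum_univ' (T y)
      conv_rhs => rw [e, map_sum]
      rw [sum_apply]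
      refine Finset.sum_congr rfl fun i _ => ?_
      rw [smul_apply, map_smul, smul_eq_mul, smul_eq_mul, mul_comm]
      rfl
  · intro y hy
    rw [key]
    have : f (T y) ∈ (S.map T).map f := ⟨_, ⟨y, hy, rfl⟩, rfl⟩
    rw [hf'] at this
    exact this
  · rw [key]
    exact hf

/-- A norm closed subspace of a predual which separates points is the whole predual. -/
theorem IsPredual.mem_of_separating {P Q : Submodule ℂ (StrongDual ℂ E)} (hP : IsPredual P)
    (hQ : IsClosed (Q : Set (StrongDual ℂ E)))
    (h : ∀ x : E, (∀ φ ∈ P, φ ∈ Q → φ x = 0) → x = 0) {φ : StrongDual ℂ E} (hφ : φ ∈ P) :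
    φ ∈ Q := by
  -- Restricted to `P`, a functional that kills `P ⊓ Q` is evaluation at a point. The hypothesis
  -- forces this point to be 0, so `φ` has distance 0 from `P ⊓ Q`.
  have h0 : ∀ g : StrongDual ℂ (StrongDual ℂ E), ‖g‖ ≤ 1 → (∀ w ∈ P ⊓ Q, g w = 0) →
      ‖g φ‖ ≤ 0 := by
    intro g hg hgQ
    obtain ⟨x, hx⟩ := hP.surjective (g.toLinearMap ∘ₗ P.subtype) ⟨‖g‖, fun ψ => g.le_opNorm _⟩
    have hx0 : x = 0 := h x fun ψ hψ hψQ => (hx ⟨ψ, hψ⟩).symm.trans (hgQ ψ ⟨hψ, hψQ⟩)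
    have h1 : g φ = φ x := hx ⟨φ, hφ⟩
    rw [h1, hx0, map_zero, norm_zero]
  have hPQ : IsClosed ((P ⊓ Q : Submodule ℂ (StrongDual ℂ E)) : Set (StrongDual ℂ E)) :=
    hP.isClosed.inter hQ
  refine (hPQ.closure_subset (Metric.mem_closure_iff.2 fun ε hε => ?_)).2
  obtain ⟨w, hw, hn⟩ := Submodule.exists_norm_sub_lt (P ⊓ Q) h0 hε
  exact ⟨w, hw, by rwa [dist_eq_norm, ← zero_add ε]⟩

theorem isClosed_of_forall_mem {ι : Sort*} {P : Submodule ℂ (StrongDual ℂ E)}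
    {f g : ι → E → ℂ} (hf : ∀ i, Continuous[wstarTopology P, inferInstance] (f i))
    (hg : ∀ i, Continuous[wstarTopology P, inferInstance] (g i)) :
    @IsClosed E (wstarTopology P) {x | ∀ i, f i x = g i x} := by
  have e : {x | ∀ i, f i x = g i x} = ⋂ i, {x | f i x = g i x} := by ext; simp
  rw [e]
  let _ := wstarTopology P
  exact isClosed_iInter fun i => isClosed_eq (hf i) (hg i)

/-- An identity between weak-star continuous functionals extends to the weak-star closure. -/
theorem eq_of_mem_wstarClosure {P : Submodule ℂ (StrongDual ℂ E)} {φ ψ : StrongDual ℂ E}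
    (hφ : φ ∈ P) (hψ : ψ ∈ P) {S : Submodule ℂ E} (h : ∀ x ∈ S, φ x = ψ x) {x : E}
    (hx : x ∈ wstarClosure P S) : φ x = ψ x := by
  have h1 := isClosed_of_forall_mem (ι := Unit) (P := P) (f := fun _ => φ) (g := fun _ => ψ)
    (fun _ => continuous_wstar hφ) fun _ => continuous_wstar hψ
  exact (@closure_minimal E (wstarTopology P) S _ (fun y hy _ => h y hy) h1) hx ()

theorem map_mem_wstarClosure_of_span {P : Submodule ℂ (StrongDual ℂ E)} (f : E →L[ℂ] E)
    (hf : ∀ φ ∈ P, φ.comp f ∈ P) {S : Set E} {T : Submodule ℂ E}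
    (h : ∀ x ∈ S, f x ∈ wstarClosure P T) {x : E} (hx : x ∈ wstarClosure P (Submodule.span ℂ S)) :
    f x ∈ wstarClosure P T := by
  have h1 : Submodule.span ℂ S ≤ (wstarClosure P T).comap f.toLinearMap := Submodule.span_le.2 h
  exact wstarClosure_map_mem (f := f) (fun φ hφ => continuous_wstar (hf φ hφ))
    (fun y hy => h1 hy) hx

theorem eq_zero_of_mem_wstarClosure_span {P : Submodule ℂ (StrongDual ℂ E)}
    {φ : StrongDual ℂ E} (hφ : φ ∈ P) {S : Set E} (h : ∀ x ∈ S, φ x = 0) {x : E}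
    (hx : x ∈ wstarClosure P (Submodule.span ℂ S)) : φ x = 0 := by
  have h1 : Submodule.span ℂ S ≤ φ.ker := Submodule.span_le.2 h
  exact eq_of_mem_wstarClosure hφ P.zero_mem (fun y hy => h1 hy) hx

/-- Continuity becomes a statement about pulling back functionals from `Q` to `P`. In the
applications `g` is the identity or the inclusion of a subset. -/
theorem continuous_induced_wstar {X : Type*} {P : Submodule ℂ (StrongDual ℂ E)}
    {Q : Submodule ℂ (StrongDual ℂ F)} {g : X → E} {f : X → F}
    (h : ∀ φ ∈ Q, ∃ ψ ∈ P, ∀ x, φ (f x) = ψ (g x)) :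
    Continuous[TopologicalSpace.induced g (wstarTopology P), wstarTopology Q] f := by
  let _ : TopologicalSpace X := TopologicalSpace.induced g (wstarTopology P)
  refine continuous_to_wstar fun φ hφ => ?_
  obtain ⟨ψ, hψ, he⟩ := h φ hφ
  rw [funext he]
  exact @Continuous.comp _ _ _ _ (wstarTopology P) _ _ _ (continuous_wstar hψ)
    (@continuous_induced_dom _ _ g (wstarTopology P))

theorem continuous_wstar_wstar {P : Submodule ℂ (StrongDual ℂ E)}
    {Q : Submodule ℂ (StrongDual ℂ F)} {f : E → F}
    (h : ∀ φ ∈ Q, ∃ ψ ∈ P, ∀ x, φ (f x) = ψ x) :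
    Continuous[wstarTopology P, wstarTopology Q] f := by
  refine Eq.mp ?_ (continuous_induced_wstar (g := id) h)
  rw [@induced_id E (wstarTopology P)]

/-- Limits along ultrafilters of elements of a weak-star closed set. -/
theorem mem_of_tendsto_wstar {P : Submodule ℂ (StrongDual ℂ E)} {s : Set E}
    (hs : @IsClosed E (wstarTopology P) s) {ι : Type*} {l : Filter ι} [l.NeBot] {f : ι → E} {a : E}
    (hf : ∀ᶠ i in l, f i ∈ s) (h : ∀ φ ∈ P, Filter.Tendsto (fun i => φ (f i)) l (𝓝 (φ a))) :
    a ∈ s := by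
  refine @IsClosed.mem_of_tendsto E (wstarTopology P) _ _ _ _ _ _ hs ?_ hf
  rw [wstarTopology, nhds_iInf, Filter.tendsto_iInf]
  intro φ
  rw [nhds_induced, Filter.tendsto_comap_iff]
  exact h φ φ.2

end Duality

/-! ### Weak-star closed subalgebras, units and centres. -/

section RestrictPredual

variable {A : Type*} [NonUnitalCStarAlgebra A]

/-- The restriction of a functional to a subalgebra. -/
def restrictFunctional (S : NonUnitalStarSubalgebra ℂ A) [IsClosed (S : Set A)] :
    StrongDual ℂ A →L[ℂ] StrongDual ℂ S :=
  (ContinuousLinearMap.compL ℂ S A ℂ).flip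
    (LinearMap.mkContinuous ⟨⟨fun x : S => (x : A), fun _ _ => rfl⟩, fun _ _ => rfl⟩ 1
      fun x => by rw [one_mul]; rfl)

theorem norm_restrictFunctional_le (S : NonUnitalStarSubalgebra ℂ A) [IsClosed (S : Set A)]
    (φ : StrongDual ℂ A) : ‖restrictFunctional S φ‖ ≤ ‖φ‖ :=
  ContinuousLinearMap.opNorm_le_bound _ (norm_nonneg _) fun x => φ.le_opNorm x

theorem restrictFunctional_mem {P : Submodule ℂ (StrongDual ℂ A)} {S : NonUnitalStarSubalgebra ℂ A}
    [IsClosed (S : Set A)] {φ : StrongDual ℂ A} (hφ : φ ∈ P) :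
    restrictFunctional S φ ∈ restrictPredual P S := ⟨φ, hφ, fun _ => rfl⟩

theorem restrictPredual_eq_map (P : Submodule ℂ (StrongDual ℂ A))
    (S : NonUnitalStarSubalgebra ℂ A) [IsClosed (S : Set A)] :
    restrictPredual P S = P.map (restrictFunctional S).toLinearMap := by
  ext ψ
  constructor
  · rintro ⟨φ, hφ, h⟩
    exact ⟨φ, hφ, ContinuousLinearMap.ext fun x => (h x).symm⟩
  · rintro ⟨φ, hφ, rfl⟩
    exact restrictFunctional_mem hφ

variable {P : Submodule ℂ (StrongDual ℂ A)}

/-- The distance from `φ` to the annihilator of `S` in `P` is at most the norm of the restriction of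
`φ`. Indeed a contractive functional that kills this annihilator is evaluation at a point of the
unit ball, and this point lies in `S` because weak-star closed subspaces are cut out by the predual.
-/
theorem IsPredual.exists_norm_le_restrict (hP : IsPredual P) {S : NonUnitalStarSubalgebra ℂ A}
    [IsClosed (S : Set A)] (hS : @IsClosed A (wstarTopology P) S) {φ : StrongDual ℂ A}
    (hφ : φ ∈ P) {ε : ℝ} (hε : 0 < ε) :
    ∃ ψ ∈ P, (∀ x : S, ψ x = φ x) ∧ ‖ψ‖ < ‖restrictFunctional S φ‖ + ε := by
  let K : Submodule ℂ (StrongDual ℂ A) := P ⊓ (restrictFunctional S).ker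
  have hK : IsClosed (K : Set (StrongDual ℂ A)) :=
    hP.isClosed.inter (restrictFunctional S).isClosed_ker
  have h0 : ∀ g : StrongDual ℂ (StrongDual ℂ A), ‖g‖ ≤ 1 → (∀ w ∈ K, g w = 0) →
      ‖g φ‖ ≤ ‖restrictFunctional S φ‖ := by
    intro g hg hgK
    have hb : ∀ ψ : P, ‖(g.toLinearMap ∘ₗ P.subtype) ψ‖ ≤ 1 * ‖(ψ : StrongDual ℂ A)‖ := fun ψ =>
      (g.le_opNorm _).trans (mul_le_mul_of_nonneg_right hg (norm_nonneg _))
    obtain ⟨x, hx⟩ := hP.surjective (g.toLinearMap ∘ₗ P.subtype) ⟨1, hb⟩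
    have hx1 : ‖x‖ ≤ 1 := hP.norm_le x 1 zero_le_one fun ψ hψ => by
      rw [← hx ⟨ψ, hψ⟩]
      exact hb ⟨ψ, hψ⟩
    have hxS : x ∈ S := by
      by_contra hn
      obtain ⟨ψ, hψ, h0, h1⟩ := exists_separating
        (S := S.toNonUnitalSubalgebra.toSubmodule) hS hn
      refine h1 ((hx ⟨ψ, hψ⟩).symm.trans (hgK ψ ⟨hψ, ?_⟩))
      exact ContinuousLinearMap.ext fun y => h0 y y.2
    have h3 : g φ = restrictFunctional S φ ⟨x, hxS⟩ := hx ⟨φ, hφ⟩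
    rw [h3]
    exact (ContinuousLinearMap.le_opNorm _ _).trans (mul_le_of_le_one_right (norm_nonneg _) hx1)
  obtain ⟨w, ⟨hw, hw'⟩, hn⟩ := Submodule.exists_norm_sub_lt K h0 hε
  refine ⟨φ - w, P.sub_mem hφ hw, fun x => ?_, hn⟩
  have h1 : w x = 0 := DFunLike.congr_fun hw' x
  rw [sub_apply, h1, sub_zero]

/-- A weak-star closed subalgebra of a W*-algebra is a W*-algebra. -/
theorem IsPredual.restrict (hP : IsPredual P) {S : NonUnitalStarSubalgebra ℂ A}
    [IsClosed (S : Set A)] (hS : @IsClosed A (wstarTopology P) S) :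
    IsPredual (restrictPredual P S) where
  isClosed := by
    rw [restrictPredual_eq_map]
    refine Submodule.isClosed_map_of_lift (V := StrongDual ℂ A) (W := StrongDual ℂ S) P hP.isClosed
      (restrictFunctional S) fun φ hφ h0 => ?_
    -- The error ε is taken to be the norm of the restriction itself, which gives the factor 2.
    obtain ⟨ψ, hψ, h, hn⟩ := hP.exists_norm_le_restrict hS hφ h0
    exact ⟨ψ, hψ, ContinuousLinearMap.ext h, hn.le.trans_eq (two_mul _).symm⟩
  norm_le x C hC h := hP.norm_le x C hC fun φ hφ =>
    (h _ (restrictFunctional_mem hφ)).trans (by gcongr; exact norm_restrictFunctional_le S φ)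
  surjective := by
    rintro Λ ⟨C, hC⟩
    let r : P →ₗ[ℂ] restrictPredual P S :=
      ((restrictFunctional S).toLinearMap ∘ₗ P.subtype).codRestrict _
        fun φ => restrictFunctional_mem φ.2
    have hr : ∀ φ : P, ((r φ : restrictPredual P S) : StrongDual ℂ S) = restrictFunctional S φ :=
      fun φ => rfl
    obtain ⟨x, hx⟩ := hP.surjective (Λ ∘ₗ r) ⟨|C|, fun φ => by
      refine (hC _).trans ?_
      rw [hr]
      exact mul_le_mul (le_abs_self C) (norm_restrictFunctional_le S φ) (norm_nonneg _)
        (abs_nonneg _)⟩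
    -- A functional in `P` that vanishes on `S` restricts to 0, hence is killed by `Λ ∘ₗ r`. So
    -- nothing in `P` separates `x` from `S`.
    have hxS : x ∈ S := by
      by_contra hn
      obtain ⟨ψ, hψ, h0, h1⟩ := exists_separating
        (S := S.toNonUnitalSubalgebra.toSubmodule) hS hn
      refine h1 ?_
      rw [← hx ⟨ψ, hψ⟩]
      have : r ⟨ψ, hψ⟩ = 0 := Subtype.ext (ContinuousLinearMap.ext fun y => h0 y y.2)
      change Λ (r ⟨ψ, hψ⟩) = 0
      rw [this, map_zero]
    refine ⟨⟨x, hxS⟩, ?_⟩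
    rintro ⟨ψ, φ, hφ, h⟩
    have : r ⟨φ, hφ⟩ = ⟨ψ, φ, hφ, h⟩ :=
      Subtype.ext (ContinuousLinearMap.ext fun y => (h y).symm)
    rw [← this]
    exact (hx ⟨φ, hφ⟩)

theorem IsAlgDual.restrict (hP : IsAlgDual P) (S : NonUnitalStarSubalgebra ℂ A)
    [IsClosed (S : Set A)] : IsAlgDual (restrictPredual P S) where
  star_mem := by
    rintro ψ ⟨φ, hφ, h⟩
    exact ⟨_, hP.star_mem φ hφ, fun x => by rw [starDual_apply, starDual_apply, h]; rfl⟩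
  mul_left_mem := by
    rintro ψ ⟨φ, hφ, h⟩ b
    exact ⟨_, hP.mul_left_mem φ hφ b, fun x => h _⟩
  mul_right_mem := by
    rintro ψ ⟨φ, hφ, h⟩ b
    exact ⟨_, hP.mul_right_mem φ hφ b, fun x => h _⟩

/-- A W*-algebra has a unit. -/
theorem IsPredual.exists_unit (hP : IsPredual P) (hP' : IsAlgDual P) :
    ∃ e : A, (∀ x, e * x = x) ∧ ∀ x, x * e = x := by
  let _ : PartialOrder A := CStarAlgebra.spectralOrder A
  have : StarOrderedRing A := CStarAlgebra.spectralOrderedRing A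
  have hl := CStarAlgebra.increasingApproximateUnit A
  let U := Ultrafilter.of (CStarAlgebra.approximateUnit A)
  have hU : (U : Filter A) ≤ CStarAlgebra.approximateUnit A := Ultrafilter.of_le _
  classical
  -- The unit is a weak-star limit of a contractive approximate unit. The value 0 off the unit ball
  -- only serves to bound the family at every index.
  obtain ⟨e, he⟩ := hP.exists_ultrafilter_limit U (f := fun a => if ‖a‖ ≤ 1 then a else 0)
    (R := 1) fun a => by split_ifs with h <;> simp [h]
  have he' : ∀ φ ∈ P, Filter.Tendsto (fun a => φ a) U (𝓝 (φ e)) := fun φ hφ =>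
    (he φ hφ).congr' ((hl.eventually_norm.filter_mono hU).mono fun a ha => by
      rw [if_pos ha])
  refine ⟨e, fun x => hP.ext fun φ hφ => ?_, fun x => hP.ext fun φ hφ => ?_⟩
  · exact tendsto_nhds_unique (he' _ (hP'.mul_right_mem φ hφ x))
      ((φ.continuous.tendsto x).comp ((hl.tendsto_mul_right x).mono_left hU))
  · exact tendsto_nhds_unique (he' _ (hP'.mul_left_mem φ hφ x))
      ((φ.continuous.tendsto x).comp ((hl.tendsto_mul_left x).mono_left hU))

theorem continuous_wstarTopologyOn {N : Type*} [NonUnitalCStarAlgebra N]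
    {Q : Submodule ℂ (StrongDual ℂ N)} {I : Set A} {J : Set N} {f : I → J}
    (h : ∀ φ ∈ Q, ∃ ψ ∈ P, ∀ x : I, φ (f x) = ψ x) :
    Continuous[wstarTopologyOn P I, wstarTopologyOn Q J] f :=
  @Continuous.mk _ _ (wstarTopologyOn P I) (wstarTopologyOn Q J) _ fun _ hs => by
    obtain ⟨u, hu, rfl⟩ := hs
    exact @Continuous.isOpen_preimage _ _ (_) (_) _
      (continuous_induced_wstar (f := fun x : I => (f x : N)) h) u hu

theorem isClosed_center (hP : IsPredual P) (hP' : IsAlgDual P) :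
    @IsClosed A (wstarTopology P) (NonUnitalStarSubalgebra.center ℂ A : Set A) := by
  have : (NonUnitalStarSubalgebra.center ℂ A : Set A) =
      {a | ∀ i : A × P, (i.2 : StrongDual ℂ A) (i.1 * a) = (i.2 : StrongDual ℂ A) (a * i.1)} := by
    ext a
    refine Semigroup.mem_center_iff.trans ⟨fun h i => by rw [h], fun h b => ?_⟩
    exact hP.ext fun φ hφ => h (b, ⟨φ, hφ⟩)
  rw [this]
  exact isClosed_of_forall_mem
    (fun i => continuous_wstar (hP'.mul_left_mem _ i.2.2 i.1))
    (fun i => continuous_wstar (hP'.mul_right_mem _ i.2.2 i.1))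

end RestrictPredual

/-! ### The predual of an algebra of bounded functions -/

section LinftyPredual

variable {G : Type*} [Group G] {N : Type*} [NonUnitalCStarAlgebra N]
  {P : Submodule ℂ (StrongDual ℂ N)}

theorem comp_eval_mem {φ : StrongDual ℂ N} (hφ : φ ∈ P) (t : G) :
    φ.comp (lp.evalCLM ℂ (fun _ : G => N) ∞ t) ∈ linftyPredual (G := G) P :=
  Submodule.le_topologicalClosure _ (Submodule.subset_span ⟨φ, hφ, t, rfl⟩)

/-- Together with `opPredual_le` this reduces weak-star continuity of maps into ℓ^∞(G, 𝓛) to matrix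
coefficients. -/
theorem linftyPredual_le {Q : Submodule ℂ (StrongDual ℂ (lp (fun _ : G => N) ∞))}
    (hQ : IsClosed (Q : Set (StrongDual ℂ (lp (fun _ : G => N) ∞))))
    (h : ∀ φ ∈ P, ∀ t : G, φ.comp (lp.evalCLM ℂ (fun _ : G => N) ∞ t) ∈ Q) :
    linftyPredual P ≤ Q := by
  refine Submodule.topologicalClosure_minimal _ (Submodule.span_le.2 ?_) hQ
  rintro _ ⟨φ, hφ, t, rfl⟩
  exact h φ hφ t

theorem norm_comp_eval_le (φ : StrongDual ℂ N) (t : G) :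
    ‖φ.comp (lp.evalCLM ℂ (fun _ : G => N) ∞ t)‖ ≤ ‖φ‖ :=
  ContinuousLinearMap.opNorm_le_bound _ (norm_nonneg _) fun f =>
    (φ.le_opNorm _).trans (by gcongr; exact lp.norm_apply_le_norm ENNReal.top_ne_zero f t)

/-- If `P` is a predual of `N`, then `linftyPredual P` is a predual of `ℓ^∞(G, N)`. -/
theorem IsPredual.linfty (hP : IsPredual P) : IsPredual (linftyPredual (G := G) P) where
  isClosed := Submodule.isClosed_topologicalClosure _
  norm_le f C hC h := lp.norm_le_of_forall_le hC fun t => hP.norm_le _ C hC fun φ hφ =>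
    (h _ (comp_eval_mem hφ t)).trans (by gcongr; exact norm_comp_eval_le φ t)
  surjective := by
    rintro Λ ⟨C, hC⟩
    -- Each coordinate is represented separately, with a bound independent of `t`. The absolute
    -- value is there because `C` is not assumed to be nonnegative.
    have hC' : ∀ t : G, ∀ φ : P, ‖Λ ⟨_, comp_eval_mem φ.2 t⟩‖ ≤ |C| * ‖(φ : StrongDual ℂ N)‖ :=
      fun t φ => (hC _).trans (mul_le_mul (le_abs_self C) (norm_comp_eval_le _ t) (norm_nonneg _)
        (abs_nonneg _))
    have h1 : ∀ t : G, ∃ x : N, ∀ φ : P, Λ ⟨_, comp_eval_mem φ.2 t⟩ = (φ : StrongDual ℂ N) x :=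
      fun t => hP.surjective
        { toFun := fun φ : P => Λ ⟨_, comp_eval_mem φ.2 t⟩
          map_add' := fun φ ψ => by rw [← map_add]; rfl
          map_smul' := fun c φ => by rw [← map_smul]; rfl } ⟨|C|, hC' t⟩
    choose x hx using h1
    have hxC : ∀ t, ‖x t‖ ≤ |C| := fun t => hP.norm_le _ _ (abs_nonneg _) fun φ hφ => by
      rw [← hx t ⟨φ, hφ⟩]
      exact hC' t ⟨φ, hφ⟩
    refine ⟨⟨x, memℓp_infty ⟨|C|, by rintro _ ⟨t, rfl⟩; exact hxC t⟩⟩, fun φ => ?_⟩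
    refine eq_of_eqOn_closed_span hC (ContinuousLinearMap.apply ℂ ℂ _) ?_ φ
    rintro _ ⟨φ, hφ, t, rfl⟩
    exact hx t ⟨φ, hφ⟩

end LinftyPredual

namespace WStarFellBundle

open FellBundle

variable {G : Type u} [Group G] {M : WStarFellBundle.{u, v} G}

/-! ### Multiplication in a W*-Fell bundle -/

theorem mul_sub {s t r : G} (h : s * t = r) (a : M.fiber s) (b c : M.fiber t) :
    M.mul h a (b - c) = M.mul h a b - M.mul h a c :=
  map_sub (mulLeft (B := M.toFellBundle) h a) b c

theorem sub_mul {s t r : G} (h : s * t = r) (a b : M.fiber s) (c : M.fiber t) :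
    M.mul h (a - b) c = M.mul h a c - M.mul h b c :=
  map_sub (mulRight (B := M.toFellBundle) h c) a b

theorem mul_zero_fiber {s t r : G} (h : s * t = r) (a : M.fiber s) : M.mul h a 0 = 0 :=
  map_zero (mulLeft (B := M.toFellBundle) h a)

theorem comp_mulLeft_mem {s t r : G} (h : s * t = r) (a : M.fiber s)
    {φ : StrongDual ℂ (M.fiber r)} (hφ : φ ∈ M.predual r) :
    φ.comp (mulLeft (B := M.toFellBundle) h a) ∈ M.predual t :=
  mem_of_continuous_wstar (@Continuous.comp _ _ _ (wstarTopology (M.predual t))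
    (wstarTopology (M.predual r)) _ _ _ (continuous_wstar hφ) (M.continuous_mul_left h a))

/-- Since a b = (b* a*)*, right multiplication inherits weak-star continuity from the involution and
left multiplication. -/
theorem comp_mulRight_mem {s t r : G} (h : s * t = r) (b : M.fiber t)
    {φ : StrongDual ℂ (M.fiber r)} (hφ : φ ∈ M.predual r) :
    φ.comp (mulRight (B := M.toFellBundle) h b) ∈ M.predual s := by
  refine mem_of_continuous_wstar ?_
  have h' : t⁻¹ * s⁻¹ = r⁻¹ := by rw [← h, mul_inv_rev]
  have h1 := @Continuous.comp _ _ _ (wstarTopology (M.predual s)) (wstarTopology (M.predual s⁻¹))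
    (wstarTopology (M.predual r⁻¹)) _ _ (M.continuous_mul_left h' (M.adj rfl b))
    (M.continuous_adj (s := s) rfl)
  have h2 := @Continuous.comp _ _ _ (wstarTopology (M.predual s)) (wstarTopology (M.predual r⁻¹))
    (wstarTopology (M.predual r)) _ _ (M.continuous_adj (inv_inv r)) h1
  have h3 := @Continuous.comp _ _ _ (wstarTopology (M.predual s)) (wstarTopology (M.predual r)) _
    _ _ (continuous_wstar hφ) h2
  refine Eq.mp ?_ h3
  congr 1
  funext a
  change φ (M.adj _ (M.mul h' (M.adj rfl b) (M.adj rfl a))) = φ (M.mul h a b)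
  rw [← M.adj_mul h rfl rfl rfl h', M.adj_adj]

variable (M) in
theorem isAlgDual : IsAlgDual (M.predual 1) where
  star_mem φ hφ := by
    obtain ⟨ψ, hψ, h⟩ := M.isStarPredual.star_mem φ hφ
    have : ψ = starDual φ := ContinuousLinearMap.ext h
    exact this ▸ hψ
  mul_left_mem φ hφ b := comp_mulLeft_mem (one_mul 1) b hφ
  mul_right_mem φ hφ b := comp_mulRight_mem (one_mul 1) b hφ

theorem norm_mul_adj_self {s s' : G} (h : s⁻¹ = s') (h' : s * s' = 1) (v : M.fiber s) :
    ‖M.mul h' v (M.adj h v)‖ = ‖v‖ ^ 2 := by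
  have h1 : s'⁻¹ = s := by rw [← h, inv_inv]
  have h2 := M.norm_adj_mul_self h1 h' (M.adj h v)
  rwa [M.adj_adj, norm_adj] at h2

theorem eq_zero_of_mul_adj_self {s s' : G} (h : s⁻¹ = s') (h' : s * s' = 1) {v : M.fiber s}
    (hv : M.mul h' v (M.adj h v) = 0) : v = 0 := by
  have := norm_mul_adj_self h h' v
  rw [hv, norm_zero] at this
  simpa using this.symm

theorem eq_zero_of_adj_self_mul {s s' : G} (h : s⁻¹ = s') (h' : s' * s = 1) {v : M.fiber s}
    (hv : M.mul h' (M.adj h v) v = 0) : v = 0 := by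
  have := M.norm_adj_mul_self h h' v
  rw [hv, norm_zero] at this
  simpa using this.symm

theorem adj_sub {s r : G} (h : s⁻¹ = r) (a b : M.fiber s) :
    M.adj h (a - b) = M.adj h a - M.adj h b := by
  have h1 := M.adj_smul h (-1) b
  rw [star_neg, star_one, neg_one_smul, neg_one_smul] at h1
  rw [sub_eq_add_neg, M.adj_add, h1, ← sub_eq_add_neg]

variable (M) in
/-- The unit of the unit fibre. -/
def unit : M.fiber 1 := ((M.isPredual 1).exists_unit M.isAlgDual).choose

theorem unit_mul (a : M.fiber 1) : M.unit * a = a :=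
  ((M.isPredual 1).exists_unit M.isAlgDual).choose_spec.1 a

theorem mul_unit (a : M.fiber 1) : a * M.unit = a :=
  ((M.isPredual 1).exists_unit M.isAlgDual).choose_spec.2 a

theorem star_unit : star M.unit = M.unit := by
  rw [← unit_mul (star M.unit), ← star_star (M.unit * star M.unit), star_mul, star_star, unit_mul,
    star_star]

/-- With u the unit and v = u x − x, the product x v* lies in the unit fibre, so v v* = u (x v*) − x
v* = 0. This test of v by v v* or v* v recurs below. -/
theorem unit_mul_fiber {t : G} (x : M.fiber t) : M.mul (one_mul t) M.unit x = x := by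
  rw [← sub_eq_zero]
  set v := M.mul (one_mul t) M.unit x - x with hv
  refine eq_zero_of_mul_adj_self rfl (mul_inv_cancel t) ?_
  conv_lhs => rw [hv]
  rw [sub_mul, M.mul_assoc _ _ (mul_inv_cancel t) (one_mul 1), ← hv]
  exact sub_eq_zero.2 (unit_mul _)

theorem mul_unit_fiber {t : G} (x : M.fiber t) : M.mul (mul_one t) x M.unit = x := by
  rw [← sub_eq_zero]
  set v := M.mul (mul_one t) x M.unit - x with hv
  refine eq_zero_of_adj_self_mul rfl (inv_mul_cancel t) ?_
  conv_lhs => rw [hv]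
  rw [mul_sub, ← M.mul_assoc (inv_mul_cancel t) (one_mul 1), ← hv]
  exact sub_eq_zero.2 (mul_unit _)

theorem mul_fiber_assoc {t : G} (a b : M.fiber 1) (x : M.fiber t) :
    M.mul (one_mul t) (a * b) x = M.mul (one_mul t) a (M.mul (one_mul t) b x) :=
  M.mul_assoc _ _ _ _ _ _ _

theorem mem_centre_iff {z : M.fiber 1} : z ∈ M.centre ↔ ∀ a, a * z = z * a :=
  Semigroup.mem_center_iff

/-! ### The ideals spanned by the fibres -/

variable (M) in
/-- The span of the products `x y*`, for `x` and `y` in the fibre at `t`. -/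
def preIdeal (t : G) : Submodule ℂ (M.fiber 1) :=
  Submodule.span ℂ {a | ∃ x y : M.fiber t, a = M.mul (mul_inv_cancel t) x (M.adj rfl y)}

theorem preIdeal_le (t : G) : M.preIdeal t ≤ fiberIdeal M t := subset_wstarClosure _ _

theorem mul_mem_preIdeal {t t' : G} (h : t * t' = 1) (x : M.fiber t) (y : M.fiber t') :
    M.mul h x y ∈ M.preIdeal t := by
  obtain rfl : t⁻¹ = t' := inv_eq_of_mul_eq_one_right h
  refine Submodule.subset_span ⟨x, M.adj (inv_inv t) y, ?_⟩
  rw [M.adj_adj]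

theorem preIdeal_induction {t : G} {p : M.fiber 1 → Prop}
    (mul : ∀ (x : M.fiber t) (y : M.fiber t⁻¹), p (M.mul (mul_inv_cancel t) x y))
    (add : ∀ a b, p a → p b → p (a + b)) (smul : ∀ (c : ℂ) a, p a → p (c • a))
    {a : M.fiber 1} (ha : a ∈ M.preIdeal t) : p a := by
  induction ha using Submodule.span_induction with
  | mem a ha =>
    obtain ⟨x, y, rfl⟩ := ha
    exact mul _ _
  | zero =>
    have := smul 0 _ (mul 0 0)
    rwa [zero_smul] at this
  | add a b _ _ iha ihb => exact add a b iha ihb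
  | smul c a _ iha => exact smul c a iha

theorem mul_left_mem_preIdeal {t : G} (b : M.fiber 1) {a : M.fiber 1} (ha : a ∈ M.preIdeal t) :
    b * a ∈ M.preIdeal t := by
  refine preIdeal_induction (p := fun a => b * a ∈ M.preIdeal t) (fun x y => ?_)
    (fun a c ha hc => ?_) (fun c a ha => ?_) ha
  · rw [mul_def, ← M.mul_assoc (one_mul t) (mul_inv_cancel t)]
    exact mul_mem_preIdeal _ _ _
  · rw [_root_.mul_add]; exact Submodule.add_mem _ ha hc
  · rw [mul_smul_comm]; exact Submodule.smul_mem _ _ ha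

theorem star_mem_preIdeal {t : G} {a : M.fiber 1} (ha : a ∈ M.preIdeal t) :
    star a ∈ M.preIdeal t := by
  refine preIdeal_induction (p := fun a => star a ∈ M.preIdeal t) (fun x y => ?_)
    (fun a c ha hc => ?_) (fun c a ha => ?_) ha
  · rw [star_def, M.adj_mul _ rfl (inv_inv t) _ (mul_inv_cancel t)]
    exact mul_mem_preIdeal _ _ _
  · rw [star_add]; exact Submodule.add_mem _ ha hc
  · rw [star_smul]; exact Submodule.smul_mem _ _ ha

theorem mul_right_mem_preIdeal {t : G} (b : M.fiber 1) {a : M.fiber 1} (ha : a ∈ M.preIdeal t) :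
    a * b ∈ M.preIdeal t := by
  have := star_mem_preIdeal (mul_left_mem_preIdeal (star b) (star_mem_preIdeal ha))
  rwa [star_mul, star_star, star_star] at this

variable (M) in
/-- The span of the products `x y*`, as a *-algebra. -/
def preIdealAlg (t : G) : NonUnitalStarSubalgebra ℂ (M.fiber 1) :=
  { M.preIdeal t with
    mul_mem' := fun {_ _} _ hb => mul_left_mem_preIdeal _ hb
    star_mem' := fun {_} ha => star_mem_preIdeal ha }

theorem isWStarIdeal_fiberIdeal (t : G) : IsWStarIdeal (M.predual 1) (fiberIdeal M t : Set _) where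
  zero_mem := Submodule.zero_mem _
  add_mem _ ha _ hb := Submodule.add_mem _ ha hb
  smul_mem c _ ha := Submodule.smul_mem _ c ha
  mul_left_mem b _ ha := wstarClosure_map_mem (f := fun x => b * x)
    (fun φ hφ => continuous_wstar (M.isAlgDual.mul_left_mem φ hφ b))
    (fun _ hy => preIdeal_le t (mul_left_mem_preIdeal b hy)) ha
  mul_right_mem b _ ha := wstarClosure_map_mem (f := fun x => x * b)
    (fun φ hφ => continuous_wstar (M.isAlgDual.mul_right_mem φ hφ b))
    (fun _ hy => preIdeal_le t (mul_right_mem_preIdeal b hy)) ha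
  star_mem _ ha := (wstarClosureAlg M.isAlgDual (M.preIdealAlg t)).star_mem' ha
  isClosed := isClosed_wstarClosure _ _

variable (M) in
/-- The ideal `I_t`, as a *-algebra. -/
abbrev fiberIdealAlg (t : G) : NonUnitalStarSubalgebra ℂ (M.fiber 1) :=
  wstarClosureAlg M.isAlgDual (M.preIdealAlg t)

/-- The map c ↦ c v is weak-star continuous and kills every generator x y*, because y* v = 0. -/
theorem fiberIdeal_mul_eq_zero {t s r q : G} {v : M.fiber s} (hq : t⁻¹ * s = q)
    (hv : ∀ y : M.fiber t⁻¹, M.mul hq y v = 0) (h : 1 * s = r)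
    {c : M.fiber 1} (hc : c ∈ fiberIdeal M t) : M.mul h c v = 0 := by
  refine (M.isPredual r).ext fun φ hφ => ?_
  rw [map_zero]
  refine eq_zero_of_mem_wstarClosure_span (comp_mulRight_mem h v hφ) ?_ hc
  rintro _ ⟨x, y, rfl⟩
  change φ (M.mul h (M.mul _ x (M.adj rfl y)) v) = 0
  rw [M.mul_assoc _ _ hq (by rw [← h, ← hq]; group), hv, mul_zero_fiber, map_zero]

theorem mul_fiberIdeal_eq_zero {t s r q : G} {v : M.fiber s} (hq : s * t = q)
    (hv : ∀ x : M.fiber t, M.mul hq v x = 0) (h : s * 1 = r)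
    {c : M.fiber 1} (hc : c ∈ fiberIdeal M t) : M.mul h v c = 0 := by
  refine (M.isPredual r).ext fun φ hφ => ?_
  rw [map_zero]
  refine eq_zero_of_mem_wstarClosure_span (comp_mulLeft_mem h v hφ) ?_ hc
  rintro _ ⟨x, y, rfl⟩
  change φ (M.mul h v (M.mul _ x (M.adj rfl y))) = 0
  rw [← M.mul_assoc hq (by rw [← h, ← hq]; group), hv, zero_mul_fiber, map_zero]

/-- Elements of `I_t` are determined by their action on the fibre at `t`. -/
theorem fiberIdeal_ext {t : G} {c d : M.fiber 1} (hc : c ∈ fiberIdeal M t)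
    (hd : d ∈ fiberIdeal M t)
    (h : ∀ x : M.fiber t, M.mul (one_mul t) c x = M.mul (one_mul t) d x) : c = d := by
  rw [← sub_eq_zero, ← CStarRing.mul_star_self_eq_zero_iff]
  have hv : ∀ x : M.fiber t, M.mul (one_mul t) (c - d) x = 0 := fun x => by
    rw [sub_mul, h, sub_self]
  -- The difference kills M_t from the left, hence kills I_t, which contains its own adjoint.
  exact mul_fiberIdeal_eq_zero (one_mul t) hv (mul_one 1)
    ((isWStarIdeal_fiberIdeal t).star_mem _ (Submodule.sub_mem _ hc hd))

theorem fiberIdeal_one : fiberIdeal M 1 = ⊤ := by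
  refine eq_top_iff.2 fun a _ => preIdeal_le 1 ?_
  rw [← mul_unit a]
  exact mul_mem_preIdeal (one_mul 1) a M.unit

/-- The norm of an element of `I_t`, computed by its action on the fibre at `t`. -/
theorem norm_le_of_mem_fiberIdeal {t : G} {a : M.fiber 1} (ha : a ∈ fiberIdeal M t) {C : ℝ}
    (hC : 0 ≤ C) (h : ∀ x : M.fiber t, ‖M.mul (one_mul t) a x‖ ≤ C * ‖x‖) : ‖a‖ ≤ C := by
  -- Operators on sections supported at `t` give a representation of I_t. It is faithful by
  -- `fiberIdeal_ext`, hence isometric.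
  let ρ : M.fiberIdealAlg t →⋆ₙₐ[ℂ] Op M :=
    { toFun := fun a => elemOp (one_mul t) (a : M.fiber 1)
      map_smul' := fun c a => map_smul (elemOp (one_mul t)) c (a : M.fiber 1)
      map_zero' := map_zero (elemOp (M := M) (one_mul t))
      map_add' := fun a b => map_add (elemOp (one_mul t)) (a : M.fiber 1) b
      map_mul' := fun a b => (elemOp_mul (one_mul t) (one_mul t) (one_mul 1) (one_mul t) _ _).symm
      map_star' := fun a => (star_elemOp (one_mul t) inv_one (one_mul t) _).symm }
  have hρ : Function.Injective ρ := by
    intro a b hab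
    refine Subtype.ext (fiberIdeal_ext a.2 b.2 fun x => ?_)
    have h1 : (elemOp (one_mul t) (a : M.fiber 1)).1 (L2.single t x) t =
        (elemOp (one_mul t) (b : M.fiber 1)).1 (L2.single t x) t := by
      change (ρ a).1 _ _ = (ρ b).1 _ _
      rw [hab]
    rwa [elemOp_apply, elemOp_apply, L2.single_same, L2.single_same, L2.single_same] at h1
  have h1 := NonUnitalStarAlgHom.norm_map ρ hρ ⟨a, ha⟩
  change _ = ‖a‖ at h1
  rw [← h1]
  refine ContinuousLinearMap.opNorm_le_bound _ hC fun ξ => ?_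
  change ‖L2.single t (M.mul (one_mul t) a (ξ t))‖ ≤ _
  rw [L2.norm_single]
  exact (h _).trans (mul_le_mul_of_nonneg_left (L2.norm_coord_le ξ t) hC)

variable (M) in
/-- There is a bounded left approximate unit of the fibre at `t` in the span of the products
`x y*`. -/
theorem exists_approximateUnit (t : G) : ∃ l : Filter (M.fiber 1), l.NeBot ∧
    (∀ᶠ c in l, c ∈ M.preIdeal t ∧ ‖c‖ ≤ 2) ∧
    ∀ x : M.fiber t, Filter.Tendsto (fun c => M.mul (one_mul t) c x) l (𝓝 x) := by
  let B := (M.preIdealAlg t).topologicalClosure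
  have hB : IsClosed (B : Set (M.fiber 1)) := (M.preIdealAlg t).isClosed_topologicalClosure
  let _ : PartialOrder B := CStarAlgebra.spectralOrder B
  have : StarOrderedRing B := CStarAlgebra.spectralOrderedRing B
  have hl := CStarAlgebra.increasingApproximateUnit B
  have hc : ∀ (e : B) (δ : ℝ), ∃ c : M.fiber 1, c ∈ M.preIdeal t ∧ (0 < δ → ‖c - e‖ < δ) := by
    intro e δ
    by_cases hδ : 0 < δ
    · obtain ⟨c, hc, hd⟩ := Metric.mem_closure_iff.1 e.2 δ hδ
      exact ⟨c, hc, fun _ => by rwa [← dist_eq_norm, dist_comm]⟩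
    · exact ⟨0, Submodule.zero_mem _, fun h => absurd h hδ⟩
  choose c hcJ hcn using hc
  -- The approximate unit lives in the norm closure `B`. Each of its elements is moved by less than
  -- δ into the algebraic span, so once δ < 1 the norm is at most 1 + δ ≤ 2.
  let L : Filter (B × ℝ) := CStarAlgebra.approximateUnit B ×ˢ 𝓝[>] (0 : ℝ)
  have h1 : ∀ᶠ p in L, ‖(p.1 : M.fiber 1)‖ ≤ 1 := hl.eventually_norm.prod_inl _
  have h2 : ∀ᶠ p in L, 0 < p.2 ∧ p.2 < 1 :=
    (eventually_nhdsWithin_of_forall (fun δ (hδ : (0:ℝ) < δ) => hδ)).and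
      (eventually_nhdsWithin_of_eventually_nhds (eventually_lt_nhds one_pos)) |>.prod_inr _
  have h3 : Filter.Tendsto (fun p : B × ℝ => p.2) L (𝓝 0) :=
    (tendsto_nhdsWithin_iff.1 Filter.tendsto_snd).1
  refine ⟨L.map fun p => c p.1 p.2, inferInstance, ?_, fun x => ?_⟩
  · rw [Filter.eventually_map]
    filter_upwards [h1, h2] with p hp hp'
    refine ⟨hcJ _ _, ?_⟩
    have h4 := (hcn p.1 p.2 hp'.1).le
    have h5 := norm_add_le (c p.1 p.2 - p.1) (p.1 : M.fiber 1)
    rw [sub_add_cancel] at h5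
    linarith [hp'.2]
  · rw [Filter.tendsto_map'_iff, tendsto_iff_norm_sub_tendsto_zero]
    let a : B := ⟨M.mul (mul_inv_cancel t) x (M.adj rfl x),
      subset_closure (mul_mem_preIdeal _ _ _)⟩
    have h6 : Filter.Tendsto (fun p : B × ℝ => ‖p.1 * a - a‖) L (𝓝 0) :=
      (tendsto_iff_norm_sub_tendsto_zero.1 (hl.tendsto_mul_right a)).comp Filter.tendsto_fst
    have h7 : Filter.Tendsto (fun p : B × ℝ => p.2 * ‖x‖ + √(2 * ‖p.1 * a - a‖)) L (𝓝 0) := by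
      have := (h3.mul_const ‖x‖).add (h6.const_mul 2).sqrt
      simpa using this
    refine squeeze_zero' (Filter.Eventually.of_forall fun _ => norm_nonneg _) ?_ h7
    filter_upwards [h1, h2] with p hp hp'
    obtain ⟨e, δ⟩ := p
    change ‖M.mul (one_mul t) (c e δ) x - x‖ ≤ _
    have e1 : M.mul (one_mul t) (c e δ) x - x =
        M.mul (one_mul t) (c e δ - e) x + (M.mul (one_mul t) (e : M.fiber 1) x - x) := by
      rw [sub_mul]; abel
    rw [e1]
    refine (norm_add_le _ _).trans (add_le_add ((M.norm_mul_le _ _ _).trans ?_) ?_)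
    · exact mul_le_mul_of_nonneg_right (hcn e δ hp'.1).le (norm_nonneg _)
    · refine Real.le_sqrt_of_sq_le ?_
      -- With a = x x*, (e x − x)(e x − x)* = (e a − a) e* − (e a − a), whose norm is at most 2‖e a
      -- − a‖. This is the quantity under the square root in `h7`.
      rw [← norm_mul_adj_self rfl (mul_inv_cancel t)]
      have e2 : ∀ w : M.fiber t⁻¹, M.mul (mul_inv_cancel t)
          (M.mul (one_mul t) (e : M.fiber 1) x - x) w =
          (e : M.fiber 1) * M.mul (mul_inv_cancel t) x w - M.mul (mul_inv_cancel t) x w := by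
        intro w
        rw [sub_mul, M.mul_assoc _ _ (mul_inv_cancel t) (one_mul 1)]
        rfl
      have e3 : M.adj rfl (M.mul (one_mul t) (e : M.fiber 1) x - x) =
          M.mul (mul_one t⁻¹) (M.adj rfl x) (star (e : M.fiber 1)) - M.adj rfl x := by
        rw [adj_sub, M.adj_mul _ inv_one rfl _ (mul_one t⁻¹)]
        rfl
      have e4 : M.mul (mul_inv_cancel t) x (M.mul (mul_one t⁻¹) (M.adj rfl x)
          (star (e : M.fiber 1))) = (a : M.fiber 1) * star (e : M.fiber 1) := by
        rw [← M.mul_assoc (mul_inv_cancel t) (mul_one 1)]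
        rfl
      rw [e2, e3, mul_sub, e4]
      have e5 : (e : M.fiber 1) * (a * star (e : M.fiber 1) - a) - (a * star (e : M.fiber 1) - a) =
          (e * a - a) * star (e : M.fiber 1) - (e * a - a) := by
        noncomm_ring
      change ‖(e : M.fiber 1) * (a * star (e : M.fiber 1) - a) -
        (a * star (e : M.fiber 1) - a)‖ ≤ _
      rw [e5]
      refine (norm_sub_le _ _).trans ?_
      change _ ≤ 2 * ‖(e : M.fiber 1) * a - a‖
      have h8 := _root_.norm_mul_le ((e : M.fiber 1) * a - a) (star (e : M.fiber 1))
      rw [norm_star] at h8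
      have h9 : ‖(e : M.fiber 1) * a - a‖ * ‖(e : M.fiber 1)‖ ≤ ‖(e : M.fiber 1) * a - a‖ * 1 :=
        mul_le_mul_of_nonneg_left hp (norm_nonneg _)
      linarith

/-! ### The central partial action -/

/-- On generators, x (a b*) y = (x a)(b* y) is a product of elements of M_{ts} and M_{(ts)⁻¹}. The
general case follows by weak-star continuity. -/
theorem mul_mul_mem_fiberIdeal {t t' s : G} (h : t * t' = 1) (x : M.fiber t) (y : M.fiber t')
    {w : M.fiber 1} (hw : w ∈ fiberIdeal M s) :
    M.mul h (M.mul (mul_one t) x w) y ∈ fiberIdeal M (t * s) := by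
  refine map_mem_wstarClosure_of_span
    ((mulRight (B := M.toFellBundle) h y).comp (mulLeft (B := M.toFellBundle) (mul_one t) x))
    (fun φ hφ => comp_mulLeft_mem (mul_one t) x (comp_mulRight_mem h y hφ)) ?_ hw
  rintro _ ⟨a, b, rfl⟩
  change M.mul h (M.mul _ x (M.mul _ a (M.adj rfl b))) y ∈ _
  have e : M.mul h (M.mul (mul_one t) x (M.mul (mul_inv_cancel s) a (M.adj rfl b))) y =
      M.mul (show t * s * (s⁻¹ * t') = 1 by rw [← h]; group) (M.mul rfl x a)
        (M.mul rfl (M.adj rfl b) y) := by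
    rw [← M.mul_assoc rfl (by group) (mul_inv_cancel s) (mul_one t),
      M.mul_assoc _ _ rfl _]
  rw [e]
  exact preIdeal_le _ (mul_mem_preIdeal _ _ _)

/-- If c = Σ xᵢ yᵢ, take d = Σ xᵢ z yᵢ. For x in M_t the element yᵢ x lies in the unit fibre and
commutes with z, so d x = (c x) z. -/
theorem exists_mul_eq_mul_of_mem_preIdeal {t : G} {z : M.fiber 1} (hz : z ∈ M.centre)
    {c : M.fiber 1} (hc : c ∈ M.preIdeal t) : ∃ d ∈ M.preIdeal t,
      (∀ s, z ∈ fiberIdeal M s → d ∈ fiberIdeal M (t * s)) ∧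
      ∀ x : M.fiber t, M.mul (one_mul t) d x =
        M.mul (mul_one t) (M.mul (one_mul t) c x) z := by
  refine preIdeal_induction (p := fun c => ∃ d ∈ M.preIdeal t,
      (∀ s, z ∈ fiberIdeal M s → d ∈ fiberIdeal M (t * s)) ∧
      ∀ x : M.fiber t, M.mul (one_mul t) d x =
        M.mul (mul_one t) (M.mul (one_mul t) c x) z) (fun x y => ?_) ?_ ?_ hc
  · refine ⟨M.mul (mul_inv_cancel t) (M.mul (mul_one t) x z) y, mul_mem_preIdeal _ _ _,
      fun s hs => mul_mul_mem_fiberIdeal _ _ _ hs, fun w => ?_⟩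
    rw [M.mul_assoc _ _ (inv_mul_cancel t) (mul_one t), M.mul_assoc _ _ (one_mul 1) (mul_one t),
      M.mul_assoc (mul_inv_cancel t) (one_mul t) (inv_mul_cancel t) (mul_one t),
      M.mul_assoc (mul_one t) (mul_one t) (mul_one 1) (mul_one t)]
    exact congrArg _ (mem_centre_iff.1 hz _).symm
  · rintro a b ⟨d, hd, h1, h2⟩ ⟨d', hd', h1', h2'⟩
    refine ⟨d + d', Submodule.add_mem _ hd hd', fun s hs =>
      Submodule.add_mem _ (h1 s hs) (h1' s hs), fun x => ?_⟩
    rw [M.add_mul, M.add_mul, M.add_mul, h2, h2']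
  · rintro k a ⟨d, hd, h1, h2⟩
    refine ⟨k • d, Submodule.smul_mem _ k hd, fun s hs => Submodule.smul_mem _ k (h1 s hs),
      fun x => ?_⟩
    rw [M.smul_mul, M.smul_mul, M.smul_mul, h2]

/-- Let c run through the approximate unit of M_t and let d(c) be the element of
`exists_mul_eq_mul_of_mem_preIdeal`. From d(c) x = (c x) z and `norm_le_of_mem_fiberIdeal` comes the
bound ‖d(c)‖ ≤ 2‖z‖. A weak-star limit T then satisfies T x = lim (c x) z = x z. The memberships
survive because the ideals are weak-star closed. -/
theorem exists_central (t : G) {z : M.fiber 1} (hz : z ∈ M.centre) :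
    ∃ T ∈ fiberIdeal M t, (∀ s, z ∈ fiberIdeal M s → T ∈ fiberIdeal M (t * s)) ∧
      ∀ x : M.fiber t, M.mul (one_mul t) T x = M.mul (mul_one t) x z := by
  classical
  obtain ⟨l, hl, h1, h2⟩ := exists_approximateUnit M t
  have hd : ∀ c : M.fiber 1, ∃ d : M.fiber 1, c ∈ M.preIdeal t ∧ ‖c‖ ≤ 2 →
      d ∈ M.preIdeal t ∧ (∀ s, z ∈ fiberIdeal M s → d ∈ fiberIdeal M (t * s)) ∧
      ∀ x : M.fiber t, M.mul (one_mul t) d x =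
        M.mul (mul_one t) (M.mul (one_mul t) c x) z := by
    intro c
    by_cases hc : c ∈ M.preIdeal t
    · obtain ⟨d, hd⟩ := exists_mul_eq_mul_of_mem_preIdeal hz hc
      exact ⟨d, fun _ => hd⟩
    · exact ⟨0, fun h => absurd h.1 hc⟩
  choose d hd using hd
  have hn : ∀ c, c ∈ M.preIdeal t ∧ ‖c‖ ≤ 2 → ‖d c‖ ≤ 2 * ‖z‖ := fun c hc =>
    norm_le_of_mem_fiberIdeal (preIdeal_le t (hd c hc).1) (by positivity) fun x => by
      rw [(hd c hc).2.2]
      refine (M.norm_mul_le _ _ _).trans ?_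
      have h3 := (M.norm_mul_le (one_mul t) c x).trans
        (mul_le_mul_of_nonneg_right hc.2 (norm_nonneg _))
      calc _ ≤ 2 * ‖x‖ * ‖z‖ := mul_le_mul_of_nonneg_right h3 (norm_nonneg _)
        _ = _ := by ring
  let U := Ultrafilter.of l
  have hU : (U : Filter (M.fiber 1)) ≤ l := Ultrafilter.of_le _
  have hU1 := h1.filter_mono hU
  obtain ⟨T, hT⟩ := (M.isPredual 1).exists_ultrafilter_limit U
    -- The value 0 is irrelevant for the limit, since the condition holds eventually.
    (f := fun c => if c ∈ M.preIdeal t ∧ ‖c‖ ≤ 2 then d c else 0) (R := 2 * ‖z‖) fun c => by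
      split_ifs with h
      · exact hn c h
      · rw [norm_zero]; positivity
  have hT' : ∀ φ ∈ M.predual 1, Filter.Tendsto (fun c => φ (d c)) U (𝓝 (φ T)) := fun φ hφ =>
    (hT φ hφ).congr' (hU1.mono fun c hc => by rw [if_pos hc])
  refine ⟨T, mem_of_tendsto_wstar (isClosed_wstarClosure (M.predual 1) (M.preIdeal t))
    (hU1.mono fun c hc => preIdeal_le t (hd c hc).1) hT', fun s hs =>
    mem_of_tendsto_wstar (isClosed_wstarClosure (M.predual 1) (M.preIdeal (t * s)))
      (hU1.mono fun c hc => (hd c hc).2.1 s hs) hT', fun x => ?_⟩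
  refine (M.isPredual t).ext fun φ hφ => ?_
  refine tendsto_nhds_unique (hT' _ (comp_mulRight_mem (one_mul t) x hφ)) ?_
  have h3 := (φ.comp (mulRight (B := M.toFellBundle) (mul_one t) z)).continuous.tendsto x
  refine (h3.comp ((h2 x).mono_left hU)).congr' (hU1.mono fun c hc => ?_)
  exact congrArg φ ((hd c hc).2.2 x).symm

/-- The element `σ_t(z)` of `I_t` with `σ_t(z) x = x z` for `x` in the fibre at `t`. -/
def centralFun (t : G) (z : M.centre) : M.fiber 1 := (exists_central t z.2).choose

theorem centralFun_mem (t : G) (z : M.centre) : centralFun t z ∈ fiberIdeal M t :=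
  (exists_central t z.2).choose_spec.1

theorem centralFun_mem_mul (t : G) {s : G} {z : M.centre} (hz : (z : M.fiber 1) ∈ fiberIdeal M s) :
    centralFun t z ∈ fiberIdeal M (t * s) :=
  (exists_central t z.2).choose_spec.2.1 s hz

theorem centralFun_mul {t : G} (z : M.centre) (x : M.fiber t) :
    M.mul (one_mul t) (centralFun t z) x = M.mul (mul_one t) x (z : M.fiber 1) :=
  (exists_central t z.2).choose_spec.2.2 x

theorem eq_centralFun {t : G} {z : M.centre} {c : M.fiber 1} (hc : c ∈ fiberIdeal M t)
    (h : ∀ x : M.fiber t, M.mul (one_mul t) c x = M.mul (mul_one t) x (z : M.fiber 1)) :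
    c = centralFun t z :=
  fiberIdeal_ext hc (centralFun_mem t z) fun x => by rw [h, centralFun_mul]

/-- The centre of the ideal I_t lies in the centre of M_e. For y in I_t also a y is in I_t, so a c y
= a y c = c a y. It remains to apply this to y = x v* with v = (a c − c a) x. -/
theorem mem_centre_of_mul_comm {t : G} {c : M.fiber 1} (hc : c ∈ fiberIdeal M t)
    (h : ∀ a ∈ fiberIdeal M t, c * a = a * c) : c ∈ M.centre := by
  rw [mem_centre_iff]
  intro a
  have hI := isWStarIdeal_fiberIdeal (M := M) t
  refine fiberIdeal_ext (hI.mul_left_mem a c hc) (hI.mul_right_mem a c hc) fun x => ?_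
  rw [← sub_eq_zero, ← sub_mul]
  set v := M.mul (one_mul t) (a * c - c * a) x with hv
  refine eq_zero_of_mul_adj_self rfl (mul_inv_cancel t) ?_
  have hy : M.mul (mul_inv_cancel t) x (M.adj rfl v) ∈ fiberIdeal M t :=
    preIdeal_le t (mul_mem_preIdeal _ _ _)
  conv_lhs => rw [hv]
  rw [M.mul_assoc _ _ (mul_inv_cancel t) (one_mul 1)]
  change (a * c - c * a) * M.mul (mul_inv_cancel t) x (M.adj rfl v) = 0
  rw [_root_.sub_mul, _root_.mul_assoc, h _ hy, ← _root_.mul_assoc, _root_.mul_assoc c,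
    h _ (hI.mul_left_mem a _ hy), sub_self]

/-- Both products with a lie in I_t and send x in M_t to a x z. -/
theorem centralFun_mem_centre (t : G) (z : M.centre) : centralFun t z ∈ M.centre := by
  rw [mem_centre_iff]
  intro a
  have hI := isWStarIdeal_fiberIdeal (M := M) t
  refine fiberIdeal_ext (hI.mul_left_mem a _ (centralFun_mem t z))
    (hI.mul_right_mem a _ (centralFun_mem t z)) fun x => ?_
  rw [mul_fiber_assoc, mul_fiber_assoc, centralFun_mul, centralFun_mul]
  exact (M.mul_assoc _ _ _ _ _ _ _).symm

/-- The difference v of the two sides satisfies v x = y x z − z y x = 0 for every x in M_t, since y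
x lies in the unit fibre. Taking x = v* gives v = 0. -/
theorem mul_centralFun {t : G} (y : M.fiber t⁻¹) (z : M.centre) :
    M.mul (mul_one t⁻¹) y (centralFun t z) = M.mul (one_mul t⁻¹) (z : M.fiber 1) y := by
  rw [← sub_eq_zero]
  set v := M.mul (mul_one t⁻¹) y (centralFun t z) - M.mul (one_mul t⁻¹) (z : M.fiber 1) y with hv
  refine eq_zero_of_mul_adj_self (inv_inv t) (inv_mul_cancel t) ?_
  generalize M.adj (inv_inv t) v = x
  rw [hv, sub_mul, M.mul_assoc _ _ (one_mul t) (inv_mul_cancel t), centralFun_mul,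
    ← M.mul_assoc (inv_mul_cancel t) (mul_one 1), M.mul_assoc _ _ (inv_mul_cancel t) (one_mul 1)]
  exact sub_eq_zero.2 (mem_centre_iff.1 z.2 _)

/-- Taking adjoints in `mul_centralFun` gives the relation that characterizes the right-hand side.
-/
theorem star_centralFun (t : G) (z : M.centre) :
    star (centralFun t z) = centralFun t (star z) := by
  refine eq_centralFun ((isWStarIdeal_fiberIdeal t).star_mem _ (centralFun_mem t z)) fun x => ?_
  have h := congrArg (M.adj (inv_inv t)) (mul_centralFun (M.adj rfl x) z)
  rwa [M.adj_mul _ (inv_inv t) inv_one _ (one_mul t), M.adj_mul _ inv_one (inv_inv t) _ (mul_one t),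
    M.adj_adj] at h

/-- The commutation relation between the elements `σ_r(z)` and `σ_s(z)`. -/
theorem centralFun_mul_comm {u s r : G} (h : u * s = r) (a : M.fiber u) (z : M.centre) :
    M.mul (one_mul u) (centralFun r z) a = M.mul (mul_one u) a (centralFun s z) := by
  rw [← sub_eq_zero]
  set v := M.mul (one_mul u) (centralFun r z) a - M.mul (mul_one u) a (centralFun s z) with hv
  -- Both terms send x to a x z, because a x lies in M_r.
  have h1 : ∀ x : M.fiber s, M.mul h v x = 0 := fun x => by
    rw [hv, sub_mul, M.mul_assoc _ _ h (one_mul r), centralFun_mul, M.mul_assoc _ _ (one_mul s) h,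
      centralFun_mul, M.mul_assoc _ _ (mul_one s) h, sub_self]
  have hq : r⁻¹ * u = s⁻¹ := by rw [← h]; group
  -- Both terms become z y a, because y a lies in the fibre at s⁻¹.
  have h2 : ∀ y : M.fiber r⁻¹, M.mul hq y v = 0 := fun y => by
    rw [hv, mul_sub, ← M.mul_assoc (mul_one r⁻¹) hq, mul_centralFun,
      M.mul_assoc _ _ hq (one_mul s⁻¹), ← M.mul_assoc hq (mul_one s⁻¹), mul_centralFun, sub_self]
  have hI := fun t => isWStarIdeal_fiberIdeal (M := M) t
  -- Thus I_r v = 0 and v I_s = 0. The adjoint elements σ_r(z)* and σ_s(z)* are inserted here, so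
  -- that the adjoint relations are v* σ_r(z) = 0 and σ_s(z) v* = 0.
  have h3 := fiberIdeal_mul_eq_zero hq h2 (one_mul u)
    ((hI r).star_mem _ (centralFun_mem r z))
  have h4 := mul_fiberIdeal_eq_zero h h1 (mul_one u)
    ((hI s).star_mem _ (centralFun_mem s z))
  have h5 : M.mul (mul_one u⁻¹) (M.adj rfl v) (centralFun r z) = 0 := by
    have := congrArg (M.adj (s := u) rfl) h3
    rw [M.adj_mul _ inv_one rfl _ (mul_one u⁻¹), ← star_def, star_star] at this
    rw [this]
    have e := M.adj_smul (s := u) rfl 0 0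
    rwa [star_zero, zero_smul, zero_smul] at e
  have h6 : M.mul (one_mul u⁻¹) (centralFun s z) (M.adj rfl v) = 0 := by
    have := congrArg (M.adj (s := u) rfl) h4
    rw [M.adj_mul _ rfl inv_one _ (one_mul u⁻¹), ← star_def, star_star] at this
    rw [this]
    have e := M.adj_smul (s := u) rfl 0 0
    rwa [star_zero, zero_smul, zero_smul] at e
  refine eq_zero_of_mul_adj_self rfl (mul_inv_cancel u) ?_
  generalize M.adj rfl v = w at h5 h6
  rw [hv, sub_mul, M.mul_assoc _ _ (one_mul u⁻¹) (mul_inv_cancel u), h6, mul_zero_fiber, sub_zero,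
    M.mul_assoc _ _ (mul_inv_cancel u) (one_mul 1)]
  -- What remains of v v* is σ_r(z)(a v*). Centrality moves σ_r(z) to the right of a v*, where v*
  -- annihilates it.
  refine (mem_centre_iff.1 (centralFun_mem_centre r z) _).symm.trans ?_
  rw [mul_def, M.mul_assoc _ _ (mul_one u⁻¹) (mul_inv_cancel u), h5, mul_zero_fiber]

/-- For x in M_s, `centralFun_mul_comm` gives σ_{st}(z) x = x σ_t(z). The hypothesis on z puts
σ_{st}(z) into the ideal at s t t⁻¹ = s, so uniqueness applies. -/
theorem centralFun_centralFun (s t : G) {z w : M.centre} (hz : (z : M.fiber 1) ∈ fiberIdeal M t⁻¹)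
    (hw : (w : M.fiber 1) = centralFun t z) : centralFun s w = centralFun (s * t) z := by
  refine (eq_centralFun ?_ fun x => ?_).symm
  · have := centralFun_mem_mul (s * t) hz
    rwa [mul_inv_cancel_right] at this
  · rw [hw, centralFun_mul_comm rfl]

theorem centralFun_one (z : M.centre) : centralFun 1 z = z := by
  refine (eq_centralFun ?_ fun x => ?_).symm
  · rw [fiberIdeal_one]; trivial
  · exact (mem_centre_iff.1 z.2 x).symm

/-- The *-homomorphism `σ_t`. -/
def centralHom (t : G) : M.centre →⋆ₙₐ[ℂ] M.centre where
  toFun z := ⟨centralFun t z, centralFun_mem_centre t z⟩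
  map_smul' c z := Subtype.ext (eq_centralFun (Submodule.smul_mem _ c (centralFun_mem t z))
    fun x => by
      rw [M.smul_mul, centralFun_mul]
      exact (M.mul_smul _ _ _ _).symm).symm
  map_zero' := Subtype.ext (eq_centralFun (Submodule.zero_mem _) fun x => by
    rw [zero_mul_fiber]
    exact (mul_zero_fiber _ _).symm).symm
  map_add' z w := Subtype.ext (eq_centralFun (Submodule.add_mem _ (centralFun_mem t z)
    (centralFun_mem t w)) fun x => by
      rw [M.add_mul, centralFun_mul, centralFun_mul]
      exact (M.mul_add _ _ _ _).symm).symm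
  map_mul' z w := Subtype.ext (eq_centralFun ((isWStarIdeal_fiberIdeal t).mul_right_mem _ _
    (centralFun_mem t z)) fun x => by
      rw [mul_fiber_assoc, centralFun_mul, centralFun_mul, M.mul_assoc _ _ (mul_one 1) (mul_one t)]
      exact congrArg _ (mem_centre_iff.1 z.2 _)).symm
  map_star' z := Subtype.ext (star_centralFun t z).symm

/-- The construction by limits gives only the constant 2; *-homomorphisms of C*-algebras are
contractive. -/
theorem norm_centralFun_le (t : G) (z : M.centre) : ‖centralFun t z‖ ≤ ‖z‖ :=
  NonUnitalStarAlgHom.norm_apply_le (centralHom t) z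

variable (M) in
theorem isClosed_centre : @IsClosed _ (wstarTopology (M.predual 1)) (M.centre : Set (M.fiber 1)) :=
  isClosed_center (M.isPredual 1) M.isAlgDual

variable (M) in
theorem isPredual_centre : IsPredual (restrictPredual (M.predual 1) M.centre) :=
  (M.isPredual 1).restrict M.isClosed_centre

/-- `σ_t`, as a bounded linear map. -/
def centralCLM (t : G) : M.centre →L[ℂ] M.fiber 1 :=
  LinearMap.mkContinuous
    ⟨⟨centralFun t, fun z w => congrArg Subtype.val (map_add (centralHom t) z w)⟩,
      fun c z => congrArg Subtype.val (map_smul (centralHom t) c z)⟩ 1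
    fun z => by rw [one_mul]; exact norm_centralFun_le t z

/-- The map `σ_t` is weak-star continuous. -/
theorem comp_centralCLM_mem (t : G) {φ : StrongDual ℂ (M.fiber 1)} (hφ : φ ∈ M.predual 1) :
    φ.comp (centralCLM t) ∈ restrictPredual (M.predual 1) M.centre := by
  let L := (ContinuousLinearMap.compL ℂ M.centre (M.fiber 1) ℂ).flip (centralCLM t)
  let Q : Submodule ℂ (StrongDual ℂ (M.fiber 1)) :=
    (restrictPredual (M.predual 1) M.centre).comap L.toLinearMap
  have hQ : IsClosed (Q : Set (StrongDual ℂ (M.fiber 1))) :=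
    M.isPredual_centre.isClosed.preimage L.continuous
  -- It suffices that the functionals whose composition with σ_t is weak-star continuous separate
  -- points. They include those that vanish on I_t, and all a ↦ ψ(a u w) with u in M_t, since
  -- ψ(σ_t(z) u w) = ψ(u z w).
  refine (M.isPredual 1).mem_of_separating (Q := Q) hQ (fun x hx => ?_) hφ
  have hxI : x ∈ fiberIdeal M t := by
    by_contra hn
    obtain ⟨ψ, hψ, h0, h1⟩ := exists_separating (isClosed_wstarClosure _ _) hn
    refine h1 (hx ψ hψ ⟨0, Submodule.zero_mem _, fun z => h0 _ (centralFun_mem t z)⟩)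
  refine fiberIdeal_ext hxI (Submodule.zero_mem _) fun u => ?_
  rw [zero_mul_fiber]
  refine eq_zero_of_mul_adj_self rfl (mul_inv_cancel t) ?_
  generalize M.adj rfl (M.mul (one_mul t) x u) = w
  refine (M.isPredual 1).ext fun ψ hψ => ?_
  rw [map_zero]
  refine hx ((ψ.comp (mulRight (B := M.toFellBundle) (mul_inv_cancel t) w)).comp
    (mulRight (B := M.toFellBundle) (one_mul t) u))
    (comp_mulRight_mem _ _ (comp_mulRight_mem _ _ hψ))
    ⟨(ψ.comp (mulRight (B := M.toFellBundle) (mul_inv_cancel t) w)).comp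
      (mulLeft (B := M.toFellBundle) (mul_one t) u),
      comp_mulLeft_mem _ _ (comp_mulRight_mem _ _ hψ), fun z => ?_⟩
  change ψ (M.mul _ (M.mul _ (centralFun t z) u) w) = ψ (M.mul _ (M.mul _ u (z : M.fiber 1)) w)
  rw [centralFun_mul]

/-! ### Existence, uniqueness and weak-star continuity of the central partial action. -/

variable (M) in
/-- The central partial action of a W*-Fell bundle. -/
def centralAction : PartialAction G M.centre where
  dom t := {z | (z : M.fiber 1) ∈ fiberIdeal M t}
  map t z := ⟨centralHom (M := M) t z.1, centralFun_mem t z.1⟩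
  dom_one := by
    rw [fiberIdeal_one]
    exact Set.eq_univ_of_forall fun _ => trivial
  map_one z := Subtype.ext (centralFun_one _)
  mem_dom s t z h := by
    change z.1.1 ∈ fiberIdeal M (s * t)⁻¹
    -- Applying σ_{t⁻¹} to σ_t(z) recovers z and moves the ideal at s⁻¹ into the ideal at t⁻¹ s⁻¹.
    have h1 := centralFun_mem_mul t⁻¹ (z := centralHom t z.1) h
    rw [centralFun_centralFun t⁻¹ t z.2 rfl, inv_mul_cancel, centralFun_one] at h1
    rwa [mul_inv_rev]
  map_mul s t z h := Subtype.ext (centralFun_centralFun s t z.2 rfl).symm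

theorem centralAction_map (t : G) (z : (centralAction M).dom t⁻¹) :
    ((centralAction M).map t z : M.centre) = centralHom t z := rfl

theorem isCentralPartialAction_centralAction : M.IsCentralPartialAction (centralAction M) where
  dom_eq t := by
    ext z
    constructor
    · rintro ⟨z, hz, rfl⟩
      exact ⟨hz, fun a _ => (mem_centre_iff.1 z.2 a).symm⟩
    · rintro ⟨hz, h⟩
      exact ⟨⟨z, mem_centre_of_mul_comm hz h⟩, hz, rfl⟩
  map_mul t z x := centralFun_mul _ x

/-- The inclusion of the centre is injective, so the prescribed images fix the domains. The values
lie in I_t, where the action on M_t determines them. -/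
theorem IsCentralPartialAction.eq {σ : PartialAction G M.centre}
    (hσ : M.IsCentralPartialAction σ) : σ = centralAction M := by
  have hdom : σ.dom = (centralAction M).dom := funext fun t =>
    Subtype.val_injective.image_injective
      ((hσ.dom_eq t).trans (isCentralPartialAction_centralAction.dom_eq t).symm)
  have hmap : ∀ t (z : σ.dom t⁻¹), ((σ.map t z : M.centre) : M.fiber 1) = centralFun t z :=
    fun t z => eq_centralFun (by
      have : (σ.map t z : M.centre) ∈ (centralAction M).dom t := hdom ▸ (σ.map t z).2
      exact this) (hσ.map_mul t z)
  obtain ⟨dom, map, h1, h2, h3, h4⟩ := σ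
  dsimp only at hdom
  subst hdom
  have : map = (centralAction M).map := by
    funext t z
    exact Subtype.ext (Subtype.ext (hmap t z))
  subst this
  rfl

/-- The central partial action is a W*-partial action. -/
theorem isWStarPartialAction_centralAction :
    IsWStarPartialAction (restrictPredual (M.predual 1) M.centre) (centralAction M) where
  isWStarIdeal t :=
    { zero_mem := (fiberIdeal M t).zero_mem
      add_mem := fun _ ha _ hb => (fiberIdeal M t).add_mem ha hb
      smul_mem := fun c _ ha => (fiberIdeal M t).smul_mem c ha
      mul_left_mem := fun b _ ha => (isWStarIdeal_fiberIdeal t).mul_left_mem b _ ha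
      mul_right_mem := fun b _ ha => (isWStarIdeal_fiberIdeal t).mul_right_mem b _ ha
      star_mem := fun _ ha => (isWStarIdeal_fiberIdeal t).star_mem _ ha
      isClosed := by
        refine @IsClosed.preimage _ _ (wstarTopology _) (wstarTopology _) _ ?_ _
          (isWStarIdeal_fiberIdeal (M := M) t).isClosed
        exact continuous_wstar_wstar fun φ hφ => ⟨_, restrictFunctional_mem hφ, fun _ => rfl⟩ }
  map_add t x y z h := by
    simp only [centralAction_map, h, map_add]
  map_smul t c x z h := by
    simp only [centralAction_map, h, map_smul]
  map_mul t x y z h := by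
    simp only [centralAction_map, h, map_mul]
  map_star t x z h := by
    simp only [centralAction_map, h, map_star]
  continuous_map t := by
    refine continuous_wstarTopologyOn fun ψ hψ => ?_
    obtain ⟨φ, hφ, h⟩ := hψ
    exact ⟨_, comp_centralCLM_mem t hφ, fun z => h _⟩

/-! ### The predual of the algebra of adjointable operators -/

namespace L2

theorem ipL_add_left (ξ η ζ : L2 M) : ipL (ξ + η) ζ = ipL ξ ζ + ipL η ζ := by
  rw [← star_ipL, ipL_add_right, star_add, star_ipL, star_ipL]

theorem ipL_smul_left (c : ℂ) (ξ η : L2 M) : ipL (c • ξ) η = star c • ipL ξ η := by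
  rw [← star_ipL, ipL_smul_right, star_smul, star_ipL]

theorem ipL_actL_left (ξ η : L2 M) (b : M.fiber 1) : ipL (actL ξ b) η = star b * ipL ξ η := by
  rw [← star_ipL, ipL_actL, star_mul, star_ipL]

theorem norm_ipL_le (ξ η : L2 M) : ‖ipL ξ η‖ ≤ ‖ξ‖ * ‖η‖ :=
  CStarModule.norm_inner_le (A := (M.fiber 1)ᵐᵒᵖ) (L2 M)

theorem ip_zero_right {t : G} (a : M.fiber t) : ip a 0 = 0 := mul_zero_fiber _ _

open scoped Classical in
/-- The restriction of a section to a subset, extended by zero. -/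
def cut (S : Set G) (ξ : L2 M) : L2 M :=
  ⟨fun t => if t ∈ S then ξ t else 0, by
    obtain ⟨C, hC⟩ := ξ.2
    refine ⟨C, fun F => le_trans ?_ (hC F)⟩
    refine CStarAlgebra.norm_le_norm_of_nonneg_of_le
      (Finset.sum_nonneg fun t _ => ip_self_nonneg _) (Finset.sum_le_sum fun t _ => ?_)
    beta_reduce
    split_ifs
    · exact le_rfl
    · rw [ip_zero_left]; exact ip_self_nonneg _⟩

theorem cut_of_mem {S : Set G} {t : G} (h : t ∈ S) (ξ : L2 M) : cut S ξ t = ξ t := if_pos h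

theorem cut_of_notMem {S : Set G} {t : G} (h : t ∉ S) (ξ : L2 M) : cut S ξ t = 0 := if_neg h

theorem norm_cut_le (S : Set G) (ξ : L2 M) : ‖cut S ξ‖ ≤ ‖ξ‖ := by
  refine norm_le_of_sum (norm_nonneg _) fun F => le_trans ?_ (norm_sum_ip_le ξ F)
  refine CStarAlgebra.norm_le_norm_of_nonneg_of_le
    (Finset.sum_nonneg fun t _ => ip_self_nonneg _) (Finset.sum_le_sum fun t _ => ?_)
  by_cases h : t ∈ S
  · rw [cut_of_mem h]
  · rw [cut_of_notMem h, ip_zero_left]; exact ip_self_nonneg _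

theorem ipL_cut_left (S : Set G) (ξ η : L2 M) : ipL (cut S ξ) η = ipL ξ (cut S η) := by
  refine ipL_eq fun φ hφ => ?_
  refine (hasSum_ipL ξ (cut S η) hφ).congr_fun fun t => ?_
  by_cases h : t ∈ S
  · rw [cut_of_mem h, cut_of_mem h]
  · rw [cut_of_notMem h, cut_of_notMem h, ip_zero_left, ip_zero_right]

theorem ipL_cut (F : Finset G) (ξ η : L2 M) :
    ipL ξ (cut F η) = ∑ t ∈ F, ip (ξ t) (η t) := by
  refine ipL_eq fun φ hφ => ?_
  rw [map_sum, ← Finset.sum_congr rfl fun t ht => congrArg (fun a => φ (ip (ξ t) a))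
    (cut_of_mem (S := (F : Set G)) ht η)]
  refine hasSum_sum_of_ne_finset_zero fun t ht => ?_
  rw [cut_of_notMem (by exact ht), ip_zero_right, map_zero]

theorem tendsto_ipL_cut (ξ η : L2 M) {φ : StrongDual ℂ (M.fiber 1)} (hφ : φ ∈ M.predual 1) :
    Filter.Tendsto (fun F : Finset G => φ (ipL ξ (cut F η))) Filter.atTop (𝓝 (φ (ipL ξ η))) := by
  refine Filter.Tendsto.congr (fun F => ?_) (hasSum_ipL ξ η hφ)
  rw [ipL_cut, map_sum]

theorem cut_finset (F : Finset G) (ξ : L2 M) : cut F ξ = ∑ t ∈ F, single t (ξ t) := by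
  refine inner_left_ext (B := (M.fiber 1)ᵐᵒᵖ) fun ζ => ?_
  rw [CStarModule.inner_sum_right]
  simp only [inner_eq, ipL_cut, ipL_single_right, Finset.op_sum]

theorem cut_compl (S : Set G) (ξ : L2 M) : ξ - cut S ξ = cut Sᶜ ξ := by
  ext t
  rw [sub_apply]
  by_cases h : t ∈ S
  · rw [cut_of_mem h, cut_of_notMem (by simpa using h), sub_self]
  · rw [cut_of_notMem h, cut_of_mem h, sub_zero]

theorem single_actL (r : G) (a : M.fiber r) (b : M.fiber 1) :
    single r (act a b) = actL (single r a) b := by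
  ext t
  rcases eq_or_ne t r with rfl | h
  · rw [single_same]
    change _ = act (single t a t) b
    rw [single_same]
  · rw [single_of_ne h]
    change _ = act (single r a t) b
    rw [single_of_ne h]
    exact (zero_mul_fiber _ _).symm

theorem ipL_eq_zero_of_disjoint {ξ η : L2 M} (h : ∀ t, ξ t = 0 ∨ η t = 0) : ipL ξ η = 0 := by
  refine ipL_eq fun φ hφ => ?_
  rw [map_zero]
  refine hasSum_zero.congr_fun fun t => ?_
  rcases h t with h | h
  · rw [h, ip_zero_left, map_zero]
  · rw [h, ip_zero_right, map_zero]

/-- The functional `η ↦ φ ⟨ξ, η⟩` is small on sections which vanish on a large finite set. -/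
theorem exists_finset_norm_ipL_le {φ : StrongDual ℂ (M.fiber 1)} (hφ : φ ∈ M.predual 1)
    (ξ : L2 M) {ε : ℝ} (hε : 0 < ε) :
    ∃ F : Finset G, ∀ η : L2 M, (∀ t ∈ F, η t = 0) → ‖φ (ipL ξ η)‖ ≤ ε * ‖η‖ := by
  classical
  by_contra! hcon
  -- If the claim fails, beyond every finite set there is a finitely supported vector of norm at
  -- most 1 on which the functional equals ε. It is a truncation of a bad vector, rescaled by ε/c.
  have step : ∀ F : Finset G, ∃ (F' : Finset G) (y : L2 M), (∀ t ∈ F, y t = 0) ∧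
      (∀ t ∉ F', y t = 0) ∧ ‖y‖ ≤ 1 ∧ φ (ipL ξ y) = ε := by
    intro F
    obtain ⟨y, hy, hlt⟩ := hcon F
    obtain ⟨F', hF'⟩ := ((tendsto_ipL_cut ξ y hφ).norm.eventually (lt_mem_nhds hlt)).exists
    set c := φ (ipL ξ (cut F' y)) with hc
    have h1 : ε * ‖cut (F' : Set G) y‖ < ‖c‖ :=
      (mul_le_mul_of_nonneg_left (norm_cut_le _ y) hε.le).trans_lt hF'
    have hc0 : 0 < ‖c‖ := (by positivity : 0 ≤ ε * ‖cut (F' : Set G) y‖).trans_lt h1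
    refine ⟨F', (ε / c : ℂ) • cut F' y, fun t ht => ?_, fun t ht => ?_, ?_, ?_⟩
    · rw [smul_apply]
      by_cases h : t ∈ (F' : Set G)
      · rw [cut_of_mem h, hy t ht, smul_zero]
      · rw [cut_of_notMem h, smul_zero]
    · rw [smul_apply, cut_of_notMem (by exact ht), smul_zero]
    · rw [norm_smul, norm_div, Complex.norm_real, Real.norm_eq_abs, abs_of_pos hε, div_mul_eq_mul_div,
        div_le_one hc0]
      exact h1.le
    · rw [ipL_smul_right, map_smul, ← hc, smul_eq_mul, div_mul_cancel₀ _ (norm_pos_iff.1 hc0)]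
  -- Adding n such vectors with disjoint supports gives squared norm at most n but value n ε, which
  -- contradicts Cauchy–Schwarz for large n.
  have build : ∀ n : ℕ, ∃ (F : Finset G) (w : L2 M), (∀ t ∉ F, w t = 0) ∧ ‖w‖ ^ 2 ≤ n ∧
      φ (ipL ξ w) = n * ε := by
    intro n
    induction n with
    | zero => exact ⟨∅, 0, fun _ _ => rfl, by simp, by
        have := ipL_smul_right 0 ξ (0 : L2 M)
        rw [zero_smul, zero_smul] at this
        simp [this]⟩
    | succ n ih =>
      obtain ⟨F, w, h1, h2, h3⟩ := ih
      obtain ⟨F', y, hy, hy', hy1, hy2⟩ := step F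
      refine ⟨F ∪ F', w + y, fun t ht => ?_, ?_, ?_⟩
      · rw [Finset.mem_union, not_or] at ht
        rw [add_apply, h1 t ht.1, hy' t ht.2, add_zero]
      · have hd : ∀ t, w t = 0 ∨ y t = 0 := fun t => by
          by_cases h : t ∈ F
          · exact Or.inr (hy t h)
          · exact Or.inl (h1 t h)
        rw [norm_sq_eq, ipL_add_left, ipL_add_right, ipL_add_right, ipL_eq_zero_of_disjoint hd,
          ipL_eq_zero_of_disjoint fun t => (hd t).symm, add_zero, zero_add]
        refine (norm_add_le _ _).trans ?_
        rw [← norm_sq_eq, ← norm_sq_eq, Nat.cast_succ]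
        exact add_le_add h2 (pow_le_one₀ (norm_nonneg _) hy1)
      · rw [ipL_add_right, map_add, h3, hy2]
        push_cast
        ring
  obtain ⟨n, hn⟩ := exists_nat_gt ((‖φ‖ * ‖ξ‖) ^ 2 / ε ^ 2)
  obtain ⟨F, w, -, h2, h3⟩ := build n
  have hn0 : (0 : ℝ) < n := (by positivity : 0 ≤ (‖φ‖ * ‖ξ‖) ^ 2 / ε ^ 2).trans_lt hn
  have h4 : n * ε ≤ ‖φ‖ * ‖ξ‖ * ‖w‖ := by
    have : ‖φ (ipL ξ w)‖ ≤ ‖φ‖ * (‖ξ‖ * ‖w‖) :=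
      (φ.le_opNorm _).trans (mul_le_mul_of_nonneg_left (norm_ipL_le ξ w) (norm_nonneg _))
    rw [h3, norm_mul, Complex.norm_natCast, Complex.norm_real, Real.norm_eq_abs, abs_of_pos hε] at this
    linarith
  have h5 : (n * ε) ^ 2 ≤ (‖φ‖ * ‖ξ‖) ^ 2 * n :=
    (pow_le_pow_left₀ (by positivity) h4 2).trans (by
      rw [mul_pow]
      exact mul_le_mul_of_nonneg_left h2 (by positivity))
  rw [div_lt_iff₀ (by positivity)] at hn
  nlinarith

end L2

theorem opFunctional_mem {φ : StrongDual ℂ (M.fiber 1)} (hφ : φ ∈ M.predual 1) (ξ η : L2 M) :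
    opFunctional φ ξ η ∈ opPredual M :=
  Submodule.le_topologicalClosure _ (Submodule.subset_span ⟨φ, hφ, ξ, η, rfl⟩)

theorem norm_opFunctional_le (φ : StrongDual ℂ (M.fiber 1)) (ξ η : L2 M) :
    ‖opFunctional φ ξ η‖ ≤ ‖φ‖ * (‖ξ‖ * ‖η‖) :=
  LinearMap.mkContinuous_norm_le _ (by positivity) _

/-- The convergence is in norm, although finite truncations of ξ need not converge to ξ in the norm
of the module. The gain comes from `exists_finset_norm_ipL_le`, which is uniform over the vectors T
η with ‖T‖ bounded. -/
theorem tendsto_opFunctional_cut {φ : StrongDual ℂ (M.fiber 1)} (hφ : φ ∈ M.predual 1)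
    (ξ η : L2 M) : Filter.Tendsto (fun F : Finset G => opFunctional φ (L2.cut F ξ) η) Filter.atTop
      (𝓝 (opFunctional φ ξ η)) := by
  rw [Metric.tendsto_nhds]
  intro ε hε
  -- The summand 1 keeps the denominator positive when η = 0.
  obtain ⟨F₀, hF₀⟩ := L2.exists_finset_norm_ipL_le hφ ξ
    (show 0 < ε / 2 / (‖η‖ + 1) by positivity)
  refine (Filter.eventually_ge_atTop F₀).mono fun F hF => ?_
  rw [dist_eq_norm]
  refine lt_of_le_of_lt (b := ε / 2) ?_ (half_lt_self hε)
  refine ContinuousLinearMap.opNorm_le_bound _ (half_pos hε).le fun T => ?_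
  have h1 : (opFunctional φ (L2.cut F ξ) η - opFunctional φ ξ η) T =
      -φ (L2.ipL ξ (L2.cut (F : Set G)ᶜ (T.1 η))) := by
    rw [sub_apply, opFunctional_apply, opFunctional_apply, L2.ipL_cut_left, ← map_sub, ← map_neg,
      ← L2.cut_compl, sub_eq_add_neg (T.1 η), L2.ipL_add_right]
    have := L2.ipL_smul_right (-1) ξ (L2.cut F (T.1 η))
    rw [neg_one_smul, neg_one_smul] at this
    rw [this, neg_add_rev, neg_neg, sub_eq_add_neg]
  rw [h1, norm_neg]
  refine (hF₀ _ fun t ht => L2.cut_of_notMem (by simpa using hF ht) _).trans ?_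
  have h2 : ‖L2.cut (F : Set G)ᶜ (T.1 η)‖ ≤ ‖T‖ * ‖η‖ :=
    (L2.norm_cut_le _ _).trans (Adjointable.norm_apply_le T η)
  calc ε / 2 / (‖η‖ + 1) * ‖L2.cut (F : Set G)ᶜ (T.1 η)‖ ≤ ε / 2 / (‖η‖ + 1) * (‖T‖ * ‖η‖) := by
        gcongr
    _ = ε / 2 * ‖T‖ * (‖η‖ / (‖η‖ + 1)) := by ring
    _ ≤ ε / 2 * ‖T‖ * 1 := by
        gcongr
        rw [div_le_one (by positivity)]
        linarith
    _ = ε / 2 * ‖T‖ := mul_one _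

theorem opFunctional_add_left (φ : StrongDual ℂ (M.fiber 1)) (ξ ξ' η : L2 M) :
    opFunctional φ (ξ + ξ') η = opFunctional φ ξ η + opFunctional φ ξ' η := by
  ext T
  rw [add_apply, opFunctional_apply, opFunctional_apply, opFunctional_apply, L2.ipL_add_left,
    map_add]

theorem opFunctional_smul_left (φ : StrongDual ℂ (M.fiber 1)) (c : ℂ) (ξ η : L2 M) :
    opFunctional φ (c • ξ) η = star c • opFunctional φ ξ η := by
  ext T
  rw [smul_apply, opFunctional_apply, opFunctional_apply, L2.ipL_smul_left, map_smul]

theorem opFunctional_add_right (φ : StrongDual ℂ (M.fiber 1)) (ξ η η' : L2 M) :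
    opFunctional φ ξ (η + η') = opFunctional φ ξ η + opFunctional φ ξ η' := by
  ext T
  rw [add_apply, opFunctional_apply, opFunctional_apply, opFunctional_apply, map_add,
    L2.ipL_add_right, map_add]

theorem opFunctional_smul_right (φ : StrongDual ℂ (M.fiber 1)) (c : ℂ) (ξ η : L2 M) :
    opFunctional φ ξ (c • η) = c • opFunctional φ ξ η := by
  ext T
  rw [smul_apply, opFunctional_apply, opFunctional_apply, map_smul, L2.ipL_smul_right, map_smul]

theorem opFunctional_actL_left (φ : StrongDual ℂ (M.fiber 1)) (ξ η : L2 M) (b : M.fiber 1) :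
    opFunctional φ (L2.actL ξ b) η =
      opFunctional (φ.comp (ContinuousLinearMap.mul ℂ (M.fiber 1) (star b))) ξ η := by
  ext T
  rw [opFunctional_apply, opFunctional_apply, L2.ipL_actL_left]
  rfl

theorem _root_.tendsto_of_bounded_functional {V : Type*} [NormedAddCommGroup V] [NormedSpace ℂ V]
    {S : Submodule ℂ V} {Λ : S →ₗ[ℂ] ℂ} {C : ℝ} (hC : ∀ v : S, ‖Λ v‖ ≤ C * ‖(v : V)‖)
    {ι : Type*} {l : Filter ι} {f : ι → V} {a : V} (hf : ∀ i, f i ∈ S) (ha : a ∈ S)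
    (h : Filter.Tendsto f l (𝓝 a)) :
    Filter.Tendsto (fun i => Λ ⟨f i, hf i⟩) l (𝓝 (Λ ⟨a, ha⟩)) :=
  ((Λ.mkContinuous C hC).continuous.tendsto ⟨a, ha⟩).comp (tendsto_subtype_rng.2 h)

/-- The predual of the algebra of operators is generated by the functionals `T ↦ φ ⟨ξ, T η⟩`, with
`ξ` supported at a point. -/
theorem opPredual_le {Q : Submodule ℂ (StrongDual ℂ (Op M))}
    (hQ : IsClosed (Q : Set (StrongDual ℂ (Op M))))
    (h : ∀ φ ∈ M.predual 1, ∀ (r : G) (x : M.fiber r) (η : L2 M),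
      opFunctional φ (L2.single r x) η ∈ Q) : opPredual M ≤ Q := by
  refine Submodule.topologicalClosure_minimal _ (Submodule.span_le.2 ?_) hQ
  rintro _ ⟨φ, hφ, ξ, η, rfl⟩
  refine hQ.mem_of_tendsto (tendsto_opFunctional_cut hφ ξ η) (Filter.Eventually.of_forall fun F => ?_)
  let L : L2 M →+ StrongDual ℂ (Op M) :=
    AddMonoidHom.mk' (fun ξ => opFunctional φ ξ η) fun a b => opFunctional_add_left φ a b η
  change L (L2.cut F ξ) ∈ Q
  rw [L2.cut_finset, map_sum]
  exact Q.sum_mem fun t _ => h φ hφ t _ η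

/-- A bounded functional on the predual of the algebra of operators is implemented by an operator. -/
theorem exists_clm_of_functional (Λ : opPredual M →ₗ[ℂ] ℂ) {C : ℝ} (hC0 : 0 ≤ C)
    (hC : ∀ ω : opPredual M, ‖Λ ω‖ ≤ C * ‖(ω : StrongDual ℂ (Op M))‖) :
    ∃ T : L2 M →L[ℂ] L2 M, ∀ φ (hφ : φ ∈ M.predual 1) (ξ η : L2 M),
      Λ ⟨opFunctional φ ξ η, opFunctional_mem hφ ξ η⟩ = φ (L2.ipL ξ (T η)) := by
  classical
  have hbd : ∀ φ (hφ : φ ∈ M.predual 1) (ξ η : L2 M),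
      ‖Λ ⟨opFunctional φ ξ η, opFunctional_mem hφ ξ η⟩‖ ≤ C * ‖ξ‖ * ‖η‖ * ‖φ‖ := by
    intro φ hφ ξ η
    refine (hC _).trans ((mul_le_mul_of_nonneg_left (norm_opFunctional_le φ ξ η) hC0).trans_eq ?_)
    ring
  -- For fixed ξ and η, `Λ` is a bounded functional of φ, hence given by an element b(ξ, η) of the
  -- unit fibre. The form b is the candidate for ⟨ξ, T η⟩.
  have hex : ∀ ξ η : L2 M, ∃ b : M.fiber 1, ∀ φ : M.predual 1,
      Λ ⟨opFunctional φ ξ η, opFunctional_mem φ.2 ξ η⟩ = (φ : StrongDual ℂ (M.fiber 1)) b := by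
    intro ξ η
    refine (M.isPredual 1).surjective
      { toFun := fun φ => Λ ⟨opFunctional φ ξ η, opFunctional_mem φ.2 ξ η⟩
        map_add' := fun φ ψ => by rw [← map_add]; rfl
        map_smul' := fun c φ => by rw [← map_smul]; rfl } ⟨C * ‖ξ‖ * ‖η‖, fun φ => hbd φ φ.2 ξ η⟩
  choose b hb using hex
  have hbn : ∀ ξ η, ‖b ξ η‖ ≤ C * ‖ξ‖ * ‖η‖ := fun ξ η =>
    (M.isPredual 1).norm_le _ _ (by positivity) fun φ hφ => by
      rw [← hb ξ η ⟨φ, hφ⟩]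
      exact hbd φ hφ ξ η
  have hb_add_left : ∀ ξ ξ' η, b (ξ + ξ') η = b ξ η + b ξ' η := fun ξ ξ' η =>
    (M.isPredual 1).ext fun φ hφ => by
      rw [map_add, ← hb _ _ ⟨φ, hφ⟩, ← hb _ _ ⟨φ, hφ⟩, ← hb _ _ ⟨φ, hφ⟩, ← map_add]
      exact congrArg Λ (Subtype.ext (opFunctional_add_left φ ξ ξ' η))
  have hb_smul_left : ∀ (c : ℂ) ξ η, b (c • ξ) η = star c • b ξ η := fun c ξ η =>
    (M.isPredual 1).ext fun φ hφ => by
      rw [map_smul, ← hb _ _ ⟨φ, hφ⟩, ← hb _ _ ⟨φ, hφ⟩, ← map_smul]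
      exact congrArg Λ (Subtype.ext (opFunctional_smul_left φ c ξ η))
  have hb_add_right : ∀ ξ η η', b ξ (η + η') = b ξ η + b ξ η' := fun ξ η η' =>
    (M.isPredual 1).ext fun φ hφ => by
      rw [map_add, ← hb _ _ ⟨φ, hφ⟩, ← hb _ _ ⟨φ, hφ⟩, ← hb _ _ ⟨φ, hφ⟩, ← map_add]
      exact congrArg Λ (Subtype.ext (opFunctional_add_right φ ξ η η'))
  have hb_smul_right : ∀ (c : ℂ) ξ η, b ξ (c • η) = c • b ξ η := fun c ξ η =>
    (M.isPredual 1).ext fun φ hφ => by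
      rw [map_smul, ← hb _ _ ⟨φ, hφ⟩, ← hb _ _ ⟨φ, hφ⟩, ← map_smul]
      exact congrArg Λ (Subtype.ext (opFunctional_smul_right φ c ξ η))
  have hb_act : ∀ ξ η (a : M.fiber 1), b (L2.actL ξ a) η = star a * b ξ η := fun ξ η a =>
    (M.isPredual 1).ext fun φ hφ => by
      have h1 := hb ξ η ⟨_, M.isAlgDual.mul_left_mem φ hφ (star a)⟩
      rw [← hb _ _ ⟨φ, hφ⟩]
      refine Eq.trans ?_ h1
      exact congrArg Λ (Subtype.ext (opFunctional_actL_left φ ξ η a))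
  -- The coordinate of T η at r must represent x ↦ b(δ_r x, η). Such a representation is explicit
  -- after x is replaced by c x with c = Σ uᵢ wᵢ, and the general case is a weak-star limit along
  -- the approximate unit.
  have hcomp : ∀ (η : L2 M) (r : G), ∃ y : M.fiber r, ∀ x : M.fiber r,
      ip x y = b (L2.single r x) η := by
    intro η r
    have h1 : ∀ c ∈ M.preIdeal r, ∃ y : M.fiber r, ∀ x : M.fiber r,
        ip x y = b (L2.single r (M.mul (one_mul r) c x)) η := by
      intro c hc
      refine preIdeal_induction (p := fun c => ∃ y : M.fiber r, ∀ x : M.fiber r,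
        ip x y = b (L2.single r (M.mul (one_mul r) c x)) η) (fun u w => ?_) ?_ ?_ hc
      -- Since w x lies in the unit fibre, b(δ_r(u w x), η) = (w x)* b(δ_r u, η) = x* w* b(δ_r u,
      -- η).
      · refine ⟨act (M.adj (inv_inv r) w) (b (L2.single r u) η), fun x => ?_⟩
        rw [M.mul_assoc _ _ (inv_mul_cancel r) (mul_one r)]
        change _ = b (L2.single r (act u (M.mul (inv_mul_cancel r) w x))) η
        rw [L2.single_actL, hb_act, ip_act, star_def,
          M.adj_mul _ (inv_inv r) rfl inv_one (inv_mul_cancel r)]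
        rfl
      · rintro a a' ⟨y, hy⟩ ⟨y', hy'⟩
        exact ⟨y + y', fun x => by
          rw [ip_add_right, hy, hy', M.add_mul, L2.single_add, hb_add_left]⟩
      · rintro k a ⟨y, hy⟩
        exact ⟨star k • y, fun x => by
          rw [ip_smul_right, hy, M.smul_mul, L2.single_smul, hb_smul_left]⟩
    have h2 : ∀ c : M.fiber 1, ∃ y : M.fiber r, c ∈ M.preIdeal r → ∀ x : M.fiber r,
        ip x y = b (L2.single r (M.mul (one_mul r) c x)) η := fun c => by
      by_cases hc : c ∈ M.preIdeal r
      · obtain ⟨y, hy⟩ := h1 c hc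
        exact ⟨y, fun _ => hy⟩
      · exact ⟨0, fun h => absurd h hc⟩
    choose y hy using h2
    -- Testing y(c) against itself bounds ‖y(c)‖² by a multiple of ‖y(c)‖, and one factor cancels.
    have hyn : ∀ c, c ∈ M.preIdeal r ∧ ‖c‖ ≤ 2 → ‖y c‖ ≤ C * 2 * ‖η‖ := by
      intro c hc
      have h3 := hy c hc.1 (y c)
      have h4 := congrArg norm h3
      rw [norm_ip_self] at h4
      have h5 := hbn (L2.single r (M.mul (one_mul r) c (y c))) η
      rw [← h4, L2.norm_single] at h5
      have h6 : ‖M.mul (one_mul r) c (y c)‖ ≤ 2 * ‖y c‖ := (M.norm_mul_le _ _ _).trans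
        (mul_le_mul_of_nonneg_right hc.2 (norm_nonneg _))
      have h7 : ‖y c‖ ^ 2 ≤ C * (2 * ‖y c‖) * ‖η‖ := h5.trans (by gcongr)
      rcases (norm_nonneg (y c)).eq_or_lt with h0 | h0
      · rw [← h0]; positivity
      · refine le_of_mul_le_mul_right ?_ h0
        calc ‖y c‖ * ‖y c‖ = ‖y c‖ ^ 2 := (sq _).symm
          _ ≤ _ := h7
          _ = _ := by ring
    obtain ⟨l, hl, hl1, hl2⟩ := exists_approximateUnit M r
    let U := Ultrafilter.of l
    have hU : (U : Filter (M.fiber 1)) ≤ l := Ultrafilter.of_le _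
    have hU1 := hl1.filter_mono hU
    obtain ⟨Y, hY⟩ := (M.isPredual r).exists_ultrafilter_limit U
      (f := fun c => if c ∈ M.preIdeal r ∧ ‖c‖ ≤ 2 then y c else 0) (R := C * 2 * ‖η‖) fun c => by
        split_ifs with h
        · exact hyn c h
        · rw [norm_zero]; positivity
    have hY' : ∀ φ ∈ M.predual r, Filter.Tendsto (fun c => φ (y c)) U (𝓝 (φ Y)) := fun φ hφ =>
      (hY φ hφ).congr' (hU1.mono fun c hc => by rw [if_pos hc])
    refine ⟨Y, fun x => (M.isPredual 1).ext fun φ hφ => ?_⟩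
    refine tendsto_nhds_unique (hY' _ (comp_mulLeft_mem (inv_mul_cancel r) (M.adj rfl x) hφ)) ?_
    let β : M.fiber r →+ M.fiber 1 := AddMonoidHom.mk' (fun x => b (L2.single r x) η)
      fun x x' => by rw [L2.single_add, hb_add_left]
    have hβ : Continuous β := AddMonoidHomClass.continuous_of_bound β (C * ‖η‖) fun x => by
      refine (hbn _ _).trans_eq ?_
      rw [L2.norm_single]
      ring
    refine (((φ.continuous.comp hβ).tendsto x).comp ((hl2 x).mono_left hU)).congr'
      (hU1.mono fun c hc => ?_)
    exact congrArg φ (hy c hc.1 x).symm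
  choose y hy using hcomp
  -- For ξ = Σ_{t ∈ F} δ_t y(η)_t one has ⟨ξ, ξ⟩ = b(ξ, η), so ‖ξ‖² ≤ C‖ξ‖‖η‖.
  have hsum : ∀ (η : L2 M) (F : Finset G), ‖∑ t ∈ F, ip (y η t) (y η t)‖ ≤ (C * ‖η‖) ^ 2 := by
    intro η F
    let ξ : L2 M := ∑ t ∈ F, L2.single t (y η t)
    let β : L2 M →+ M.fiber 1 := AddMonoidHom.mk' (fun ξ => b ξ η) fun ξ ξ' => hb_add_left ξ ξ' η
    have h1 : b ξ η = ∑ t ∈ F, ip (y η t) (y η t) := by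
      change β ξ = _
      rw [map_sum]
      exact Finset.sum_congr rfl fun t _ => (hy η t _).symm
    have h2 : ∀ t ∈ F, ξ t = y η t := by
      intro t ht
      have h3 : ∀ (F : Finset G), (∑ s ∈ F, L2.single s (y η s) : L2 M) t =
          ∑ s ∈ F, (L2.single s (y η s) : L2 M) t := by
        intro F
        induction F using Finset.induction with
        | empty => rfl
        | insert a s ha ih => rw [Finset.sum_insert ha, L2.add_apply, ih, Finset.sum_insert ha]
      change (∑ s ∈ F, L2.single s (y η s) : L2 M) t = _
      rw [h3, Finset.sum_eq_single_of_mem t ht fun s _ hs => L2.single_of_ne hs.symm _,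
        L2.single_same]
    have h4 : L2.ipL ξ ξ = ∑ t ∈ F, ip (y η t) (y η t) := by
      let κ : L2 M →+ M.fiber 1 := AddMonoidHom.mk' (fun ζ => L2.ipL ξ ζ) (L2.ipL_add_right ξ)
      change κ ξ = _
      rw [map_sum]
      refine Finset.sum_congr rfl fun t ht => ?_
      change L2.ipL ξ (L2.single t _) = _
      rw [L2.ipL_single_right, h2 t ht]
    rw [← h4, ← L2.norm_sq_eq]
    have h5 := hbn ξ η
    rw [h1, ← h4, ← L2.norm_sq_eq] at h5
    refine pow_le_pow_left₀ (norm_nonneg _) ?_ 2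
    rcases (norm_nonneg ξ).eq_or_lt with h0 | h0
    · rw [← h0]; positivity
    · refine le_of_mul_le_mul_right ?_ h0
      calc ‖ξ‖ * ‖ξ‖ = ‖ξ‖ ^ 2 := (sq _).symm
        _ ≤ _ := h5
        _ = _ := by ring
  let T₀ : L2 M → L2 M := fun η => ⟨y η, _, hsum η⟩
  -- The identity holds coordinatewise, hence for truncations of ξ. Both sides follow the limit: the
  -- left by the definition of the inner product, the right by norm convergence of the functionals.
  have hT₀ : ∀ ξ η, L2.ipL ξ (T₀ η) = b ξ η := by
    intro ξ η
    refine (M.isPredual 1).ext fun φ hφ => ?_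
    have h1 := L2.tendsto_ipL_cut ξ (T₀ η) hφ
    refine tendsto_nhds_unique h1 ?_
    have h3 := tendsto_of_bounded_functional hC (fun F : Finset G => opFunctional_mem hφ (L2.cut F ξ) η)
      (opFunctional_mem hφ ξ η) (tendsto_opFunctional_cut hφ ξ η)
    rw [hb ξ η ⟨φ, hφ⟩] at h3
    refine h3.congr fun F => ?_
    refine (hb (L2.cut F ξ) η ⟨φ, hφ⟩).trans (congrArg φ ?_)
    rw [L2.ipL_cut, L2.cut_finset]
    let β : L2 M →+ M.fiber 1 := AddMonoidHom.mk' (fun ξ => b ξ η) fun ξ ξ' => hb_add_left ξ ξ' η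
    change β _ = _
    rw [map_sum]
    exact Finset.sum_congr rfl fun t _ => (hy η t _).symm
  have hext : ∀ ζ ζ' : L2 M, (∀ ξ, L2.ipL ξ ζ = L2.ipL ξ ζ') → ζ = ζ' := fun ζ ζ' h =>
    inner_left_ext (B := (M.fiber 1)ᵐᵒᵖ) fun ξ => congrArg MulOpposite.op (h ξ)
  let T : L2 M →L[ℂ] L2 M := LinearMap.mkContinuous
    { toFun := T₀
      map_add' := fun η η' => hext _ _ fun ξ => by
        rw [L2.ipL_add_right, hT₀, hT₀, hT₀, hb_add_right]
      map_smul' := fun c η => hext _ _ fun ξ => by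
        rw [RingHom.id_apply, L2.ipL_smul_right, hT₀, hT₀, hb_smul_right] } C
    fun η => L2.norm_le_of_sum (by positivity) (hsum η)
  exact ⟨T, fun φ hφ ξ η => (hb ξ η ⟨φ, hφ⟩).trans (congrArg φ (hT₀ ξ η).symm)⟩

theorem starDual_opFunctional (φ : StrongDual ℂ (M.fiber 1)) (ξ η : L2 M) :
    starDual (opFunctional φ ξ η) = opFunctional (starDual φ) η ξ := by
  ext T
  rw [starDual_apply, opFunctional_apply, opFunctional_apply, starDual_apply, ← ipL_star,
    L2.star_ipL]

variable (M) in
/-- `𝓛(ℓ²(M))` is a W*-algebra. -/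
theorem isPredual_opPredual : IsPredual (opPredual M) where
  isClosed := Submodule.isClosed_topologicalClosure _
  norm_le T C hC h := by
    refine ContinuousLinearMap.opNorm_le_bound _ hC fun η => ?_
    have h1 : ∀ ξ : L2 M, ‖L2.ipL ξ (T.1 η)‖ ≤ ‖ξ‖ * (C * ‖η‖) := fun ξ =>
      (M.isPredual 1).norm_le _ _ (by positivity) fun φ hφ => by
        refine (h _ (opFunctional_mem hφ ξ η)).trans ?_
        refine (mul_le_mul_of_nonneg_left (norm_opFunctional_le φ ξ η) hC).trans_eq ?_
        ring
    have h2 := h1 (T.1 η)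
    rw [← L2.norm_sq_eq, sq] at h2
    change ‖T.1 η‖ ≤ _
    rcases (norm_nonneg (T.1 η)).eq_or_lt with h0 | h0
    · rw [← h0]; positivity
    · exact le_of_mul_le_mul_left h2 h0
  surjective := by
    rintro Λ ⟨C, hC⟩
    have hC' : ∀ ω : opPredual M, ‖Λ ω‖ ≤ |C| * ‖(ω : StrongDual ℂ (Op M))‖ := fun ω =>
      (hC ω).trans (mul_le_mul_of_nonneg_right (le_abs_self C) (norm_nonneg _))
    -- The operator that implements `Λ` must have an adjoint. It is obtained as the operator that
    -- implements the conjugate functional ω ↦ conj Λ(ω*).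
    let Λ' : opPredual M →ₗ[ℂ] ℂ :=
      { toFun := fun ω => star (Λ ⟨starDual ω, (isAlgDual_opPredual M).star_mem _ ω.2⟩)
        map_add' := fun ω ω' => by
          rw [← star_add, ← map_add]
          congr 2
          refine Subtype.ext (ContinuousLinearMap.ext fun T => ?_)
          exact star_add _ _
        map_smul' := fun c ω => by
          have h : (⟨starDual ((c • ω : opPredual M) : StrongDual ℂ (Op M)),
              (isAlgDual_opPredual M).star_mem _ (c • ω).2⟩ : opPredual M) =
              star c • ⟨starDual ω, (isAlgDual_opPredual M).star_mem _ ω.2⟩ := by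
            refine Subtype.ext (ContinuousLinearMap.ext fun T => ?_)
            change star (c * _) = star c * star _
            exact star_mul' _ _
          rw [h, map_smul]
          change star (star c * _) = c * star _
          rw [star_mul', star_star] }
    obtain ⟨T, hT⟩ := exists_clm_of_functional Λ (abs_nonneg C) hC'
    obtain ⟨S, hS⟩ := exists_clm_of_functional Λ' (abs_nonneg C) fun ω => by
      change ‖star _‖ ≤ _
      rw [norm_star]
      exact (hC' _).trans (mul_le_mul_of_nonneg_left (norm_starDual_le _) (abs_nonneg C))
    have hTS : ∀ ξ η : L2 M, L2.ipL (T ξ) η = L2.ipL ξ (S η) := by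
      intro ξ η
      refine (M.isPredual 1).ext fun φ hφ => ?_
      rw [← hS φ hφ]
      change _ = star (Λ ⟨starDual (opFunctional φ ξ η), _⟩)
      have h1 := hT _ (M.isAlgDual.star_mem φ hφ) η ξ
      have h2 : Λ ⟨starDual (opFunctional φ ξ η),
          (isAlgDual_opPredual M).star_mem _ (opFunctional_mem hφ ξ η)⟩ =
          Λ ⟨opFunctional (starDual φ) η ξ, opFunctional_mem (M.isAlgDual.star_mem φ hφ) η ξ⟩ :=
        congrArg Λ (Subtype.ext (starDual_opFunctional φ ξ η))
      rw [h2, h1, starDual_apply, star_star, L2.star_ipL]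
    let T' : Op M := ⟨T, S, fun ξ η => congrArg MulOpposite.op (hTS ξ η)⟩
    refine ⟨T', fun ω => ?_⟩
    refine eq_of_eqOn_closed_span hC' (ContinuousLinearMap.apply ℂ ℂ T') ?_ ω
    rintro _ ⟨φ, hφ, ξ, η, rfl⟩
    exact hT φ hφ ξ η

/-! ### Kernels with one entry -/

theorem mul_eq_mul_right {u s r : G} (h : u * s = r) (t : G) : u * (s * t) = r * t := by
  rw [← _root_.mul_assoc, h]

/-- The image in `ℓ^∞(G, 𝓛(ℓ²(M)))` of the kernel whose only entry is `a`, at `(r, s)`. -/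
def entryKernel {u s r : G} (h : u * s = r) : M.fiber u →ₗ[ℂ] LInfOp M where
  toFun a := ⟨fun t => elemOp (mul_eq_mul_right h t) a, memℓp_infty ⟨‖a‖, by
    rintro _ ⟨t, rfl⟩
    exact norm_elemOp_le _ a⟩⟩
  map_add' a b := by
    ext t : 2
    exact map_add (elemOp (mul_eq_mul_right h t)) a b
  map_smul' c a := by
    ext t : 2
    exact map_smul (elemOp (mul_eq_mul_right h t)) c a

theorem entryKernel_apply {u s r : G} (h : u * s = r) (a : M.fiber u) (t : G) :
    entryKernel h a t = elemOp (mul_eq_mul_right h t) a := rfl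

theorem norm_entryKernel_le {u s r : G} (h : u * s = r) (a : M.fiber u) :
    ‖entryKernel h a‖ ≤ ‖a‖ :=
  lp.norm_le_of_forall_le (norm_nonneg a) fun _ => norm_elemOp_le _ a

theorem entryKernel_mul {u w uw q s r : G} (h : u * s = r) (h' : w * q = s) (h₁ : u * w = uw)
    (h₂ : uw * q = r) (a : M.fiber u) (b : M.fiber w) :
    entryKernel h a * entryKernel h' b = entryKernel h₂ (M.mul h₁ a b) := by
  ext t : 2
  exact elemOp_mul _ _ _ _ a b

theorem entryKernel_mul_of_ne {u w q s s' r : G} (h : u * s = r) (h' : w * q = s') (hs : s ≠ s')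
    (a : M.fiber u) (b : M.fiber w) : entryKernel h a * entryKernel h' b = 0 := by
  ext t : 2
  exact elemOp_mul_of_ne _ _ (fun e => hs (mul_right_cancel e)) a b

theorem star_entryKernel {u u' s r : G} (h : u * s = r) (hu : u⁻¹ = u') (h' : u' * r = s)
    (a : M.fiber u) : star (entryKernel h a) = entryKernel h' (M.adj hu a) := by
  ext t : 2
  exact star_elemOp _ hu _ a

open scoped Classical in
theorem kernelRep_single_eq (r s : G) (a : M.fiber (r * s⁻¹)) :
    kernelRep (DFinsupp.single (r, s) a : Kernel M) =
      entryKernel (inv_mul_cancel_right r s) a := by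
  ext t : 2
  exact kernelRep_single r s a t

theorem entryKernel_mem_kernelRange {u s r : G} (h : u * s = r) (a : M.fiber u) :
    entryKernel h a ∈ kernelRange M := by
  classical
  obtain rfl : u = r * s⁻¹ := eq_mul_inv_of_mul_eq h
  exact ⟨DFinsupp.single (r, s) a, kernelRep_single_eq r s a⟩

theorem kernelRange_induction {p : LInfOp M → Prop}
    (entry : ∀ {u s r : G} (h : u * s = r) (a : M.fiber u), p (entryKernel h a)) (zero : p 0)
    (add : ∀ f g, p f → p g → p (f + g)) {f : LInfOp M} (hf : f ∈ kernelRange M) : p f := by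
  classical
  obtain ⟨k, rfl⟩ := hf
  induction k using DFinsupp.induction with
  | h0 => rwa [map_zero]
  | ha q a k _ _ ih =>
    rw [map_add]
    exact add _ _ (kernelRep_single_eq q.1 q.2 a ▸ entry _ a) ih

theorem kernelRange_le : kernelRange M ≤ kernelAlg M := fun _ hf =>
  subset_wstarClosure _ (kernelRange M).toNonUnitalSubalgebra.toSubmodule hf

theorem entryKernel_mem {u s r : G} (h : u * s = r) (a : M.fiber u) :
    entryKernel h a ∈ kernelAlg M := kernelRange_le (entryKernel_mem_kernelRange h a)

variable (M) in
theorem isAlgDual_linfty : IsAlgDual (linftyPredual (G := G) (opPredual M)) :=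
  isAlgDual_linftyPredual (isAlgDual_opPredual M)

variable (M) in
theorem isPredual_linfty : IsPredual (linftyPredual (G := G) (opPredual M)) :=
  (isPredual_opPredual M).linfty

variable (M) in
theorem isClosed_kernelAlg :
    @IsClosed _ (wstarTopology (linftyPredual (opPredual M))) (kernelAlg M : Set (LInfOp M)) :=
  isClosed_wstarClosure _ (kernelRange M).toNonUnitalSubalgebra.toSubmodule

/-- Two weak-star continuous functionals which agree on the kernels with one entry agree on the
W*-algebra of kernels. -/
theorem eq_of_mem_kernelAlg {φ ψ : StrongDual ℂ (LInfOp M)} (hφ : φ ∈ linftyPredual (opPredual M))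
    (hψ : ψ ∈ linftyPredual (opPredual M))
    (h : ∀ {u s r : G} (h : u * s = r) (a : M.fiber u), φ (entryKernel h a) = ψ (entryKernel h a))
    {f : LInfOp M} (hf : f ∈ kernelAlg M) : φ f = ψ f := by
  refine eq_of_mem_wstarClosure hφ hψ (S := (kernelRange M).toNonUnitalSubalgebra.toSubmodule)
    (fun g hg => ?_) hf
  refine kernelRange_induction (p := fun g => φ g = ψ g) h ?_ ?_ hg
  · rw [map_zero, map_zero]
  · intro f g hf hg
    rw [map_add, map_add, hf, hg]

theorem commute_of_mem_kernelAlg {f : LInfOp M}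
    (h : ∀ {u s r : G} (h : u * s = r) (a : M.fiber u),
      entryKernel h a * f = f * entryKernel h a) {g : LInfOp M} (hg : g ∈ kernelAlg M) :
    g * f = f * g :=
  (isPredual_linfty M).ext fun φ hφ => eq_of_mem_kernelAlg
    ((isAlgDual_linfty M).mul_right_mem φ hφ f) ((isAlgDual_linfty M).mul_left_mem φ hφ f)
    (fun h' a => congrArg φ (h h' a)) hg

/-- By weak-star density f kills the whole W*-algebra of kernels from the left, in particular f*. -/
theorem eq_zero_of_mul_entryKernel {f : LInfOp M} (hf : f ∈ kernelAlg M)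
    (h : ∀ {u s r : G} (h : u * s = r) (a : M.fiber u), f * entryKernel h a = 0) : f = 0 := by
  rw [← CStarRing.mul_star_self_eq_zero_iff]
  refine (isPredual_linfty M).ext fun φ hφ => ?_
  rw [map_zero]
  refine eq_of_mem_kernelAlg (φ := φ.comp (ContinuousLinearMap.mul ℂ _ f)) (ψ := 0)
    ((isAlgDual_linfty M).mul_left_mem φ hφ f) (Submodule.zero_mem _) (fun h' a => ?_)
    (star_mem (s := kernelAlg M) hf)
  change φ (f * _) = 0
  rw [h, map_zero]

/-! ### The diagonal entries of an element of the W*-algebra of kernels -/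

/-- The diagonal entry of `f` at `(r, r)`. -/
def diagEntry (r : G) : LInfOp M →L[ℂ] M.fiber 1 :=
  LinearMap.mkContinuous
    -- The coordinate of `f` at t shows the (r,s) entry at position (r t, s t). With t = r⁻¹ the
    -- (r,r) entry appears at (1,1), where the unit of M_e is available as a vector.
    { toFun := fun f => L2.ipL (L2.single 1 M.unit) ((f r⁻¹).1 (L2.single 1 M.unit))
      map_add' := fun f g => L2.ipL_add_right _ _ _
      map_smul' := fun c f => L2.ipL_smul_right _ _ _ }
    (‖(L2.single 1 M.unit : L2 M)‖ * ‖(L2.single 1 M.unit : L2 M)‖) fun f => by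
      refine (L2.norm_ipL_le _ _).trans ?_
      rw [_root_.mul_assoc]
      refine mul_le_mul_of_nonneg_left ?_ (norm_nonneg _)
      refine (Adjointable.norm_apply_le (f r⁻¹) _).trans ?_
      rw [mul_comm]
      exact mul_le_mul_of_nonneg_left (lp.norm_apply_le_norm ENNReal.top_ne_zero f _)
        (norm_nonneg _)

theorem diagEntry_apply (r : G) (f : LInfOp M) :
    diagEntry r f = L2.ipL (L2.single 1 M.unit) ((f r⁻¹).1 (L2.single 1 M.unit)) := rfl

theorem comp_diagEntry_mem (r : G) {φ : StrongDual ℂ (M.fiber 1)} (hφ : φ ∈ M.predual 1) :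
    φ.comp (diagEntry r) ∈ linftyPredual (opPredual M) :=
  comp_eval_mem (opFunctional_mem hφ (L2.single 1 M.unit) (L2.single 1 M.unit)) r⁻¹

theorem L2.single_zero (r : G) : L2.single r (0 : M.fiber r) = 0 := by
  have := L2.single_smul r 0 (0 : M.fiber r)
  rwa [zero_smul, zero_smul] at this

theorem ip_unit (a : M.fiber 1) : ip M.unit (a : M.fiber 1) = a := by
  -- The index 1⁻¹ is generalized so that it can be replaced by 1 without transport of fibres.
  have key : ∀ (p : G) (h : 1⁻¹ = p) (h' : p * 1 = 1), M.mul h' (M.adj h M.unit) a = a := by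
    intro p h h'
    obtain rfl : p = 1 := by rw [← h, inv_one]
    exact (congrArg (· * a) star_unit).trans (unit_mul a)
  exact key _ _ _

theorem diagEntry_entryKernel_self (r : G) (a : M.fiber 1) :
    diagEntry r (entryKernel (one_mul r) a) = a := by
  rw [diagEntry_apply, entryKernel_apply]
  have key : ∀ (p : G) (hp : p = 1) (h : 1 * p = p), L2.ipL (L2.single 1 M.unit)
      ((elemOp h a).1 (L2.single 1 M.unit)) = a := by
    rintro _ rfl h
    rw [elemOp_apply, L2.ipL_single_left, L2.single_same, L2.single_same, ip_unit]
    exact mul_unit a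
  exact key _ (mul_inv_cancel r) _

theorem diagEntry_entryKernel_of_left_ne {u s r q : G} (h : u * s = r) (a : M.fiber u)
    (hr : r ≠ q) : diagEntry q (entryKernel h a) = 0 := by
  rw [diagEntry_apply, entryKernel_apply, elemOp_apply, L2.ipL_single_left, L2.single_of_ne,
    L2.ip_zero_right]
  exact fun e => hr (mul_inv_eq_one.1 e.symm)

theorem diagEntry_entryKernel_of_right_ne {u s r q : G} (h : u * s = r) (a : M.fiber u)
    (hs : s ≠ q) : diagEntry q (entryKernel h a) = 0 := by
  rw [diagEntry_apply, entryKernel_apply, elemOp_apply, L2.single_of_ne, mul_zero_fiber,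
    L2.single_zero, L2.ipL_single_left]
  · exact L2.ip_zero_right _
  · exact fun e => hs (mul_inv_eq_one.1 e)

/-- Multiplying the one-entry matrix of v = a − b by its adjoint produces v* v as a diagonal entry,
which `diagEntry` reads off. -/
theorem entryKernel_injective {u s r : G} (h : u * s = r) {a b : M.fiber u}
    (e : entryKernel h a = entryKernel h b) : a = b := by
  rw [← sub_eq_zero]
  have h0 : entryKernel h (a - b) = 0 := by rw [map_sub, e, sub_self]
  have h1 : entryKernel (show u⁻¹ * r = s by rw [← h, inv_mul_cancel_left]) (M.adj rfl (a - b)) *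
      entryKernel h (a - b) = entryKernel (one_mul s) (ip (a - b) (a - b)) :=
    entryKernel_mul _ _ _ _ _ _
  rw [h0, mul_zero] at h1
  have h2 := diagEntry_entryKernel_self s (ip (a - b) (a - b))
  rw [← h1, map_zero] at h2
  exact eq_zero_of_adj_self_mul rfl (inv_mul_cancel u) h2.symm

/-- The map which puts an element of the unit fibre in a diagonal entry is weak-star continuous. -/
theorem exists_comp_entryKernel (r : G) {φ : StrongDual ℂ (LInfOp M)}
    (hφ : φ ∈ linftyPredual (opPredual M)) :
    ∃ ψ ∈ M.predual 1, ∀ a : M.fiber 1, ψ a = φ (entryKernel (one_mul r) a) := by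
  let L : M.fiber 1 →L[ℂ] LInfOp M := (entryKernel (M := M) (one_mul r)).mkContinuous 1 fun a => by
    rw [one_mul]
    exact norm_entryKernel_le _ a
  have h1 : ∀ t : G, opPredual M ≤ (M.predual 1).comap
      (((ContinuousLinearMap.compL ℂ (M.fiber 1) (LInfOp M) ℂ).flip L).toLinearMap ∘ₗ
        ((ContinuousLinearMap.compL ℂ (LInfOp M) (Op M) ℂ).flip
          (lp.evalCLM ℂ (fun _ : G => Op M) ∞ t)).toLinearMap) := by
    intro t
    refine opPredual_le ((M.isPredual 1).isClosed.preimage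
      (((ContinuousLinearMap.compL ℂ (M.fiber 1) (LInfOp M) ℂ).flip L).continuous.comp
        ((ContinuousLinearMap.compL ℂ (LInfOp M) (Op M) ℂ).flip
          (lp.evalCLM ℂ (fun _ : G => Op M) ∞ t)).continuous)) fun φ hφ q x η => ?_
    -- Only the coefficient in row r t sees the entry; there the functional is a ↦ φ(x* a η(r t)).
    by_cases hq : q = r * t
    · subst hq
      have h2 := comp_mulRight_mem (one_mul (r * t)) (η (r * t))
        (comp_mulLeft_mem (inv_mul_cancel (r * t)) (M.adj rfl x) hφ)
      refine (congrArg (· ∈ M.predual 1) (ContinuousLinearMap.ext fun a => ?_)).mp h2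
      change φ (ip x (M.mul _ a (η (r * t)))) = φ (L2.ipL _ ((elemOp _ a).1 η))
      rw [L2.ipL_single_left, elemOp_apply, L2.single_same]
    · refine (congrArg (· ∈ M.predual 1) (ContinuousLinearMap.ext fun a => ?_)).mp
        (M.predual 1).zero_mem
      change 0 = φ (L2.ipL _ ((elemOp _ a).1 η))
      rw [L2.ipL_single_left, elemOp_apply, L2.single_of_ne hq, L2.ip_zero_right, map_zero]
  have h3 : linftyPredual (opPredual M) ≤ (M.predual 1).comap
      ((ContinuousLinearMap.compL ℂ (M.fiber 1) (LInfOp M) ℂ).flip L).toLinearMap :=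
    linftyPredual_le ((M.isPredual 1).isClosed.preimage
      ((ContinuousLinearMap.compL ℂ (M.fiber 1) (LInfOp M) ℂ).flip L).continuous)
      fun φ hφ t => h1 t hφ
  exact ⟨_, h3 hφ, fun a => rfl⟩

/-- Compression to a diagonal entry. -/
theorem entryKernel_unit_mul_mul (r : G) {f : LInfOp M} (hf : f ∈ kernelAlg M) :
    entryKernel (one_mul r) M.unit * f * entryKernel (one_mul r) M.unit =
      entryKernel (one_mul r) (diagEntry r f) := by
  refine (isPredual_linfty M).ext fun φ hφ => ?_
  obtain ⟨ψ, hψ, h⟩ := exists_comp_entryKernel r hφ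
  rw [← h]
  -- Both sides are weak-star continuous in `f`, so one-entry matrices suffice. They survive the
  -- compression only if both their row and their column are r.
  refine eq_of_mem_kernelAlg (φ := (φ.comp ((ContinuousLinearMap.mul ℂ _).flip
      (entryKernel (one_mul r) M.unit))).comp (ContinuousLinearMap.mul ℂ _
      (entryKernel (one_mul r) M.unit))) (ψ := ψ.comp (diagEntry r))
    ((isAlgDual_linfty M).mul_left_mem _ ((isAlgDual_linfty M).mul_right_mem φ hφ _) _)
    (comp_diagEntry_mem r hψ) (fun {u s q} h' a => ?_) hf
  change φ (_ * _ * _) = ψ (diagEntry r _)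
  rw [h]
  congr 1
  by_cases hq : q = r
  · by_cases hs : s = r
    · subst hs hq
      obtain rfl : u = 1 := mul_eq_right.1 h'
      rw [diagEntry_entryKernel_self, entryKernel_mul _ _ (one_mul 1) (one_mul _),
        entryKernel_mul _ _ (one_mul 1) (one_mul _)]
      congr 1
      exact (mul_unit _).trans (unit_mul a)
    · rw [diagEntry_entryKernel_of_right_ne _ _ hs, _root_.mul_assoc,
        entryKernel_mul_of_ne _ _ hs, mul_zero, map_zero]
  · rw [diagEntry_entryKernel_of_left_ne _ _ hq,
      entryKernel_mul_of_ne _ _ (Ne.symm hq), zero_mul, map_zero]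

theorem diagEntry_star (r : G) {f : LInfOp M} (hf : f ∈ kernelAlg M) :
    diagEntry r (star f) = star (diagEntry r f) := by
  have h0 : star (entryKernel (one_mul r) M.unit) = entryKernel (one_mul r) M.unit := by
    rw [star_entryKernel _ inv_one (one_mul r)]
    congr 1
    exact star_unit
  refine entryKernel_injective (one_mul r) ?_
  rw [← entryKernel_unit_mul_mul r (star_mem (s := kernelAlg M) hf)]
  change _ = entryKernel _ (M.adj inv_one _)
  rw [← star_entryKernel (one_mul r) inv_one (one_mul r), ← entryKernel_unit_mul_mul r hf,
    star_mul, star_mul, h0, _root_.mul_assoc]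

/-! ### The centre of the W*-algebra of kernels -/

theorem entryKernel_mul_kernelCentre (f : M.kernelCentre) {u s r : G} (h : u * s = r)
    (a : M.fiber u) : entryKernel h a * f.1.1 = f.1.1 * entryKernel h a :=
  congrArg Subtype.val (Semigroup.mem_center_iff.1 f.2 ⟨entryKernel h a, entryKernel_mem h a⟩)

theorem mem_kernelCentre {f : kernelAlg M}
    (h : ∀ {u s r : G} (h : u * s = r) (a : M.fiber u),
      entryKernel h a * f.1 = f.1 * entryKernel h a) : f ∈ M.kernelCentre :=
  Semigroup.mem_center_iff.2 fun g => Subtype.ext (commute_of_mem_kernelAlg h g.2)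

/-- With p the unit of M_e placed at (r,r), centrality gives f p = p f p, which is the diagonal
entry of f at r. The given matrix is unchanged by p on its left. -/
theorem kernelCentre_mul_entryKernel (f : M.kernelCentre) {u s r : G} (h : u * s = r)
    (a : M.fiber u) : f.1.1 * entryKernel h a =
      entryKernel h (M.mul (one_mul u) (diagEntry r f.1.1) a) := by
  have h1 : entryKernel h a = entryKernel (one_mul r) M.unit * entryKernel h a := by
    rw [entryKernel_mul (one_mul r) h (one_mul u) h, unit_mul_fiber]
  rw [← entryKernel_mul (one_mul r) h (one_mul u) h, ← entryKernel_unit_mul_mul r f.1.2,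
    _root_.mul_assoc, ← h1, entryKernel_mul_kernelCentre, _root_.mul_assoc, ← h1]

theorem entryKernel_mul_kernelCentre' (f : M.kernelCentre) {u s r : G} (h : u * s = r)
    (a : M.fiber u) : entryKernel h a * f.1.1 =
      entryKernel h (M.mul (mul_one u) a (diagEntry s f.1.1)) := by
  have h1 : entryKernel h a = entryKernel h a * entryKernel (one_mul s) M.unit := by
    rw [entryKernel_mul h (one_mul s) (mul_one u) h, mul_unit_fiber]
  rw [← entryKernel_mul h (one_mul s) (mul_one u) h, ← entryKernel_unit_mul_mul s f.1.2,
    _root_.mul_assoc, ← entryKernel_mul_kernelCentre f (one_mul s), ← _root_.mul_assoc, ← h1,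
    ← _root_.mul_assoc, ← h1]

/-- The two sides are the entries of f k and k f, where k is the matrix whose only entry is a, at
(r,s). -/
theorem diagEntry_mul_comm (f : M.kernelCentre) {u s r : G} (h : u * s = r) (a : M.fiber u) :
    M.mul (one_mul u) (diagEntry r f.1.1) a = M.mul (mul_one u) a (diagEntry s f.1.1) :=
  entryKernel_injective h (by
    rw [← kernelCentre_mul_entryKernel, ← entryKernel_mul_kernelCentre',
      entryKernel_mul_kernelCentre])

theorem diagEntry_mem_centre (r : G) (f : M.kernelCentre) : diagEntry r f.1.1 ∈ M.centre :=
  mem_centre_iff.2 fun a => (diagEntry_mul_comm f (one_mul r) a).symm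

/-- Compression to a corner is not multiplicative in general; centrality of the second factor lets
it pass through the projection. -/
theorem diagEntry_mul (r : G) {g : LInfOp M} (hg : g ∈ kernelAlg M) (f : M.kernelCentre) :
    diagEntry r (g * f.1.1) = diagEntry r g * diagEntry r f.1.1 := by
  refine entryKernel_injective (one_mul r) ?_
  rw [← entryKernel_unit_mul_mul r (mul_mem hg f.1.2)]
  refine Eq.trans ?_ (entryKernel_mul_kernelCentre' f (one_mul r) (diagEntry r g))
  rw [← entryKernel_unit_mul_mul r hg]
  simp only [_root_.mul_assoc, entryKernel_mul_kernelCentre f]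

/-- The products of a central element with the one-entry matrices involve only its diagonal, and
these products determine it. -/
theorem kernelCentre_ext {f g : M.kernelCentre}
    (h : ∀ r, diagEntry r f.1.1 = diagEntry r g.1.1) : f = g := by
  refine Subtype.ext (Subtype.ext ?_)
  rw [← sub_eq_zero]
  refine eq_zero_of_mul_entryKernel (sub_mem f.1.2 g.1.2) fun {u s r} h' a => ?_
  rw [_root_.sub_mul, kernelCentre_mul_entryKernel, kernelCentre_mul_entryKernel, h, sub_self]

/-- The diagonal entries of the central elements, as a *-homomorphism. -/
def diagHom (r : G) : M.kernelCentre →⋆ₙₐ[ℂ] M.centre where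
  toFun f := ⟨diagEntry r f.1.1, diagEntry_mem_centre r f⟩
  map_smul' c f := Subtype.ext (map_smul (diagEntry r) c f.1.1)
  map_zero' := Subtype.ext (map_zero (diagEntry r))
  map_add' f g := Subtype.ext (map_add (diagEntry r) f.1.1 g.1.1)
  map_mul' f g := Subtype.ext (diagEntry_mul r f.1.2 g)
  map_star' f := Subtype.ext (diagEntry_star r f.1.2)

/-- The commutation relation between positions r and 1 is the defining property of σ_r(f_1). Without
membership in I_r the entry f_r is not determined by f_1. -/
theorem diagEntry_eq_centralFun {r : G} {f : M.kernelCentre} (h : diagEntry r f.1.1 ∈ fiberIdeal M r) :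
    diagEntry r f.1.1 = centralFun r (diagHom 1 f) :=
  eq_centralFun h fun x => diagEntry_mul_comm f (mul_one r) x

/-! ### Central elements with prescribed entries -/

/-- The diagonal kernel with the entries `σ_r(z)`, `r ∈ F`. -/
def diagKernel (F : Finset G) : M.centre →⋆ₙₐ[ℂ] LInfOp M where
  toFun z := ∑ r ∈ F, entryKernel (one_mul r) (centralHom r z : M.fiber 1)
  map_smul' c z := by
    rw [MonoidHom.id_apply, Finset.smul_sum]
    exact Finset.sum_congr rfl fun r _ => by
      rw [map_smul (centralHom r), ← map_smul (entryKernel (one_mul r))]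
      rfl
  map_zero' := Finset.sum_eq_zero fun r _ => by
    rw [map_zero (centralHom r)]
    exact map_zero (entryKernel (one_mul r))
  map_add' z w := by
    rw [← Finset.sum_add_distrib]
    exact Finset.sum_congr rfl fun r _ => by
      rw [map_add (centralHom r), ← map_add (entryKernel (one_mul r))]
      rfl
  map_mul' z w := by
    rw [Finset.sum_mul]
    refine Finset.sum_congr rfl fun r hr => ?_
    rw [Finset.mul_sum, Finset.sum_eq_single_of_mem r hr fun s _ hs =>
      entryKernel_mul_of_ne _ _ hs.symm _ _, entryKernel_mul _ _ (one_mul 1) (one_mul r),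
      map_mul (centralHom r)]
    rfl
  map_star' z := by
    rw [star_sum]
    refine Finset.sum_congr rfl fun r _ => ?_
    rw [star_entryKernel _ inv_one (one_mul r), map_star (centralHom r)]
    rfl

theorem diagKernel_apply (F : Finset G) (z : M.centre) :
    diagKernel F z = ∑ r ∈ F, entryKernel (one_mul r) (centralFun r z) := rfl

/-- Contractivity of *-homomorphisms makes the bound uniform in F, as needed for weak-star
compactness. -/
theorem norm_diagKernel_le (F : Finset G) (z : M.centre) : ‖diagKernel F z‖ ≤ ‖z‖ :=
  NonUnitalStarAlgHom.norm_apply_le (diagKernel F) z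

theorem diagKernel_mul_entryKernel {F : Finset G} (z : M.centre) {u s r : G} (h : u * s = r)
    (a : M.fiber u) (hr : r ∈ F) : diagKernel F z * entryKernel h a =
      entryKernel h (M.mul (one_mul u) (centralFun r z) a) := by
  rw [diagKernel_apply, Finset.sum_mul, Finset.sum_eq_single_of_mem r hr fun q _ hq =>
    entryKernel_mul_of_ne _ _ hq _ _]
  exact entryKernel_mul _ _ _ _ _ _

theorem entryKernel_mul_diagKernel {F : Finset G} (z : M.centre) {u s r : G} (h : u * s = r)
    (a : M.fiber u) (hs : s ∈ F) : entryKernel h a * diagKernel F z =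
      entryKernel h (M.mul (mul_one u) a (centralFun s z)) := by
  rw [diagKernel_apply, Finset.mul_sum, Finset.sum_eq_single_of_mem s hs fun q _ hq =>
    entryKernel_mul_of_ne _ _ hq.symm _ _]
  exact entryKernel_mul _ _ _ _ _ _

/-- A weak-star limit point of the finite diagonal matrices with entries σ_r(z), r ∈ F. It commutes
with the one-entry matrices by `centralFun_mul_comm`. -/
theorem exists_kernelCentre (z : M.centre) :
    ∃ f : M.kernelCentre, ‖f.1.1‖ ≤ ‖z‖ ∧ ∀ r, diagEntry r f.1.1 = centralFun r z := by
  obtain ⟨U, hU⟩ := Ultrafilter.exists_le (Filter.atTop : Filter (Finset G))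
  obtain ⟨f, hf⟩ := (isPredual_linfty M).exists_ultrafilter_limit U
    (f := fun F : Finset G => diagKernel F z) (fun F => norm_diagKernel_le F z)
  have hev : ∀ r : G, ∀ᶠ F in (U : Filter (Finset G)), r ∈ F := fun r =>
    ((Filter.eventually_ge_atTop {r}).filter_mono hU).mono fun F hF => Finset.singleton_subset_iff.1 hF
  have h1 : ∀ {u s r : G} (h : u * s = r) (a : M.fiber u),
      f * entryKernel h a = entryKernel h (M.mul (one_mul u) (centralFun r z) a) := by
    intro u s r h a
    refine (isPredual_linfty M).ext fun φ hφ => ?_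
    -- The product with a one-entry matrix no longer depends on F once r ∈ F.
    refine tendsto_nhds_unique (hf _ ((isAlgDual_linfty M).mul_right_mem φ hφ (entryKernel h a))) ?_
    refine tendsto_const_nhds.congr' ((hev r).mono fun F hF => ?_)
    exact congrArg φ (diagKernel_mul_entryKernel z h a hF).symm
  have h2 : ∀ {u s r : G} (h : u * s = r) (a : M.fiber u),
      entryKernel h a * f = entryKernel h (M.mul (mul_one u) a (centralFun s z)) := by
    intro u s r h a
    refine (isPredual_linfty M).ext fun φ hφ => ?_
    refine tendsto_nhds_unique (hf _ ((isAlgDual_linfty M).mul_left_mem φ hφ (entryKernel h a))) ?_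
    refine tendsto_const_nhds.congr' ((hev s).mono fun F hF => ?_)
    exact congrArg φ (entryKernel_mul_diagKernel z h a hF).symm
  have hfm : f ∈ kernelAlg M := mem_of_tendsto_wstar (isClosed_kernelAlg M)
    (Filter.Eventually.of_forall fun F => sum_mem fun r _ => entryKernel_mem _ _) hf
  have hfn : ‖f‖ ≤ ‖z‖ := (isPredual_linfty M).norm_le_of_tendsto (norm_nonneg z)
    (Filter.Eventually.of_forall fun F => norm_diagKernel_le F z) hf
  refine ⟨⟨⟨f, hfm⟩, mem_kernelCentre fun h a => ?_⟩, hfn, fun r => ?_⟩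
  · rw [h1, h2, centralFun_mul_comm h]
  · refine entryKernel_injective (one_mul r) ?_
    rw [← entryKernel_unit_mul_mul r hfm, _root_.mul_assoc, h1,
      entryKernel_mul _ _ (one_mul 1) (one_mul r)]
    congr 1
    exact (unit_mul _).trans (mul_unit _)

/-! ### Translation -/

/-- The translations of `ℓ^∞(G, 𝓛(ℓ²(M)))`. -/
def translateHom (t : G) : LInfOp M →⋆ₙₐ[ℂ] LInfOp M where
  toFun := translateFun t
  map_smul' _ _ := rfl
  map_zero' := rfl
  map_add' _ _ := rfl
  map_mul' _ _ := rfl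
  map_star' _ := rfl

theorem translateHom_translateHom (s t : G) (f : LInfOp M) :
    translateHom s (translateHom t f) = translateHom (s * t) f := by
  ext r : 2
  change f (t⁻¹ * (s⁻¹ * r)) = f ((s * t)⁻¹ * r)
  rw [mul_inv_rev, _root_.mul_assoc]

theorem translateHom_one (f : LInfOp M) : translateHom 1 f = f := by
  ext r : 2
  change f (1⁻¹ * r) = f r
  rw [inv_one, one_mul]

theorem elemOp_congr {u s r s' r' : G} (hs : s = s') (hr : r = r') (h : u * s = r)
    (h' : u * s' = r') (a : M.fiber u) : elemOp h a = elemOp h' a := by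
  subst hs hr
  rfl

theorem translateHom_entryKernel (t : G) {u s r : G} (h : u * s = r) (a : M.fiber u) :
    translateHom t (entryKernel h a) = entryKernel (mul_eq_mul_right h t⁻¹) a := by
  ext q : 2
  exact elemOp_congr (_root_.mul_assoc _ _ _).symm (_root_.mul_assoc _ _ _).symm _ _ a

/-- The translations, as bounded linear maps. -/
def translateCLM (t : G) : LInfOp M →L[ℂ] LInfOp M :=
  LinearMap.mkContinuous ⟨⟨translateHom t, map_add _⟩, map_smul _⟩ 1 fun f => by
    rw [one_mul]
    exact NonUnitalStarAlgHom.norm_apply_le (translateHom t) f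

theorem translateCLM_apply (t : G) (f : LInfOp M) : translateCLM t f = translateHom t f := rfl

theorem comp_translateCLM_mem (t : G) {φ : StrongDual ℂ (LInfOp M)}
    (hφ : φ ∈ linftyPredual (opPredual M)) :
    φ.comp (translateCLM t) ∈ linftyPredual (opPredual M) := by
  let L := (ContinuousLinearMap.compL ℂ (LInfOp M) (LInfOp M) ℂ).flip (translateCLM t)
  have h : linftyPredual (opPredual M) ≤ (linftyPredual (opPredual M)).comap L.toLinearMap := by
    refine linftyPredual_le ((isPredual_linfty M).isClosed.preimage L.continuous)
      fun φ hφ s => ?_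
    have e : φ.comp (lp.evalCLM ℂ (fun _ : G => Op M) ∞ (t⁻¹ * s)) =
        (φ.comp (lp.evalCLM ℂ (fun _ : G => Op M) ∞ s)).comp (translateCLM t) :=
      ContinuousLinearMap.ext fun f => by
        rw [ContinuousLinearMap.comp_apply, ContinuousLinearMap.comp_apply,
          ContinuousLinearMap.comp_apply, translateCLM_apply]
        congr 1
    have e' := comp_eval_mem hφ (t⁻¹ * s)
    rw [e] at e'
    exact e'
  exact h hφ

theorem translateHom_mem (t : G) {f : LInfOp M} (hf : f ∈ kernelAlg M) :
    translateHom t f ∈ kernelAlg M := by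
  refine wstarClosure_map_mem (f := translateHom t)
    (fun φ hφ => continuous_wstar (comp_translateCLM_mem t hφ)) (fun g hg => ?_) hf
  refine kernelRange_induction (p := fun g => translateHom t g ∈ kernelAlg M) (fun h a => ?_) ?_ ?_ hg
  · rw [translateHom_entryKernel]
    exact entryKernel_mem _ _
  · rw [map_zero]
    exact zero_mem _
  · intro f g hf hg
    rw [map_add]
    exact add_mem hf hg

/-- The translations of the centre of the W*-algebra of kernels. -/
def translateCentre (t : G) : M.kernelCentre →⋆ₙₐ[ℂ] M.kernelCentre where
  toFun f := ⟨⟨translateHom t f.1.1, translateHom_mem t f.1.2⟩,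
    Semigroup.mem_center_iff.2 fun g => Subtype.ext (by
      have h := congrArg (fun x : kernelAlg M => translateHom t x.1) (Semigroup.mem_center_iff.1 f.2
        ⟨translateHom t⁻¹ g.1, translateHom_mem t⁻¹ g.2⟩)
      change translateHom t (translateHom t⁻¹ g.1 * f.1.1) =
        translateHom t (f.1.1 * translateHom t⁻¹ g.1) at h
      rw [map_mul, map_mul, translateHom_translateHom, mul_inv_cancel, translateHom_one] at h
      exact h)⟩
  map_smul' _ _ := rfl
  map_zero' := rfl
  map_add' _ _ := rfl
  map_mul' _ _ := rfl
  map_star' _ := rfl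

theorem translateCentre_translateCentre (s t : G) (f : M.kernelCentre) :
    translateCentre s (translateCentre t f) = translateCentre (s * t) f :=
  Subtype.ext (Subtype.ext (translateHom_translateHom s t f.1.1))

theorem translateCentre_one (f : M.kernelCentre) : translateCentre 1 f = f :=
  Subtype.ext (Subtype.ext (translateHom_one f.1.1))

/-- Coordinate r⁻¹ of the translate is coordinate t⁻¹ r⁻¹ = (r t)⁻¹ of f. -/
theorem diagEntry_translateHom (r t : G) (f : LInfOp M) :
    diagEntry r (translateHom t f) = diagEntry (r * t) f := by
  rw [diagEntry_apply, diagEntry_apply, mul_inv_rev]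
  rfl

end WStarFellBundle

/-! ### A criterion for enveloping actions -/

section EnvelopingCriterion

variable {G A N : Type*} [Group G] [NonUnitalCStarAlgebra A] [NonUnitalCStarAlgebra N]
  {P : Submodule ℂ (StrongDual ℂ A)} {Q : Submodule ℂ (StrongDual ℂ N)}
  {γ : PartialAction G A} {δ : PartialAction G N}

/-- A global W*-action `δ` on `N`, given by the *-endomorphisms `τ_t`, together with a separating
family of *-homomorphisms `κ_r : N → A`, related to a W*-partial action `γ` on `A`, whose maps
are restrictions of `σ_t : A → A`, and a section `e : A → N` with `κ_r ∘ e = σ_r`. -/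
structure EnvelopingData (P : Submodule ℂ (StrongDual ℂ A)) (γ : PartialAction G A)
    (Q : Submodule ℂ (StrongDual ℂ N)) (δ : PartialAction G N) where
  isPredual_left : IsPredual P
  isAlgDual_left : IsAlgDual P
  isWStarPartialAction_left : IsWStarPartialAction P γ
  isPredual_right : IsPredual Q
  isAlgDual_right : IsAlgDual Q
  σ : G → A → A
  map_left : ∀ t (z : γ.dom t⁻¹), (γ.map t z : A) = σ t z
  σ_mem : ∀ t z, σ t z ∈ γ.dom t
  σ_one : ∀ z, σ 1 z = z
  σ_mul_inv_mem : ∀ r t z, z ∈ γ.dom t → σ (r * t⁻¹) z ∈ γ.dom r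
  τ : G → N →⋆ₙₐ[ℂ] N
  dom_right : ∀ t, δ.dom t = Set.univ
  map_right : ∀ t (f : δ.dom t⁻¹), (δ.map t f : N) = τ t f
  τ_one : ∀ f, τ 1 f = f
  τ_τ : ∀ s t f, τ s (τ t f) = τ (s * t) f
  comp_τ_mem : ∀ t, ∀ φ ∈ Q, ∃ ψ ∈ Q, ∀ f, φ (τ t f) = ψ f
  κ : G → N →⋆ₙₐ[ℂ] A
  κ_τ : ∀ r t f, κ r (τ t f) = κ (r * t) f
  κ_ext : ∀ f g, (∀ r, κ r f = κ r g) → f = g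
  comp_κ_mem : ∀ r, ∀ φ ∈ P, ∃ ψ ∈ Q, ∀ f, φ (κ r f) = ψ f
  κ_eq : ∀ r f, κ r f ∈ γ.dom r → κ r f = σ r (κ 1 f)
  e : A → N
  κ_e : ∀ r z, κ r (e z) = σ r z
  comp_e_mem : ∀ φ ∈ Q, ∃ ψ ∈ P, ∀ z, φ (e z) = ψ z

namespace EnvelopingData

variable (D : EnvelopingData P γ Q δ)

theorem isWStarPartialAction_right (D : EnvelopingData P γ Q δ) : IsWStarPartialAction Q δ where
  isWStarIdeal t := by
    rw [D.dom_right]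
    exact
      { zero_mem := trivial
        add_mem := fun _ _ _ _ => trivial
        smul_mem := fun _ _ _ => trivial
        mul_left_mem := fun _ _ _ => trivial
        mul_right_mem := fun _ _ _ => trivial
        star_mem := fun _ _ => trivial
        isClosed := @isClosed_univ _ (wstarTopology _) }
  map_add t x y z h := by
    simp only [D.map_right, h, map_add]
  map_smul t c x z h := by
    simp only [D.map_right, h, map_smul]
  map_mul t x y z h := by
    simp only [D.map_right, h, map_mul]
  map_star t x z h := by
    simp only [D.map_right, h, map_star]
  continuous_map t := by
    refine continuous_wstarTopologyOn fun φ hφ => ?_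
    obtain ⟨ψ, hψ, h⟩ := D.comp_τ_mem t φ hφ
    exact ⟨ψ, hψ, fun f => by rw [D.map_right, h]⟩

/-- The elements `f` of `N` such that `κ_r(f)` belongs to the domain at `r`, for all `r`. -/
def ideal : NonUnitalStarSubalgebra ℂ N where
  carrier := {f | ∀ r, D.κ r f ∈ γ.dom r}
  zero_mem' r := by
    rw [map_zero]
    exact (D.isWStarPartialAction_left.isWStarIdeal r).zero_mem
  add_mem' ha hb r := by
    rw [map_add]
    exact (D.isWStarPartialAction_left.isWStarIdeal r).add_mem _ (ha r) _ (hb r)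
  smul_mem' c f hf r := by
    rw [map_smul]
    exact (D.isWStarPartialAction_left.isWStarIdeal r).smul_mem c _ (hf r)
  mul_mem' {f g} hf hg r := by
    rw [map_mul]
    exact (D.isWStarPartialAction_left.isWStarIdeal r).mul_left_mem _ _ (hg r)
  star_mem' {f} hf r := by
    rw [map_star]
    exact (D.isWStarPartialAction_left.isWStarIdeal r).star_mem _ (hf r)

theorem isWStarIdeal_ideal : IsWStarIdeal Q (D.ideal : Set N) where
  zero_mem := zero_mem D.ideal
  add_mem _ ha _ hb := add_mem (S := NonUnitalStarSubalgebra ℂ N) ha hb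
  smul_mem c _ ha := D.ideal.smul_mem' c ha
  mul_left_mem b f hf r := by
    rw [map_mul]
    exact (D.isWStarPartialAction_left.isWStarIdeal r).mul_left_mem _ _ (hf r)
  mul_right_mem b f hf r := by
    rw [map_mul]
    exact (D.isWStarPartialAction_left.isWStarIdeal r).mul_right_mem _ _ (hf r)
  star_mem _ ha := D.ideal.star_mem' ha
  isClosed := by
    have : (D.ideal : Set N) = ⋂ r : G, D.κ r ⁻¹' γ.dom r := by
      ext f
      simp only [Set.mem_iInter]
      rfl
    rw [this]
    exact @isClosed_iInter _ _ (wstarTopology _) _ fun r =>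
      @IsClosed.preimage _ _ (wstarTopology _) (wstarTopology _) _
        (continuous_wstar_wstar fun φ hφ => D.comp_κ_mem r φ hφ) _
        (D.isWStarPartialAction_left.isWStarIdeal r).isClosed

/-- The restriction of `κ_1` to the ideal. -/
def idealHom : D.ideal →⋆ₙₐ[ℂ] A := (D.κ 1).comp (NonUnitalStarSubalgebraClass.subtype D.ideal)

theorem idealHom_apply (f : D.ideal) : D.idealHom f = D.κ 1 f := rfl

theorem e_mem (z : A) : D.e z ∈ D.ideal := fun r => by
  rw [D.κ_e]
  exact D.σ_mem r z

/-- On the ideal all κ_r(f) = σ_r(κ_1(f)) are determined by κ_1(f), and the κ_r separate points. The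
section e gives surjectivity. -/
theorem bijective_idealHom : Function.Bijective D.idealHom := by
  constructor
  · intro f g h
    refine Subtype.ext (D.κ_ext _ _ fun r => ?_)
    rw [D.κ_eq r _ (f.2 r), D.κ_eq r _ (g.2 r)]
    exact congrArg (D.σ r) h
  · exact fun z => ⟨⟨D.e z, D.e_mem z⟩, (D.κ_e 1 z).trans (D.σ_one z)⟩

/-- The isomorphism of `A` with the ideal. -/
def equiv : A ≃⋆ₐ[ℂ] D.ideal := (StarAlgEquiv.ofBijective D.idealHom D.bijective_idealHom).symm

theorem equiv_symm_apply (f : D.ideal) : D.equiv.symm f = D.κ 1 f := rfl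

theorem coe_equiv (z : A) : (D.equiv z : N) = D.e z := by
  have : D.equiv z = ⟨D.e z, D.e_mem z⟩ := D.bijective_idealHom.1 (by
    refine (D.equiv.symm_apply_apply z).trans ?_
    exact ((D.κ_e 1 z).trans (D.σ_one z)).symm)
  rw [this]

theorem continuous_equiv :
    Continuous[wstarTopology P, wstarTopologyOn Q (D.ideal : Set N)] D.equiv := by
  refine (continuous_induced_rng (t₁ := wstarTopology P) (t₂ := wstarTopology Q)).2 ?_
  refine continuous_wstar_wstar fun φ hφ => ?_
  obtain ⟨ψ, hψ, h⟩ := D.comp_e_mem φ hφ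
  exact ⟨ψ, hψ, fun z => (congrArg φ (D.coe_equiv z)).trans (h z)⟩

theorem continuous_equiv_symm :
    Continuous[wstarTopologyOn Q (D.ideal : Set N), wstarTopology P] D.equiv.symm :=
  continuous_induced_wstar fun φ hφ => by
    obtain ⟨ψ, hψ, h⟩ := D.comp_κ_mem 1 φ hφ
    exact ⟨ψ, hψ, fun f => h f⟩

/-- As δ is global, the restricted domain at t is the intersection of the ideal with its translate
by t. -/
theorem mem_restrict_dom {t : G} {f : D.ideal} :
    f ∈ (δ.restrict D.ideal).dom t ↔ D.τ t⁻¹ f.1 ∈ D.ideal := by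
  constructor
  · rintro ⟨g, hg, e⟩
    rw [← e, D.map_right, D.τ_τ, inv_mul_cancel, D.τ_one]
    exact hg
  · intro h
    refine ⟨⟨D.τ t⁻¹ f.1, by rw [D.dom_right]; trivial⟩, h, ?_⟩
    rw [D.map_right, D.τ_τ, mul_inv_cancel, D.τ_one]

theorem coe_restrict_map (t : G) (f : (δ.restrict D.ideal).dom t⁻¹) :
    (((δ.restrict D.ideal).map t f : D.ideal) : N) = D.τ t f.1.1 :=
  D.map_right t _

/-- For z in the domain at t, κ_r of the translate of e(z) by t⁻¹ is σ_{rt⁻¹}(z), which lies in the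
domain at r. Equivariance need only be tested under κ_1, where translation by t turns into κ_t. -/
theorem isMorphism_equiv : γ.IsMorphism (δ.restrict D.ideal) D.equiv := by
  refine ⟨fun t z hz => D.mem_restrict_dom.2 fun r => ?_, fun t z h => D.bijective_idealHom.1 ?_⟩
  · rw [D.κ_τ, D.coe_equiv, D.κ_e]
    exact D.σ_mul_inv_mem r t z hz
  · rw [idealHom_apply, idealHom_apply, coe_restrict_map, D.κ_τ, D.coe_equiv, D.coe_equiv,
      D.κ_e, D.κ_e, one_mul, D.σ_one, D.map_left]

theorem isMorphism_equiv_symm : (δ.restrict D.ideal).IsMorphism γ D.equiv.symm := by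
  refine ⟨fun t f hf => ?_, fun t f h => ?_⟩
  · have h := D.mem_restrict_dom.1 hf t
    rw [D.κ_τ, mul_inv_cancel] at h
    exact h
  · rw [equiv_symm_apply, coe_restrict_map, D.κ_τ, one_mul, D.map_left]
    exact D.κ_eq t _ (f.1.2 t)

/-- The union of the translates of the ideal. -/
def orbit : Set N := {y | ∃ (t : G) (x : δ.dom t⁻¹), (x : N) ∈ D.ideal ∧ y = δ.map t x}

theorem τ_mem_orbit (t : G) {f : N} (hf : f ∈ D.ideal) : D.τ t f ∈ D.orbit :=
  ⟨t, ⟨f, by rw [D.dom_right]; trivial⟩, hf, (D.map_right t ⟨f, _⟩).symm⟩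

theorem mul_mem_orbit (g : N) {f : N} (hf : f ∈ D.orbit) : g * f ∈ D.orbit := by
  obtain ⟨t, x, hx, rfl⟩ := hf
  have h := D.τ_mem_orbit t (D.isWStarIdeal_ideal.mul_left_mem (D.τ t⁻¹ g) _ hx)
  rwa [map_mul, D.τ_τ, mul_inv_cancel, D.τ_one, ← D.map_right] at h

theorem star_mem_orbit {f : N} (hf : f ∈ D.orbit) : star f ∈ D.orbit := by
  obtain ⟨t, x, hx, rfl⟩ := hf
  have h := D.τ_mem_orbit t (star_mem (s := D.ideal) hx)
  rwa [map_star, ← D.map_right] at h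

theorem mul_mem_span_orbit (g : N) {f : N} (hf : f ∈ Submodule.span ℂ D.orbit) :
    g * f ∈ Submodule.span ℂ D.orbit := by
  have h : Submodule.span ℂ D.orbit ≤ (Submodule.span ℂ D.orbit).comap (LinearMap.mulLeft ℂ g) :=
    Submodule.span_le.2 fun f hf => Submodule.subset_span (D.mul_mem_orbit g hf)
  exact h hf

/-- The span of the translates of the ideal. -/
def orbitAlg : NonUnitalStarSubalgebra ℂ N :=
  { Submodule.span ℂ D.orbit with
    mul_mem' := fun {_ _} _ hb => D.mul_mem_span_orbit _ hb
    star_mem' := fun {a} ha => by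
      change a ∈ Submodule.span ℂ D.orbit at ha
      change star a ∈ Submodule.span ℂ D.orbit
      induction ha using Submodule.span_induction with
      | mem x hx => exact Submodule.subset_span (D.star_mem_orbit hx)
      | zero => rw [star_zero]; exact Submodule.zero_mem _
      | add x y _ _ hx hy => rw [star_add]; exact Submodule.add_mem _ hx hy
      | smul c x _ hx => rw [star_smul]; exact Submodule.smul_mem _ _ hx }

/-- The closure W is a W*-algebra and so has a unit w. For each r it contains the translate of e(u)
by r⁻¹, u the unit of A, and κ_r sends this translate to u. Hence κ_r(w) = u for every r, so f = f w
for all f. Finally f w lies in W, because the span of the translates absorbs left multiplication. -/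
theorem wstarClosure_span_orbit : wstarClosure Q (Submodule.span ℂ D.orbit) = ⊤ := by
  let W := wstarClosureAlg D.isAlgDual_right D.orbitAlg
  have hW : ∀ f, f ∈ W ↔ f ∈ wstarClosure Q (Submodule.span ℂ D.orbit) := fun f => Iff.rfl
  have hWc : @IsClosed _ (wstarTopology Q) (W : Set N) :=
    isClosed_wstarClosure _ (Submodule.span ℂ D.orbit)
  obtain ⟨w, hw, -⟩ := (D.isPredual_right.restrict hWc).exists_unit (D.isAlgDual_right.restrict W)
  obtain ⟨u, -, hu⟩ := D.isPredual_left.exists_unit D.isAlgDual_left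
  have hunit : ∀ r, D.κ r w = u := by
    intro r
    have hp : D.τ r⁻¹ (D.e u) ∈ W := (hW _).2 (subset_wstarClosure _ _ (Submodule.subset_span
      (D.τ_mem_orbit r⁻¹ (D.e_mem u))))
    have h1 := congrArg (fun f : W => D.κ r f) (hw ⟨_, hp⟩)
    have h2 : D.κ r (D.τ r⁻¹ (D.e u)) = u := by
      rw [D.κ_τ, mul_inv_cancel, D.κ_e, D.σ_one]
    change D.κ r (w * D.τ r⁻¹ (D.e u)) = D.κ r (D.τ r⁻¹ (D.e u)) at h1
    rwa [map_mul, h2, hu] at h1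
  refine eq_top_iff.2 fun f _ => ?_
  have h : f = f * w := D.κ_ext _ _ fun r => by
    rw [map_mul, hunit, hu]
  rw [h]
  exact wstarClosure_map_mem (f := fun x => f * x)
    (fun φ hφ => continuous_wstar (D.isAlgDual_right.mul_left_mem φ hφ f))
    (fun g hg => subset_wstarClosure _ _ (D.mul_mem_span_orbit f hg)) ((hW _).1 w.2)

theorem isWStarEnvelopingAction (D : EnvelopingData P γ Q δ) : IsWStarEnvelopingAction P γ Q δ where
  isPredual_left := D.isPredual_left
  isWStarPartialAction_left := D.isWStarPartialAction_left
  isPredual_right := D.isPredual_right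
  isWStarPartialAction_right := D.isWStarPartialAction_right
  isGlobal := D.dom_right
  exists_ideal := ⟨D.ideal, D.equiv, D.isWStarIdeal_ideal, D.continuous_equiv,
    D.continuous_equiv_symm, D.isMorphism_equiv, D.isMorphism_equiv_symm,
    D.wstarClosure_span_orbit⟩

end EnvelopingData

end EnvelopingCriterion

namespace WStarFellBundle

open FellBundle

variable {G : Type u} [Group G] {M : WStarFellBundle.{u, v} G}

/-! ### The canonical action on the centre -/

variable (M) in
theorem isPredual_kernelPredual : IsPredual M.kernelPredual :=
  (isPredual_linfty M).restrict (isClosed_kernelAlg M)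

variable (M) in
theorem isAlgDual_kernelPredual : IsAlgDual M.kernelPredual :=
  (isAlgDual_linfty M).restrict (kernelAlg M)

variable (M) in
theorem isPredual_kernelCentre : IsPredual (restrictPredual M.kernelPredual M.kernelCentre) :=
  (isPredual_kernelPredual M).restrict
    (isClosed_center (isPredual_kernelPredual M) (isAlgDual_kernelPredual M))

variable (M) in
theorem isAlgDual_kernelCentre :
    IsAlgDual (A := M.kernelCentre) (restrictPredual M.kernelPredual M.kernelCentre) :=
  (isAlgDual_kernelPredual M).restrict M.kernelCentre

theorem exists_kernelCentre_functional {φ : StrongDual ℂ (LInfOp M)}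
    (hφ : φ ∈ linftyPredual (opPredual M)) :
    ∃ ψ ∈ restrictPredual M.kernelPredual M.kernelCentre, ∀ f : M.kernelCentre, φ f.1.1 = ψ f :=
  ⟨_, restrictFunctional_mem (restrictFunctional_mem hφ), fun _ => rfl⟩

theorem canonicalAction_dom (t : G) : M.canonicalAction.dom t = Set.univ :=
  Set.eq_univ_of_forall fun f => ⟨⟨translateHom t⁻¹ f.1, trivial⟩, translateHom_mem _ f.2, by
    change translateHom t (translateHom t⁻¹ f.1) = f.1
    rw [translateHom_translateHom, mul_inv_cancel, translateHom_one]⟩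

theorem restrict_canonicalAction_dom (t : G) :
    (M.canonicalAction.restrict M.kernelCentre).dom t = Set.univ := by
  refine Set.eq_univ_of_forall fun f => ?_
  refine ⟨⟨(translateCentre t⁻¹ f).1, by rw [canonicalAction_dom]; trivial⟩,
    (translateCentre t⁻¹ f).2, Subtype.ext ?_⟩
  change translateHom t (translateHom t⁻¹ f.1.1) = f.1.1
  rw [translateHom_translateHom, mul_inv_cancel, translateHom_one]

/-! ### The embedding of the centre of the unit fibre -/

/-- The central element of the W*-algebra of kernels with the diagonal entries `σ_r(z)`. -/
def centralKernel (z : M.centre) : M.kernelCentre := (exists_kernelCentre z).choose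

theorem norm_centralKernel_le (z : M.centre) : ‖(centralKernel z).1.1‖ ≤ ‖z‖ :=
  (exists_kernelCentre z).choose_spec.1

theorem diagEntry_centralKernel (r : G) (z : M.centre) :
    diagEntry r (centralKernel z).1.1 = centralFun r z :=
  (exists_kernelCentre z).choose_spec.2 r

/-- The matrix coefficients of `centralKernel z`. -/
theorem centralKernel_apply_apply (z : M.centre) (r t : G) (η : L2 M) :
    (((centralKernel z).1.1 t).1 η) (r * t) =
      M.mul (one_mul (r * t)) (centralFun r z) (η (r * t)) := by
  -- Multiplication by the unit of M_e placed at (r,r) isolates the row r t of the operator at t.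
  have h1 := entryKernel_mul_kernelCentre' (centralKernel z) (one_mul r) M.unit
  rw [diagEntry_centralKernel,
    show M.mul (mul_one 1) M.unit (centralFun r z) = centralFun r z from unit_mul _] at h1
  have h2 := congrArg (fun f : LInfOp M => ((f t).1 η) (r * t)) h1
  have h3 : ∀ T : Op M, ((elemOp (mul_eq_mul_right (one_mul r) t) M.unit * T).1 η) (r * t) =
      (T.1 η) (r * t) := fun T => by
    change ((elemOp (mul_eq_mul_right (one_mul r) t) M.unit).1 (T.1 η)) (r * t) = _
    rw [elemOp_apply, L2.single_same]
    exact unit_mul_fiber _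
  refine (h3 _).symm.trans (h2.trans ?_)
  change ((elemOp (mul_eq_mul_right (one_mul r) t) (centralFun r z)).1 η) (r * t) = _
  rw [elemOp_apply, L2.single_same]

/-- The central element was obtained by choice, but it is unique by `kernelCentre_ext`, hence linear
in z. -/
theorem centralKernel_add (z w : M.centre) :
    (centralKernel (z + w)).1.1 = (centralKernel z).1.1 + (centralKernel w).1.1 := by
  refine congrArg (fun f : M.kernelCentre => f.1.1) (kernelCentre_ext
    (g := ⟨⟨_, add_mem (centralKernel z).1.2 (centralKernel w).1.2⟩,
      add_mem (centralKernel z).2 (centralKernel w).2⟩) fun r => ?_)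
  rw [map_add, diagEntry_centralKernel, diagEntry_centralKernel, diagEntry_centralKernel]
  exact map_add (centralCLM r) z w

theorem centralKernel_smul (c : ℂ) (z : M.centre) :
    (centralKernel (c • z)).1.1 = c • (centralKernel z).1.1 := by
  refine congrArg (fun f : M.kernelCentre => f.1.1) (kernelCentre_ext
    (g := ⟨⟨_, SMulMemClass.smul_mem c (centralKernel z).1.2⟩,
      M.kernelCentre.smul_mem' c (centralKernel z).2⟩) fun r => ?_)
  rw [map_smul, diagEntry_centralKernel, diagEntry_centralKernel]
  exact map_smul (centralCLM r) c z

/-- `centralKernel`, as a bounded linear map. -/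
def centralKernelCLM : M.centre →L[ℂ] LInfOp M :=
  LinearMap.mkContinuous ⟨⟨fun z => (centralKernel z).1.1, centralKernel_add⟩,
    centralKernel_smul⟩ 1 fun z => by
      rw [one_mul]
      exact norm_centralKernel_le z

/-- Tested on vectors supported at one point, the coefficient in row r t at coordinate t is φ(x*
σ_r(z) η(r t)), so weak-star continuity reduces to that of σ_r. -/
theorem comp_centralKernelCLM_mem {φ : StrongDual ℂ (LInfOp M)}
    (hφ : φ ∈ linftyPredual (opPredual M)) :
    φ.comp centralKernelCLM ∈ restrictPredual (M.predual 1) M.centre := by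
  let L := (ContinuousLinearMap.compL ℂ M.centre (LInfOp M) ℂ).flip centralKernelCLM
  let E (t : G) := (ContinuousLinearMap.compL ℂ (LInfOp M) (Op M) ℂ).flip
    (lp.evalCLM ℂ (fun _ : G => Op M) ∞ t)
  have h1 : ∀ t : G, opPredual M ≤ (restrictPredual (M.predual 1) M.centre).comap
      (L.toLinearMap ∘ₗ (E t).toLinearMap) := by
    intro t
    refine opPredual_le (M.isPredual_centre.isClosed.preimage
      (L.continuous.comp (E t).continuous)) fun φ hφ q x η => ?_
    obtain ⟨r, rfl⟩ : ∃ r, q = r * t := ⟨q * t⁻¹, (inv_mul_cancel_right q t).symm⟩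
    have h2 := comp_centralCLM_mem r (comp_mulRight_mem (one_mul (r * t)) (η (r * t))
        (comp_mulLeft_mem (inv_mul_cancel (r * t)) (M.adj rfl x) hφ))
    refine (congrArg (· ∈ restrictPredual (M.predual 1) M.centre)
      (ContinuousLinearMap.ext fun z => ?_)).mp h2
    change φ (ip x (M.mul _ (centralFun r z) (η (r * t)))) =
      φ (L2.ipL _ (((centralKernel z).1.1 t).1 η))
    rw [L2.ipL_single_left, centralKernel_apply_apply]
  have h3 : linftyPredual (opPredual M) ≤
      (restrictPredual (M.predual 1) M.centre).comap L.toLinearMap :=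
    linftyPredual_le (M.isPredual_centre.isClosed.preimage L.continuous) fun φ hφ t => h1 t hφ
  exact h3 hφ

/-- For z in I_t the composition law gives σ_{rt⁻¹}(z) = σ_r(σ_{t⁻¹}(z)). -/
theorem centralFun_mul_inv_mem {t : G} {z : M.centre} (hz : (z : M.fiber 1) ∈ fiberIdeal M t)
    (r : G) : centralFun (r * t⁻¹) z ∈ fiberIdeal M r := by
  rw [← centralFun_centralFun r t⁻¹ (w := centralHom t⁻¹ z) (by rwa [inv_inv]) rfl]
  exact centralFun_mem r _

theorem comp_diagHom_mem (r : G) {φ : StrongDual ℂ M.centre}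
    (hφ : φ ∈ restrictPredual (M.predual 1) M.centre) :
    ∃ ψ ∈ restrictPredual M.kernelPredual M.kernelCentre, ∀ f, φ (diagHom r f) = ψ f := by
  obtain ⟨χ, hχ, h⟩ := hφ
  obtain ⟨ψ, hψ, h'⟩ := exists_kernelCentre_functional (comp_diagEntry_mem r hχ)
  exact ⟨ψ, hψ, fun f => (h _).trans (h' f)⟩

theorem comp_translateCentre_mem (t : G) {φ : StrongDual ℂ M.kernelCentre}
    (hφ : φ ∈ restrictPredual M.kernelPredual M.kernelCentre) :
    ∃ ψ ∈ restrictPredual M.kernelPredual M.kernelCentre,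
      ∀ f, φ (translateCentre t f) = ψ f := by
  obtain ⟨_, ⟨χ, hχ, h⟩, h'⟩ := hφ
  obtain ⟨ψ, hψ, h''⟩ := exists_kernelCentre_functional (comp_translateCLM_mem t hχ)
  exact ⟨ψ, hψ, fun f => ((h' _).trans (h _)).trans (h'' f)⟩

theorem comp_centralKernel_mem {φ : StrongDual ℂ M.kernelCentre}
    (hφ : φ ∈ restrictPredual M.kernelPredual M.kernelCentre) :
    ∃ ψ ∈ restrictPredual (M.predual 1) M.centre, ∀ z, φ (centralKernel z) = ψ z := by
  obtain ⟨_, ⟨χ, hχ, h⟩, h'⟩ := hφ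
  exact ⟨_, comp_centralKernelCLM_mem hχ, fun z => (h' _).trans (h _)⟩

variable (M) in
/-- The data that exhibit the canonical action on the centre of the W*-algebra of kernels as an
enveloping action of the central partial action. -/
def envelopingData : EnvelopingData (restrictPredual (M.predual 1) M.centre) (centralAction M)
    (restrictPredual M.kernelPredual M.kernelCentre)
    (M.canonicalAction.restrict M.kernelCentre) where
  isPredual_left := M.isPredual_centre
  isAlgDual_left := M.isAlgDual.restrict M.centre
  isWStarPartialAction_left := isWStarPartialAction_centralAction
  isPredual_right := isPredual_kernelCentre M
  isAlgDual_right := isAlgDual_kernelCentre M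
  σ t z := centralHom t z
  map_left _ _ := rfl
  σ_mem t z := centralFun_mem t z
  σ_one z := Subtype.ext (centralFun_one z)
  σ_mul_inv_mem r _ _ hz := centralFun_mul_inv_mem hz r
  τ := translateCentre
  dom_right := restrict_canonicalAction_dom
  map_right _ _ := rfl
  τ_one := translateCentre_one
  τ_τ := translateCentre_translateCentre
  comp_τ_mem t _ hφ := comp_translateCentre_mem t hφ
  κ := diagHom
  κ_τ r t f := Subtype.ext (diagEntry_translateHom r t f.1.1)
  κ_ext _ _ h := kernelCentre_ext fun r => congrArg Subtype.val (h r)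
  comp_κ_mem r _ hφ := comp_diagHom_mem r hφ
  κ_eq _ _ h := Subtype.ext (diagEntry_eq_centralFun h)
  e := centralKernel
  κ_e r z := Subtype.ext (diagEntry_centralKernel r z)
  comp_e_mem _ hφ := comp_centralKernel_mem hφ

end WStarFellBundle

end

theorem mainTheorem9 {G : Type u} [Group G] (M : WStarFellBundle.{u, v} G) :
    (∃! σ : PartialAction G M.centre, M.IsCentralPartialAction σ) ∧
    ∀ σ : PartialAction G M.centre, M.IsCentralPartialAction σ →
      IsWStarEnvelopingAction (restrictPredual (M.predual 1) M.centre) σ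
        (restrictPredual M.kernelPredual M.kernelCentre)
        (M.canonicalAction.restrict M.kernelCentre) := by
  refine ⟨⟨M.centralAction, WStarFellBundle.isCentralPartialAction_centralAction,
    fun σ hσ => hσ.eq⟩, fun σ hσ => ?_⟩
  rw [hσ.eq]
  exact M.envelopingData.isWStarEnvelopingAction
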